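/- **Setting.** Let $\mathcal C$ (contexts), $S$ (states), $A\neq\emptyset$ (actions) be finite sets, $H\in\mathbb N$, and let $S=S_0\sqcup\dots\sqcup S_H$ be a partition into layers with $S_0=\{s_0\}$, $S_H=\{s_H\}$. Let $P(\cdot\mid s,a)$, for $s\in S_h$, $h<H$, $a\in A$, be a probability distribution supported on $S_{h+1}$ (the same dynamics for every context), $\mathcal D$ a probability distribution on $\mathcal C$, and for each $(c,s,a)$ let $R^c(s,a)$ be a probability distribution on $[0,1]$ with mean $r^c(s,a)$. For $\pi:S\to A$ let $V^{\pi}_{c}$ be the expected total reward $\mathbb E[\sum_{h<H} r^c(s_h,\pi(s_h))]$ of an episode started at $s_0$ and played with $\pi$. Assume minimum reachability: for some $p_{\min}\in(0,1]$ every $\pi:S\to A$ visits every state with probability at least $p_{\min}$. Let $\mathcal F$ be a finite set of functions $\mathcal C\times S\times A\to[0,1]$ that is realizable: some $f_\star\in\mathcal F$ satisfies $f_\star(c,s,a)=r^c(s,a)$ for all $c,a$ and all $s\ne s_H$. The learner knows the layers, $p_{\min}$, $\mathcal F$, $T$ and $\delta$, but not $P$, $\mathcal D$, $R$. In each round $t=1,\dots,T$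 the learner fixes a context-dependent policy $\pi_t:\mathcal C\times S\to A$ from the past observations (and possibly internal randomness), a fresh context $c_t\sim\mathcal D$ is drawn, and a trajectory $(s^t_0,a^t_0,r^t_0,\dots,s^t_{H-1},a^t_{H-1},r^t_{H-1},s^t_H)$ with $s^t_0=s_0$, $a^t_h=\pi_t(c_t;s^t_h)$, $r^t_h\sim R^{c_t}(s^t_h,a^t_h)$, $s^t_{h+1}\sim P(\cdot\mid s^t_h,a^t_h)$ is observed. **Algorithm RM-UCID.** Rounds $i=1,\dots,|A|$ play the constant policies $\pi_i\equiv a_i$, where $A=\{a_1,\dots,a_{|A|}\}$. For $|A|<t\le T$: 1. $\hat f_t\in\arg\min_{f\in\mathcal F}\sum_{i<t}\sum_{h<H}(f(c_i,s^i_h,a^i_h)-r^i_h)^2$. 2. With $N_t(s,a)$, $N_t(s,a,s')$ the numbers of rounds $i<t$ whose trajectory contains $(s,a)$, respectively $(s,a,s')$, put $\bar P_t(s'\mid s,a)=N_t(s,a,s')/\max\{1,N_t(s,a)\}$ and $\xi_t(s,a)=2\sqrt{\frac{|S|+2\log(4|S||A|T^2/\delta)}{\max\{1,N_t(s,a)\}}}$.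 3. For every context $c$ put $\hat r^c_t(s,a)=\hat f_t(c,s,a)+\dfrac{\beta_t}{p_{\min}\sum_{i<t}\mathbb I[a=\pi_i(c;s)]}$ with $\beta_t=\sqrt{\frac{17\,t\log(8|\mathcal F|t^3/\delta)}{|S||A|}}$. 4. For every context $c$ let $\hat q$ maximize $\sum_{h<H}\sum_{s\in S_h}\sum_a \hat r^c_t(s,a)\sum_{s'\in S_{h+1}}q(s,a,s')$ over $q\in[0,1]^{S\times A\times S}$ subject to: $\sum_{s\in S_h,\,a,\,s'\in S_{h+1}}q(s,a,s')=1$ for $h<H$; $\sum_{s'\in S_{h+1},\,a}q(s,a,s')=\sum_{s'\in S_{h-1},\,a}q(s',a,s)$ for $1\le h<H$, $s\in S_h$; and $\sum_{s'\in S_{h+1}}\bigl|q(s,a,s')-\bar P_t(s'\mid s,a)\,m_q(s,a)\bigr|\le\xi_t(s,a)\,m_q(s,a)$ for $h<H$, $s\in S_h$, $a\in A$, where $m_q(s,a)=\sum_{s''\in S_{h+1}}q(s,a,s'')$. Let $\hat P^c_t(s'\mid s,a)=\hat q(s,a,s')/m_{\hat q}(s,a)$ for $s'\in S_{h+1}$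 where $m_{\hat q}(s,a)>0$; where $m_{\hat q}(s,a)=0$ let $\hat P^c_t(\cdot\mid s,a)$ be any distribution on $S_{h+1}$ with $\|\hat P^c_t(\cdot\mid s,a)-\bar P_t(\cdot\mid s,a)\|_1\le\xi_t(s,a)$. 5. $\pi_t(c;\cdot)$ is a deterministic policy that is optimal from $s_0$ in the MDP with dynamics $\hat P^c_t$ and rewards $\hat r^c_t$. All ties may be broken arbitrarily. Let $\pi^\star$ be an optimal deterministic context-dependent policy and $\mathrm{Regret}_T=\sum_{t=1}^T\bigl(V^{\pi^\star(c_t;\cdot)}_{c_t}-V^{\pi_t(c_t;\cdot)}_{c_t}\bigr)$. **Theorem.** There is a universal constant $K>0$ such that in this setting, for every $T\ge|S||A|$ and $\delta\in(0,1)$, with probability at least $1-\delta$, $$\mathrm{Regret}_T\le K\Bigl(H^{1.5}|S|\sqrt{T|A|}\,\log\tfrac{|S||A|T^2}{\delta}+\Bigl(H+\tfrac{1+\log(T/|A|)}{p_{\min}}\Bigr)\sqrt{|S||A|T\log\tfrac{8|\mathcal F|T^3}{\delta}}+|A|H\Bigr),$$ that is, $\widetilde O\bigl(H^{1.5}|S|\sqrt{T|A|}\log\frac1\delta+(H+\frac1{p_{\min}})\sqrt{|S||A|T\log\frac{|\mathcal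 F|}{\delta}}+|A|H\bigr)$. Moreover, if $\mathcal F=\mathcal G^S$, i.e. $\mathcal F$ consists of all $f(c,s,a)=g_s(c,a)$ with $g_s\in\mathcal G$ for a finite set $\mathcal G$ of functions on $\mathcal C\times A$, then with probability at least $1-\delta$, $$\mathrm{Regret}_T\le K\Bigl(H^{1.5}|S|\sqrt{T|A|}\,\log\tfrac{|S||A|T^2}{\delta}+\Bigl(H+\tfrac{1+\log(T/|A|)}{p_{\min}}\Bigr)|S|\sqrt{|A|T\log\tfrac{8|\mathcal G|T^3}{\delta}}+|A|H\Bigr).$$ -/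

import Mathlib

open MeasureTheory Finset

noncomputable section

namespace RMUCID

/-- A partition of the finite state space into layers `S_0, …, S_H` with a unique start state and a
unique final state: `S_0 = {s0}` and `S_H = {sH}`. -/
structure Layering (S : Type*) (H : ℕ) where
  layer : S → ℕ
  layer_le : ∀ s, layer s ≤ H
  s0 : S
  sH : S
  layer_eq_zero_iff : ∀ s, layer s = 0 ↔ s = s0
  layer_eq_H_iff : ∀ s, layer s = H ↔ s = sH

open scoped Classical in
/-- The layer `S_h`. -/
def Layering.states {S : Type*} [Fintype S] {H : ℕ} (L : Layering S H) (h : ℕ) : Finset S :=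
  univ.filter fun s => L.layer s = h

/-- `P(· | s, a)` is a probability vector supported on the layer that follows the one of `s`, for
every non-final state `s` and every action `a` (no transition is made from the final state). -/
structure Layering.IsDynamics {S A : Type*} [Fintype S] {H : ℕ} (L : Layering S H)
    (P : S → A → S → ℝ) : Prop where
  nonneg : ∀ s a s', L.layer s < H → 0 ≤ P s a s'
  sum_eq_one : ∀ s a, L.layer s < H → ∑ s', P s a s' = 1
  eq_zero : ∀ s a s', L.layer s < H → L.layer s' ≠ L.layer s + 1 → P s a s' = 0

/-- A layered contextual MDP with context-independent dynamics `P`, context distribution `D`, and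
reward distributions `R c s a` on `[0,1]`. -/
structure CMDP (C S A : Type*) [Fintype C] [Fintype S] (H : ℕ) where
  lay : Layering S H
  P : S → A → S → ℝ
  isDynamics : lay.IsDynamics P
  D : C → ℝ
  D_nonneg : ∀ c, 0 ≤ D c
  D_sum : ∑ c, D c = 1
  R : C → S → A → Measure ℝ
  R_prob : ∀ c s a, IsProbabilityMeasure (R c s a)
  R_mem : ∀ c s a, ∀ᵐ x ∂(R c s a), x ∈ Set.Icc (0 : ℝ) 1

/-- The expected reward `r^c(s,a)`. -/
def CMDP.r {C S A : Type*} [Fintype C] [Fintype S] {H : ℕ} (M : CMDP C S A H)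
    (c : C) (s : S) (a : A) : ℝ :=
  ∫ x, x ∂(M.R c s a)

/-- The expected total reward collected in `n` steps from `s` by the deterministic policy `π`. -/
def value {S A : Type*} [Fintype S] (P : S → A → S → ℝ) (r : S → A → ℝ) (π : S → A) :
    ℕ → S → ℝ
  | 0, _ => 0
  | n + 1, s => r s (π s) + ∑ s', P s (π s) s' * value P r π n s'

open scoped Classical in
/-- The occupancy measure `q_h(s | π, P)`: the probability that step `h` of an episode started in
`s0` and played with `π` is in state `s`. -/
def occ {S A : Type*} [Fintype S] (P : S → A → S → ℝ) (s0 : S) (π : S → A) : ℕ → S → ℝ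
  | 0, s => if s = s0 then 1 else 0
  | h + 1, s => ∑ s', occ P s0 π h s' * P s' (π s') s

/-- The value `V^π_{M(c)}(s0)` in the true model of context `c`. -/
def CMDP.V {C S A : Type*} [Fintype C] [Fintype S] {H : ℕ} (M : CMDP C S A H)
    (c : C) (π : S → A) : ℝ :=
  value M.P (M.r c) π H M.lay.s0

/-- Minimum reachability: every deterministic policy visits every state of every layer with
probability at least `pmin`. -/
def CMDP.MinReach {C S A : Type*} [Fintype C] [Fintype S] {H : ℕ} (M : CMDP C S A H)
    (pmin : ℝ) : Prop :=
  ∀ (π : S → A) (s : S), pmin ≤ occ M.P M.lay.s0 π (M.lay.layer s) s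

/-- `πs` is an optimal deterministic context-dependent policy of the true model. -/
def CMDP.IsOptimal {C S A : Type*} [Fintype C] [Fintype S] {H : ℕ} (M : CMDP C S A H)
    (πs : C → S → A) : Prop :=
  ∀ c (π : S → A), M.V c π ≤ M.V c (πs c)

/-- What is observed in one episode: `(c; s_0, a_0, r_0, …, s_{H-1}, a_{H-1}, r_{H-1}, s_H)`.
Only the entries `st h` for `h ≤ H` and `act h`, `rew h` for `h < H` are meaningful. -/
structure Episode (C S A : Type*) where
  ctx : C
  st : ℕ → S
  act : ℕ → A
  rew : ℕ → ℝ

/-! ### The algorithm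

A history is `σ : ℕ → Episode C S A`, where `σ i` is the episode of round `i = 1, 2, …`; all
quantities of round `t` depend on `σ i` for `1 ≤ i < t` only. The algorithm knows the layering `L`,
the function class `F`, the number of rounds `T`, the confidence `δ` and `pmin`. -/

section Algorithm

variable {C S A : Type*} [Fintype S] [Fintype A]

open scoped Classical in
/-- `N_t(s,a)`: the number of rounds before round `t` whose episode contains `(s,a)`. -/
def visits (H : ℕ) (σ : ℕ → Episode C S A) (t : ℕ) (s : S) (a : A) : ℕ :=
  #{i ∈ Ico 1 t | ∃ h < H, (σ i).st h = s ∧ (σ i).act h = a}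

open scoped Classical in
/-- `N_t(s,a,s')`. -/
def visitsNext (H : ℕ) (σ : ℕ → Episode C S A) (t : ℕ) (s : S) (a : A) (s' : S) : ℕ :=
  #{i ∈ Ico 1 t | ∃ h < H, (σ i).st h = s ∧ (σ i).act h = a ∧ (σ i).st (h + 1) = s'}

/-- The empirical dynamics of round `t`. -/
def empP (H : ℕ) (σ : ℕ → Episode C S A) (t : ℕ) (s : S) (a : A) (s' : S) : ℝ :=
  (visitsNext H σ t s a s' : ℝ) / max 1 (visits H σ t s a : ℝ)

/-- The confidence radius `ξ_t(s,a)`. -/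
def xi (H T : ℕ) (δ : ℝ) (σ : ℕ → Episode C S A) (t : ℕ) (s : S) (a : A) : ℝ :=
  2 * Real.sqrt
    ((Fintype.card S + 2 * Real.log (4 * Fintype.card S * Fintype.card A * (T : ℝ) ^ 2 / δ))
      / max 1 (visits H σ t s a : ℝ))

/-- The squared loss of `f` on the data of the rounds before round `t`. -/
def sqLoss (H : ℕ) (σ : ℕ → Episode C S A) (t : ℕ) (f : C → S → A → ℝ) : ℝ :=
  ∑ i ∈ Ico 1 t, ∑ h ∈ range H,
    (f (σ i).ctx ((σ i).st h) ((σ i).act h) - (σ i).rew h) ^ 2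

/-- `f` is a possible answer of the least squares regression oracle in round `t`. -/
def IsLSR (H : ℕ) (F : Finset (C → S → A → ℝ)) (σ : ℕ → Episode C S A) (t : ℕ)
    (f : C → S → A → ℝ) : Prop :=
  f ∈ F ∧ ∀ g ∈ F, sqLoss H σ t f ≤ sqLoss H σ t g

variable (S A) in
/-- The tuning parameter `β_t`, for a class of `n` functions. -/
def beta (n : ℕ) (δ : ℝ) (t : ℕ) : ℝ :=
  Real.sqrt (17 * t * Real.log (8 * n * (t : ℝ) ^ 3 / δ)
    / (Fintype.card S * Fintype.card A))

open scoped Classical in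
/-- The optimistic reward function of round `t` for context `c`, where `b` is the tuning parameter
of the round, `f` the estimate of the round, and `pol i` the policy of round `i`. -/
def rhat (b pmin : ℝ) (f : C → S → A → ℝ) (pol : ℕ → C → S → A) (t : ℕ) (c : C)
    (s : S) (a : A) : ℝ :=
  f c s a + b / (pmin * ∑ i ∈ Ico 1 t, if a = pol i c s then (1 : ℝ) else 0)

variable {H : ℕ}

/-- The mass that `q` gives to `(s,a)` (with successor in the next layer). -/
def mass (L : Layering S H) (q : S → A → S → ℝ) (s : S) (a : A) : ℝ :=
  ∑ s' ∈ L.states (L.layer s + 1), q s a s'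

/-- The constraints of the linear program over extended occupancy measures, for the empirical
dynamics `Pbar` and the confidence radii `ξ`. -/
structure LPFeasible (L : Layering S H) (Pbar : S → A → S → ℝ) (ξ : S → A → ℝ)
    (q : S → A → S → ℝ) : Prop where
  mem_Icc : ∀ s a s', q s a s' ∈ Set.Icc (0 : ℝ) 1
  total : ∀ h < H, ∑ s ∈ L.states h, ∑ a, ∑ s' ∈ L.states (h + 1), q s a s' = 1
  flow : ∀ h, 1 ≤ h → h < H → ∀ s ∈ L.states h,
    ∑ s' ∈ L.states (h + 1), ∑ a, q s a s' = ∑ s' ∈ L.states (h - 1), ∑ a, q s' a s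
  conf : ∀ h < H, ∀ s ∈ L.states h, ∀ a,
    ∑ s' ∈ L.states (h + 1), |q s a s' - Pbar s a s' * ∑ s'' ∈ L.states (h + 1), q s a s''|
      ≤ ξ s a * ∑ s'' ∈ L.states (h + 1), q s a s''

/-- The objective of the linear program. -/
def lpObj (L : Layering S H) (r : S → A → ℝ) (q : S → A → S → ℝ) : ℝ :=
  ∑ h ∈ range H, ∑ s ∈ L.states h, ∑ a, r s a * ∑ s' ∈ L.states (h + 1), q s a s'

/-- `Phat` is a dynamics induced by `q`: `q(s,a,s') / ∑_{s''} q(s,a,s'')` where the denominator is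
positive; where it vanishes the quotient is undefined and `Phat(·|s,a)` may be any distribution on
the next layer within the confidence radius. -/
structure IsInduced (L : Layering S H) (Pbar : S → A → S → ℝ) (ξ : S → A → ℝ)
    (q Phat : S → A → S → ℝ) : Prop where
  isDynamics : L.IsDynamics Phat
  eq_div : ∀ s a, L.layer s < H → mass L q s a ≠ 0 → ∀ s' ∈ L.states (L.layer s + 1),
    Phat s a s' = q s a s' / mass L q s a
  conf : ∀ s a, L.layer s < H → mass L q s a = 0 → ∑ s', |Phat s a s' - Pbar s a s'| ≤ ξ s a

/-- `π` is a possible output policy of the subroutine FOA for the reward function `r`: solve the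
linear program, form the induced dynamics, and take a deterministic policy that is optimal for
it. -/
def IsFOA (L : Layering S H) (Pbar : S → A → S → ℝ) (ξ : S → A → ℝ) (r : S → A → ℝ)
    (π : S → A) : Prop :=
  ∃ q Phat : S → A → S → ℝ,
    LPFeasible L Pbar ξ q ∧
    (∀ q', LPFeasible L Pbar ξ q' → lpObj L r q' ≤ lpObj L r q) ∧
    IsInduced L Pbar ξ q Phat ∧
    ∀ π' : S → A, value Phat r π' H L.s0 ≤ value Phat r π H L.s0

/-- The context-dependent policies `pol 1, …, pol T` are chosen by RM-UCID along the history `σ`: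
the first `|A|` rounds play the constant policies, in the order `a_1, a_2, …` given by `enum`;
afterwards `pol t c` is, for every context `c`, an output of FOA for the optimistic reward function
built from a least squares estimate and the previous policies. -/
structure IsRun (L : Layering S H) (F : Finset (C → S → A → ℝ)) (T : ℕ) (δ pmin : ℝ)
    (enum : Fin (Fintype.card A) ≃ A) (σ : ℕ → Episode C S A) (pol : ℕ → C → S → A) : Prop where
  init : ∀ i : Fin (Fintype.card A), ∀ c s, pol (i + 1) c s = enum i
  step : ∀ t, Fintype.card A < t → t ≤ T → ∃ f, IsLSR H F σ t f ∧
    ∀ c, IsFOA L (empP H σ t) (xi H T δ σ t)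
      (rhat (beta S A #F δ t) pmin f pol t c) (pol t c)

end Algorithm

/-- The interaction protocol. `𝓕 t` is the information available before round `t` (it contains the
observed history, and possibly internal randomness of the learner); `pol t` is the policy of round
`t` and `σ t` the episode that is observed in it. Given `𝓕 t`, the context is drawn from `D` and
the trajectory is generated by `pol t` in the model of the drawn context: this is `law`, which gives
the conditional distribution of contexts, state sequences and rewards. -/
structure IsInteraction {C S A Ω : Type*} [Fintype C] [Fintype S] {H : ℕ}
    {mΩ : MeasurableSpace Ω} (M : CMDP C S A H) (T : ℕ) (μ : Measure Ω) (𝓕 : Filtration ℕ mΩ)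
    (σ : ℕ → Ω → Episode C S A) (pol : ℕ → Ω → C → S → A) : Prop where
  pol_meas : ∀ t ∈ Icc 1 T, ∀ p, MeasurableSet[𝓕 t] {ω | pol t ω = p}
  ctx_meas : ∀ t ∈ Icc 1 T, ∀ c, MeasurableSet[𝓕 (t + 1)] {ω | (σ t ω).ctx = c}
  st_meas : ∀ t ∈ Icc 1 T, ∀ h ≤ H, ∀ s, MeasurableSet[𝓕 (t + 1)] {ω | (σ t ω).st h = s}
  act_meas : ∀ t ∈ Icc 1 T, ∀ h < H, ∀ a, MeasurableSet[𝓕 (t + 1)] {ω | (σ t ω).act h = a}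
  rew_meas : ∀ t ∈ Icc 1 T, ∀ h < H, Measurable[𝓕 (t + 1)] fun ω => (σ t ω).rew h
  start : ∀ t ∈ Icc 1 T, ∀ᵐ ω ∂μ, (σ t ω).st 0 = M.lay.s0
  act_eq : ∀ t ∈ Icc 1 T, ∀ h < H, ∀ᵐ ω ∂μ,
    (σ t ω).act h = pol t ω (σ t ω).ctx ((σ t ω).st h)
  law : ∀ t ∈ Icc 1 T, ∀ (p : C → S → A) (E : Set Ω),
    MeasurableSet[𝓕 t] E → (∀ ω ∈ E, pol t ω = p) →
    ∀ (c : C) (x : ℕ → S) (B : ℕ → Set ℝ), x 0 = M.lay.s0 → (∀ h, MeasurableSet (B h)) →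
      μ.real {ω ∈ E | (σ t ω).ctx = c ∧ (∀ h ≤ H, (σ t ω).st h = x h) ∧
          ∀ h < H, (σ t ω).rew h ∈ B h}
        = μ.real E * M.D c *
          ∏ h ∈ range H,
            ((M.R c (x h) (p c (x h))).real (B h) * M.P (x h) (p c (x h)) (x (h + 1)))

/-- The regret of the policies `pol 1, …, pol T` on the contexts of the history `σ`, relative to
the policy `πs`. -/
def regret {C S A : Type*} [Fintype C] [Fintype S] {H : ℕ} (M : CMDP C S A H) (T : ℕ)
    (πs : C → S → A) (σ : ℕ → Episode C S A) (pol : ℕ → C → S → A) : ℝ :=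
  ∑ t ∈ Icc 1 T, (M.V (σ t).ctx (πs (σ t).ctx) - M.V (σ t).ctx (pol t (σ t).ctx))

end RMUCID

end

/-!
The policy of a round is optimal for the best dynamics in the confidence set and for a reward
estimate with an added bonus. If the true dynamics lie in the confidence set, then their extended
occupancy measures are feasible for the linear program, and so the regret of the round is controlled
by the bonuses of the played actions, the confidence radii along the played policy, and the amount
by which the error `|f - r|` of the estimate `f` exceeds the bonus along the optimal and the played
policy. That excess is handled by `|d| ≤ b / w + w d² / (4 b)`, where `b / w` is the bonus and `w`
is `pmin` times the number of earlier policies that play the same action: since each of these visits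
every state with probability at least `pmin`, the sum of `w d²` is at most the expected squared
error of the estimate under the earlier policies, which is what the least squares estimate controls.

All concentration inequalities are instances of one: if `E[exp Y_t | 𝓕_t] ≤ 1` in every round, then
`∑ Y_t < log (1 / ε)` with probability at least `1 - ε`. For the squared losses, the contexts and
the visited pairs, `Y_t` compares a bounded variable with a constant multiple of its mean, which
costs no factor `√T`; for the transitions it is a Hoeffding exponent for each sign pattern on the
states. It remains to sum `1 / w` over the rounds, which gives a logarithm, and `1 / √N_t(s, a)`
over the observed steps, which gives a square root.
-/

noncomputable section

namespace RMUCID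

section Planning

lemma Layering.layer_s0 {S : Type*} {H : ℕ} (L : Layering S H) : L.layer L.s0 = 0 :=
  (L.layer_eq_zero_iff _).2 rfl

variable {S A : Type*} [Fintype S] {H : ℕ} {L : Layering S H} {P Q : S → A → S → ℝ}

lemma Layering.mem_states {h : ℕ} {s : S} : s ∈ L.states h ↔ L.layer s = h := by
  simp [Layering.states]

lemma sum_occ_zero_mul (P : S → A → S → ℝ) (s0 : S) (π : S → A) (u : S → ℝ) :
    ∑ s, occ P s0 π 0 s * u s = u s0 := by
  classical
  simp [occ]

lemma sum_occ_succ_mul (P : S → A → S → ℝ) (s0 : S) (π : S → A) (h : ℕ) (u : S → ℝ) :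
    ∑ s, occ P s0 π (h + 1) s * u s
      = ∑ s, occ P s0 π h s * ∑ s', P s (π s) s' * u s' := by
  simp only [occ, sum_mul, mul_sum]
  rw [sum_comm]
  exact sum_congr rfl fun s _ => sum_congr rfl fun s' _ => by ring

namespace Layering.IsDynamics

lemma occ_eq_zero (hP : L.IsDynamics P) (π : S → A) {h : ℕ} (hh : h ≤ H) {s : S}
    (hs : L.layer s ≠ h) : occ P L.s0 π h s = 0 := by
  induction h generalizing s with
  | zero => exact if_neg fun e => hs ((L.layer_eq_zero_iff s).2 e)
  | succ h ih =>
    refine sum_eq_zero fun s' _ => ?_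
    by_cases h' : L.layer s' = h
    · rw [hP.eq_zero s' _ s (by omega) (by omega), mul_zero]
    · rw [ih (by omega) h', zero_mul]

lemma occ_nonneg (hP : L.IsDynamics P) (π : S → A) {h : ℕ} (hh : h ≤ H) (s : S) :
    0 ≤ occ P L.s0 π h s := by
  induction h generalizing s with
  | zero => simp only [occ]; positivity
  | succ h ih =>
    refine sum_nonneg fun s' _ => ?_
    by_cases h' : L.layer s' = h
    · exact mul_nonneg (ih (by omega) s') (hP.nonneg _ _ _ (by omega))
    · rw [hP.occ_eq_zero π (by omega) h', zero_mul]

lemma sum_occ (hP : L.IsDynamics P) (π : S → A) {h : ℕ} (hh : h ≤ H) :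
    ∑ s, occ P L.s0 π h s = 1 := by
  induction h with
  | zero => simpa using sum_occ_zero_mul P L.s0 π 1
  | succ h ih =>
    simp only [occ]
    rw [sum_comm, ← ih (by omega)]
    refine sum_congr rfl fun s' _ => ?_
    rw [← mul_sum]
    by_cases h' : L.layer s' = h
    · rw [hP.sum_eq_one _ _ (by omega), mul_one]
    · rw [hP.occ_eq_zero π (by omega) h', zero_mul]

lemma occ_le_one (hP : L.IsDynamics P) (π : S → A) {h : ℕ} (hh : h ≤ H) (s : S) :
    occ P L.s0 π h s ≤ 1 := by
  rw [← hP.sum_occ π hh]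
  exact single_le_sum (fun s _ => hP.occ_nonneg π hh s) (mem_univ s)

lemma sum_states_succ (hP : L.IsDynamics P) {s : S} (a : A) (hs : L.layer s < H) (u : S → ℝ) :
    ∑ s' ∈ L.states (L.layer s + 1), P s a s' * u s' = ∑ s', P s a s' * u s' := by
  refine sum_subset (subset_univ _) fun s' _ hs' => ?_
  rw [hP.eq_zero s a s' hs fun e => hs' (mem_states.2 e), zero_mul]

lemma sum_states_succ_eq_one (hP : L.IsDynamics P) {s : S} (a : A) (hs : L.layer s < H) :
    ∑ s' ∈ L.states (L.layer s + 1), P s a s' = 1 := by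
  simpa only [mul_one, hP.sum_eq_one s a hs] using hP.sum_states_succ a hs fun _ => 1

end Layering.IsDynamics

/-- The expected sum of `u` over the states `s_0, …, s_{H-1}` of an episode that is played with
`π` under the dynamics `P`. -/
def expectedSum (L : Layering S H) (P : S → A → S → ℝ) (π : S → A) (u : S → ℝ) : ℝ :=
  ∑ h ∈ range H, ∑ s, occ P L.s0 π h s * u s

section ExpectedSum

lemma expectedSum_add (π : S → A) (u v : S → ℝ) :
    expectedSum L P π (fun s => u s + v s) = expectedSum L P π u + expectedSum L P π v := by
  simp only [expectedSum, mul_add, sum_add_distrib]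

lemma expectedSum_const_mul (π : S → A) (k : ℝ) (u : S → ℝ) :
    expectedSum L P π (fun s => k * u s) = k * expectedSum L P π u := by
  simp only [expectedSum, mul_left_comm _ k, ← mul_sum]

lemma expectedSum_eq_sum_layer (hP : L.IsDynamics P) (π : S → A) (u : S → ℝ) :
    expectedSum L P π u = ∑ s with L.layer s < H, occ P L.s0 π (L.layer s) s * u s := by
  rw [expectedSum, sum_comm, sum_filter]
  refine sum_congr rfl fun s _ => ?_
  split_ifs with hs
  · refine sum_eq_single_of_mem (L.layer s) (mem_range.2 hs) fun h hh hne => ?_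
    rw [hP.occ_eq_zero π (mem_range.1 hh).le hne.symm, zero_mul]
  · refine sum_eq_zero fun h hh => ?_
    have := mem_range.1 hh
    rw [hP.occ_eq_zero π this.le (by omega), zero_mul]

lemma expectedSum_le_sum (hP : L.IsDynamics P) (π : S → A) {u : S → ℝ} (hu : ∀ s, 0 ≤ u s) :
    expectedSum L P π u ≤ ∑ s with L.layer s < H, u s := by
  rw [expectedSum_eq_sum_layer hP]
  exact sum_le_sum fun s _ => mul_le_of_le_one_left (hu s) (hP.occ_le_one π (L.layer_le s) s)

lemma expectedSum_mono (hP : L.IsDynamics P) (π : S → A) {u v : S → ℝ}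
    (huv : ∀ s, L.layer s < H → u s ≤ v s) : expectedSum L P π u ≤ expectedSum L P π v := by
  rw [expectedSum_eq_sum_layer hP, expectedSum_eq_sum_layer hP]
  exact sum_le_sum fun s hs => mul_le_mul_of_nonneg_left (huv s (mem_filter.1 hs).2)
    (hP.occ_nonneg π (L.layer_le s) s)

lemma expectedSum_nonneg (hP : L.IsDynamics P) (π : S → A) {u : S → ℝ}
    (hu : ∀ s, L.layer s < H → 0 ≤ u s) : 0 ≤ expectedSum L P π u := by
  rw [expectedSum_eq_sum_layer hP]
  exact sum_nonneg fun s hs => mul_nonneg (hP.occ_nonneg π (L.layer_le s) s)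
    (hu s (mem_filter.1 hs).2)

end ExpectedSum

lemma sum_occ_mul_value (P : S → A → S → ℝ) (s0 : S) (r : S → A → ℝ) (π : S → A) (n h : ℕ) :
    ∑ s, occ P s0 π h s * value P r π n s
      = ∑ k ∈ range n, ∑ s, occ P s0 π (h + k) s * r s (π s) := by
  induction n generalizing h with
  | zero => simp [value]
  | succ n ih =>
    simp only [value, mul_add, sum_add_distrib]
    rw [← sum_occ_succ_mul, ih, sum_range_succ', add_comm]
    simp only [add_zero, add_assoc, add_comm 1]

lemma value_eq_expectedSum (L : Layering S H) (P : S → A → S → ℝ) (r : S → A → ℝ) (π : S → A) :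
    value P r π H L.s0 = expectedSum L P π fun s => r s (π s) := by
  rw [← sum_occ_zero_mul P L.s0 π (value P r π H), sum_occ_mul_value]
  simp only [zero_add, expectedSum]

lemma value_succ_sub_value_succ (P Q : S → A → S → ℝ) (r : S → A → ℝ) (π : S → A) (n : ℕ)
    (s : S) :
    value Q r π (n + 1) s - value P r π (n + 1) s
      = ∑ s', (Q s (π s) s' - P s (π s) s') * value Q r π n s'
        + ∑ s', P s (π s) s' * (value Q r π n s' - value P r π n s') := by
  simp only [value]
  rw [← sum_add_distrib, add_sub_add_left_eq_sub, ← sum_sub_distrib]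
  exact sum_congr rfl fun s' _ => by ring

lemma sum_occ_mul_value_sub (P Q : S → A → S → ℝ) (s0 : S) (r : S → A → ℝ) (π : S → A) (n h : ℕ) :
    ∑ s, occ P s0 π h s * (value Q r π n s - value P r π n s)
      = ∑ k ∈ range n, ∑ s, occ P s0 π (h + k) s *
          ∑ s', (Q s (π s) s' - P s (π s) s') * value Q r π (n - 1 - k) s' := by
  induction n generalizing h with
  | zero => simp [value]
  | succ n ih =>
    simp only [value_succ_sub_value_succ, mul_add, sum_add_distrib]
    rw [← sum_occ_succ_mul, ih, sum_range_succ', add_comm]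
    congr 1
    refine sum_congr rfl fun k _ => ?_
    rw [show h + 1 + k = h + (k + 1) by ring, show n + 1 - 1 - (k + 1) = n - 1 - k by omega]

lemma value_sub_value (P Q : S → A → S → ℝ) (s0 : S) (r : S → A → ℝ) (π : S → A) (n : ℕ) :
    value Q r π n s0 - value P r π n s0
      = ∑ h ∈ range n, ∑ s, occ P s0 π h s *
          ∑ s', (Q s (π s) s' - P s (π s) s') * value Q r π (n - 1 - h) s' := by
  rw [← sum_occ_zero_mul P s0 π (fun s => value Q r π n s - value P r π n s),
    sum_occ_mul_value_sub]
  simp only [zero_add]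

lemma Layering.IsDynamics.value_mem_Icc (hP : L.IsDynamics P) {r : S → A → ℝ}
    (hr : ∀ s a, L.layer s < H → r s a ∈ Set.Icc (0 : ℝ) 1) (π : S → A) {n : ℕ} {s : S}
    (hs : L.layer s + n ≤ H) : value P r π n s ∈ Set.Icc (0 : ℝ) n := by
  induction n generalizing s with
  | zero => simp [value]
  | succ n ih =>
    have hlt : L.layer s < H := by omega
    obtain ⟨hr0, hr1⟩ := hr s (π s) hlt
    have hnext : ∀ s', L.layer s' = L.layer s + 1 → value P r π n s' ∈ Set.Icc (0 : ℝ) n :=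
      fun s' hs' => ih (by omega)
    have hP0 : ∀ s', 0 ≤ P s (π s) s' := fun s' => hP.nonneg _ _ _ hlt
    simp only [value, ← hP.sum_states_succ (π s) hlt, Set.mem_Icc]
    push_cast
    refine ⟨add_nonneg hr0 (sum_nonneg fun s' hs' =>
      mul_nonneg (hP0 s') (hnext s' (mem_states.1 hs')).1), ?_⟩
    calc r s (π s) + ∑ s' ∈ L.states (L.layer s + 1), P s (π s) s' * value P r π n s'
        ≤ 1 + ∑ s' ∈ L.states (L.layer s + 1), P s (π s) s' * n := by
          gcongr with s' hs'
          · exact hP0 s'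
          · exact (hnext s' (mem_states.1 hs')).2
      _ = n + 1 := by rw [← sum_mul, hP.sum_states_succ_eq_one _ hlt, one_mul, add_comm]

lemma Layering.IsDynamics.sum_sub_mul_le (hP : L.IsDynamics P) (hQ : L.IsDynamics Q) {s : S}
    (a : A) (hs : L.layer s < H) {v : S → ℝ} {b : ℝ}
    (hv : ∀ s', L.layer s' = L.layer s + 1 → |v s'| ≤ b) :
    ∑ s', (Q s a s' - P s a s') * v s'
      ≤ b * ∑ s' ∈ L.states (L.layer s + 1), |Q s a s' - P s a s'| := by
  simp only [sub_mul, sum_sub_distrib]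
  rw [← hQ.sum_states_succ a hs, ← hP.sum_states_succ a hs, ← sum_sub_distrib, mul_sum]
  refine sum_le_sum fun s' hs' => ?_
  rw [← sub_mul, mul_comm b]
  calc (Q s a s' - P s a s') * v s' ≤ |Q s a s' - P s a s'| * |v s'| := by
        rw [← abs_mul]; exact le_abs_self _
    _ ≤ |Q s a s' - P s a s'| * b := by
        gcongr; exact hv s' (mem_states.1 hs')

lemma value_sub_value_le (hP : L.IsDynamics P) (hQ : L.IsDynamics Q) {r : S → A → ℝ}
    (hr : ∀ s a, L.layer s < H → r s a ∈ Set.Icc (0 : ℝ) 1) (π : S → A) {e : S → ℝ}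
    (he : ∀ s, L.layer s < H →
      ∑ s' ∈ L.states (L.layer s + 1), |Q s (π s) s' - P s (π s) s'| ≤ e s) :
    value Q r π H L.s0 - value P r π H L.s0 ≤ H * expectedSum L P π e := by
  rw [value_sub_value, expectedSum, mul_sum]
  refine sum_le_sum fun h hh => ?_
  have hh := mem_range.1 hh
  rw [mul_sum]
  refine sum_le_sum fun s _ => ?_
  by_cases hs : L.layer s = h
  swap
  · simp [hP.occ_eq_zero π hh.le hs]
  rw [mul_left_comm]
  refine mul_le_mul_of_nonneg_left ?_ (hP.occ_nonneg π hh.le s)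
  calc ∑ s', (Q s (π s) s' - P s (π s) s') * value Q r π (H - 1 - h) s'
      ≤ H * ∑ s' ∈ L.states (L.layer s + 1), |Q s (π s) s' - P s (π s) s'| := by
        refine hP.sum_sub_mul_le hQ _ (by omega) fun s' hs' => ?_
        obtain ⟨h0, h1⟩ := hQ.value_mem_Icc hr π (n := H - 1 - h) (s := s') (by omega)
        rw [abs_of_nonneg h0]
        exact h1.trans (by exact_mod_cast (by omega : H - 1 - h ≤ H))
    _ ≤ H * e s := by
        gcongr; exact he s (by omega)

end Planning

section OptimalValue

variable {S A : Type*} [Fintype S] [Fintype A] [Nonempty A] {H : ℕ} {L : Layering S H}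

/-- The largest expected total reward that can be collected in `n` steps, given by backward
induction. -/
def optValue (P : S → A → S → ℝ) (r : S → A → ℝ) : ℕ → S → ℝ
  | 0, _ => 0
  | n + 1, s => univ.sup' univ_nonempty fun a => r s a + ∑ s', P s a s' * optValue P r n s'

lemma le_optValue_succ (P : S → A → S → ℝ) (r : S → A → ℝ) (n : ℕ) (s : S) (a : A) :
    r s a + ∑ s', P s a s' * optValue P r n s' ≤ optValue P r (n + 1) s :=
  le_sup' (fun a => r s a + ∑ s', P s a s' * optValue P r n s') (mem_univ a)

lemma exists_eq_optValue_succ (P : S → A → S → ℝ) (r : S → A → ℝ) (n : ℕ) (s : S) :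
    ∃ a, optValue P r (n + 1) s = r s a + ∑ s', P s a s' * optValue P r n s' := by
  obtain ⟨a, -, ha⟩ := exists_mem_eq_sup' (univ_nonempty (α := A))
    fun a => r s a + ∑ s', P s a s' * optValue P r n s'
  exact ⟨a, ha⟩

-- The remaining horizon is determined by the layer, so a stationary greedy policy is optimal.
lemma Layering.IsDynamics.exists_value_eq_optValue {P : S → A → S → ℝ} (hP : L.IsDynamics P)
    (r : S → A → ℝ) :
    ∃ π : S → A, ∀ n s, L.layer s + n = H → value P r π n s = optValue P r n s := by
  choose π hπ using fun s => exists_eq_optValue_succ P r (H - L.layer s - 1) s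
  refine ⟨π, fun n => ?_⟩
  induction n with
  | zero => exact fun _ _ => rfl
  | succ n ih =>
    intro s hs
    have hlt : L.layer s < H := by omega
    have hgreedy := hπ s
    rw [show H - L.layer s - 1 = n by omega] at hgreedy
    rw [hgreedy, value, ← hP.sum_states_succ _ hlt, ← hP.sum_states_succ _ hlt]
    congr 1
    refine sum_congr rfl fun s' hs' => ?_
    have := Layering.mem_states.1 hs'
    rw [ih s' (by omega)]

end OptimalValue

section ExtendedOccupancy

variable {S A : Type*} [Fintype S] {H : ℕ} {L : Layering S H}
  {P Pbar : S → A → S → ℝ} {ξ : S → A → ℝ}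

lemma sum_eq_mass (q : S → A → S → ℝ) {h : ℕ} {s : S} (hs : s ∈ L.states h) (a : A) :
    ∑ s' ∈ L.states (h + 1), q s a s' = mass L q s a := by
  rw [mass, Layering.mem_states.1 hs]

open scoped Classical in
/-- The extended occupancy measure of a deterministic policy: the probability of the transition
from `s` by `a` to `s'`. -/
def extOcc (L : Layering S H) (P : S → A → S → ℝ) (π : S → A) (s : S) (a : A) (s' : S) : ℝ :=
  if L.layer s < H ∧ π s = a then occ P L.s0 π (L.layer s) s * P s a s' else 0

lemma extOcc_apply_self (P : S → A → S → ℝ) (π : S → A) {s : S} (hs : L.layer s < H) (s' : S) :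
    extOcc L P π s (π s) s' = occ P L.s0 π (L.layer s) s * P s (π s) s' :=
  if_pos ⟨hs, rfl⟩

lemma extOcc_of_ne (P : S → A → S → ℝ) {π : S → A} {s : S} {a : A} (ha : a ≠ π s) (s' : S) :
    extOcc L P π s a s' = 0 :=
  if_neg fun h => ha h.2.symm

lemma mass_extOcc_self (hP : L.IsDynamics P) (π : S → A) {s : S} (hs : L.layer s < H) :
    mass L (extOcc L P π) s (π s) = occ P L.s0 π (L.layer s) s := by
  simp only [mass, extOcc_apply_self P π hs]
  rw [← mul_sum, hP.sum_states_succ_eq_one _ hs, mul_one]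

lemma mass_extOcc_of_ne (P : S → A → S → ℝ) {π : S → A} {s : S} {a : A} (ha : a ≠ π s) :
    mass L (extOcc L P π) s a = 0 :=
  sum_eq_zero fun s' _ => extOcc_of_ne P ha s'

lemma Layering.IsDynamics.sum_states_occ_mul (hP : L.IsDynamics P) (π : S → A) {h : ℕ}
    (hh : h ≤ H) (u : S → ℝ) :
    ∑ s ∈ L.states h, occ P L.s0 π h s * u s = ∑ s, occ P L.s0 π h s * u s := by
  refine sum_subset (subset_univ _) fun s _ hs => ?_
  rw [hP.occ_eq_zero π hh fun e => hs (mem_states.2 e), zero_mul]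

lemma extOcc_mem_Icc (hP : L.IsDynamics P) (π : S → A) (s : S) (a : A) (s' : S) :
    extOcc L P π s a s' ∈ Set.Icc (0 : ℝ) 1 := by
  unfold extOcc
  split_ifs with hs
  · have hP0 := hP.nonneg s a s' hs.1
    have hP1 : P s a s' ≤ 1 := by
      rw [← hP.sum_eq_one s a hs.1]
      exact single_le_sum (fun s' _ => hP.nonneg s a s' hs.1) (mem_univ s')
    have hocc0 := hP.occ_nonneg π (L.layer_le s) s
    exact ⟨mul_nonneg hocc0 hP0, mul_le_one₀ (hP.occ_le_one π (L.layer_le s) s) hP0 hP1⟩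
  · simp

lemma extOcc_conf (hP : L.IsDynamics P)
    (hconf : ∀ s a, L.layer s < H → ∑ s', |Pbar s a s' - P s a s'| ≤ ξ s a) (π : S → A)
    {s : S} (hs : L.layer s < H) (a : A) :
    ∑ s' ∈ L.states (L.layer s + 1),
        |extOcc L P π s a s' - Pbar s a s' * mass L (extOcc L P π) s a|
      ≤ ξ s a * mass L (extOcc L P π) s a := by
  by_cases ha : a = π s
  swap
  · simp only [extOcc_of_ne P ha, mass_extOcc_of_ne P ha, mul_zero, sub_zero, abs_zero,
      sum_const_zero, le_refl]
  subst ha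
  rw [mass_extOcc_self hP π hs]
  simp only [extOcc_apply_self P π hs]
  have hocc := hP.occ_nonneg π (L.layer_le s) s
  calc ∑ s' ∈ L.states (L.layer s + 1), |occ P L.s0 π (L.layer s) s * P s (π s) s'
          - Pbar s (π s) s' * occ P L.s0 π (L.layer s) s|
      = (∑ s' ∈ L.states (L.layer s + 1), |Pbar s (π s) s' - P s (π s) s'|)
          * occ P L.s0 π (L.layer s) s := by
        rw [sum_mul]
        refine sum_congr rfl fun s' _ => ?_
        rw [mul_comm, ← sub_mul, abs_mul, abs_of_nonneg hocc, abs_sub_comm]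
    _ ≤ ξ s (π s) * occ P L.s0 π (L.layer s) s := by
        refine mul_le_mul_of_nonneg_right (le_trans ?_ (hconf s _ hs)) hocc
        exact sum_le_sum_of_subset_of_nonneg (subset_univ _) fun _ _ _ => abs_nonneg _

variable [Fintype A]

lemma lpObj_eq_sum_mass (r : S → A → ℝ) (q : S → A → S → ℝ) :
    lpObj L r q = ∑ h ∈ range H, ∑ s ∈ L.states h, ∑ a, mass L q s a * r s a :=
  sum_congr rfl fun h _ => sum_congr rfl fun s hs => sum_congr rfl fun a _ => by
    rw [sum_eq_mass q hs, mul_comm]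

lemma sum_mass_extOcc_mul (hP : L.IsDynamics P) (π : S → A) {s : S} (hs : L.layer s < H)
    (u : A → ℝ) :
    ∑ a, mass L (extOcc L P π) s a * u a = occ P L.s0 π (L.layer s) s * u (π s) := by
  rw [Fintype.sum_eq_single (π s) fun a ha => by rw [mass_extOcc_of_ne P ha, zero_mul],
    mass_extOcc_self hP π hs]

lemma sum_states_sum_mass_extOcc_mul (hP : L.IsDynamics P) (π : S → A) {h : ℕ} (hh : h < H)
    (u : S → A → ℝ) :
    ∑ s ∈ L.states h, ∑ a, mass L (extOcc L P π) s a * u s a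
      = ∑ s, occ P L.s0 π h s * u s (π s) := by
  rw [← hP.sum_states_occ_mul π hh.le]
  refine sum_congr rfl fun s hs => ?_
  obtain rfl := Layering.mem_states.1 hs
  exact sum_mass_extOcc_mul hP π hh (u s)

lemma lpObj_extOcc (hP : L.IsDynamics P) (r : S → A → ℝ) (π : S → A) :
    lpObj L r (extOcc L P π) = value P r π H L.s0 := by
  rw [value_eq_expectedSum, lpObj_eq_sum_mass, expectedSum]
  exact sum_congr rfl fun h hh => sum_states_sum_mass_extOcc_mul hP π (mem_range.1 hh) r

lemma extOcc_flow (hP : L.IsDynamics P) (π : S → A) {h : ℕ} (hh : h + 1 < H) {s : S}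
    (hs : s ∈ L.states (h + 1)) :
    ∑ a, mass L (extOcc L P π) s a = ∑ s' ∈ L.states h, ∑ a, extOcc L P π s' a s := by
  have hs := Layering.mem_states.1 hs
  have hmass := sum_mass_extOcc_mul hP π (hs ▸ hh) fun _ => 1
  simp only [mul_one] at hmass
  rw [hmass, hs, occ, ← hP.sum_states_occ_mul π (by omega) fun s' => P s' (π s') s]
  refine sum_congr rfl fun s' hs' => ?_
  obtain rfl := Layering.mem_states.1 hs'
  rw [Fintype.sum_eq_single (π s') fun a ha => extOcc_of_ne P ha s,
    extOcc_apply_self P π (by omega)]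

lemma lpFeasible_extOcc (hP : L.IsDynamics P)
    (hconf : ∀ s a, L.layer s < H → ∑ s', |Pbar s a s' - P s a s'| ≤ ξ s a) (π : S → A) :
    LPFeasible L Pbar ξ (extOcc L P π) where
  mem_Icc := extOcc_mem_Icc hP π
  total h hh := by
    have hmass := sum_states_sum_mass_extOcc_mul hP π hh fun _ _ => 1
    simp only [mul_one, hP.sum_occ π hh.le] at hmass
    rw [← hmass]
    exact sum_congr rfl fun s hs => sum_congr rfl fun a _ => sum_eq_mass _ hs a
  flow h h1 hh s hs := by
    obtain ⟨k, rfl⟩ := Nat.exists_eq_add_of_le' h1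
    rw [sum_comm, Nat.add_sub_cancel, ← extOcc_flow hP π hh hs]
    exact sum_congr rfl fun a _ => sum_eq_mass _ hs a
  conf h hh s hs a := by
    simp only [sum_eq_mass _ hs]
    obtain rfl := Layering.mem_states.1 hs
    exact extOcc_conf hP hconf π hh a

end ExtendedOccupancy

section Optimism

variable {S A : Type*} [Fintype S] {H : ℕ} {L : Layering S H}
  {P Q Pbar q : S → A → S → ℝ} {ξ r : S → A → ℝ}

lemma Layering.IsDynamics.sum_abs_sub_le_two (hP : L.IsDynamics P) (hQ : L.IsDynamics Q) {s : S}
    (hs : L.layer s < H) (a : A) : ∑ s', |Q s a s' - P s a s'| ≤ 2 :=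
  calc ∑ s', |Q s a s' - P s a s'| ≤ ∑ s', (Q s a s' + P s a s') := by
        refine sum_le_sum fun s' _ => ?_
        have hP0 := hP.nonneg s a s' hs
        have hQ0 := hQ.nonneg s a s' hs
        exact abs_le.2 ⟨by linarith, by linarith⟩
    _ = 2 := by
        rw [sum_add_distrib, hP.sum_eq_one _ _ hs, hQ.sum_eq_one _ _ hs, one_add_one_eq_two]

lemma Layering.IsDynamics.sum_abs_sub_le_two_mul_min (hP : L.IsDynamics P) (hQ : L.IsDynamics Q)
    {s : S} (hs : L.layer s < H) {a : A} {e : ℝ}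
    (hPe : ∑ s', |Pbar s a s' - P s a s'| ≤ e)
    (hQe : ∑ s' ∈ L.states (L.layer s + 1), |Q s a s' - Pbar s a s'| ≤ e) :
    ∑ s' ∈ L.states (L.layer s + 1), |Q s a s' - P s a s'| ≤ 2 * min 1 e := by
  have hrestrict : ∀ u : S → ℝ,
      ∑ s' ∈ L.states (L.layer s + 1), |u s'| ≤ ∑ s', |u s'| := fun u =>
    sum_le_sum_of_subset_of_nonneg (subset_univ _) fun _ _ _ => abs_nonneg _
  rw [mul_min_of_nonneg _ _ zero_le_two, mul_one]
  refine le_min ((hrestrict _).trans (hP.sum_abs_sub_le_two hQ hs a)) ?_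
  calc ∑ s' ∈ L.states (L.layer s + 1), |Q s a s' - P s a s'|
      ≤ ∑ s' ∈ L.states (L.layer s + 1), (|Q s a s' - Pbar s a s'| + |Pbar s a s' - P s a s'|) :=
        sum_le_sum fun s' _ => abs_sub_le _ _ _
    _ ≤ e + e := by
        rw [sum_add_distrib]
        exact add_le_add hQe ((hrestrict _).trans hPe)
    _ = 2 * e := (two_mul e).symm

variable [Fintype A]

lemma LPFeasible.mass_nonneg (hq : LPFeasible L Pbar ξ q) (s : S) (a : A) : 0 ≤ mass L q s a :=
  sum_nonneg fun s' _ => (hq.mem_Icc s a s').1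

lemma LPFeasible.sum_mass_eq_inflow (hq : LPFeasible L Pbar ξ q) {h : ℕ} (hh : h + 1 < H) {s : S}
    (hs : s ∈ L.states (h + 1)) :
    ∑ a, mass L q s a = ∑ s' ∈ L.states h, ∑ a, q s' a s := by
  have hflow := hq.flow (h + 1) (by omega) hh s hs
  rw [sum_comm, Nat.add_sub_cancel] at hflow
  rw [← hflow]
  exact sum_congr rfl fun a _ => (sum_eq_mass q hs a).symm

lemma LPFeasible.sum_mass_s0 (hq : LPFeasible L Pbar ξ q) (hH : 0 < H) :
    ∑ a, mass L q L.s0 a = 1 := by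
  have hs0 : L.states 0 = {L.s0} := by
    ext s
    rw [Layering.mem_states, L.layer_eq_zero_iff, mem_singleton]
  have htotal := hq.total 0 hH
  rw [hs0, sum_singleton] at htotal
  rw [← htotal]
  exact sum_congr rfl fun a _ => (sum_eq_mass q (by simp [hs0]) a).symm

namespace IsInduced

lemma mass_mul (hQ : IsInduced L Pbar ξ q Q) (hq : LPFeasible L Pbar ξ q) {s : S}
    (hs : L.layer s < H) (a : A) {s' : S} (hs' : s' ∈ L.states (L.layer s + 1)) :
    mass L q s a * Q s a s' = q s a s' := by
  by_cases hm : mass L q s a = 0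
  · rw [hm, zero_mul]
    exact ((sum_eq_zero_iff_of_nonneg fun s' _ => (hq.mem_Icc s a s').1).1 hm s' hs').symm
  · rw [hQ.eq_div s a hs hm s' hs', mul_div_cancel₀ _ hm]

lemma sum_abs_sub_le (hQ : IsInduced L Pbar ξ q Q) (hq : LPFeasible L Pbar ξ q) {s : S}
    (hs : L.layer s < H) (a : A) :
    ∑ s' ∈ L.states (L.layer s + 1), |Q s a s' - Pbar s a s'| ≤ ξ s a := by
  by_cases hm : mass L q s a = 0
  · refine le_trans ?_ (hQ.conf s a hs hm)
    exact sum_le_sum_of_subset_of_nonneg (subset_univ _) fun _ _ _ => abs_nonneg _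
  · have hpos : 0 < mass L q s a := (hq.mass_nonneg s a).lt_of_ne' hm
    have hconf := hq.conf (L.layer s) hs s (Layering.mem_states.2 rfl) a
    refine le_of_mul_le_mul_right (le_of_eq_of_le ?_ hconf) hpos
    rw [sum_mul]
    refine sum_congr rfl fun s' hs' => ?_
    rw [← hQ.mass_mul hq hs a hs', ← mass, ← abs_of_pos hpos, ← abs_mul, abs_of_pos hpos,
      sub_mul, mul_comm (Q s a s')]

lemma sum_states_succ_mul (hQ : IsInduced L Pbar ξ q Q) (hq : LPFeasible L Pbar ξ q) {h : ℕ}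
    (hh : h < H) (v : S → ℝ) :
    ∑ s' ∈ L.states (h + 1), (∑ s ∈ L.states h, ∑ a, q s a s') * v s'
      = ∑ s ∈ L.states h, ∑ a, mass L q s a * ∑ s', Q s a s' * v s' := by
  simp only [sum_mul]
  rw [sum_comm]
  refine sum_congr rfl fun s hs => ?_
  obtain rfl := Layering.mem_states.1 hs
  rw [sum_comm]
  refine sum_congr rfl fun a _ => ?_
  rw [← hQ.isDynamics.sum_states_succ a hh, mul_sum]
  refine sum_congr rfl fun s' hs' => ?_
  rw [← mul_assoc, hQ.mass_mul hq hh a hs']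

variable [Nonempty A]

lemma sum_mass_mul_reward_le (hQ : IsInduced L Pbar ξ q Q) (hq : LPFeasible L Pbar ξ q) {h : ℕ}
    (hh : h < H) :
    ∑ s ∈ L.states h, ∑ a, mass L q s a * r s a
      ≤ ∑ s ∈ L.states h, (∑ a, mass L q s a) * optValue Q r (H - h) s
        - ∑ s ∈ L.states (h + 1), (∑ a, mass L q s a) * optValue Q r (H - (h + 1)) s := by
  have hnext : ∑ s ∈ L.states (h + 1), (∑ a, mass L q s a) * optValue Q r (H - (h + 1)) s
      = ∑ s ∈ L.states h, ∑ a,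
          mass L q s a * ∑ s', Q s a s' * optValue Q r (H - (h + 1)) s' := by
    rw [← hQ.sum_states_succ_mul hq hh]
    refine sum_congr rfl fun s hs => ?_
    obtain hlt | hlast := lt_or_ge (h + 1) H
    · rw [hq.sum_mass_eq_inflow hlt hs]
    · simp only [Nat.sub_eq_zero_of_le hlast, optValue, mul_zero]
  rw [hnext, le_sub_iff_add_le, ← sum_add_distrib]
  refine sum_le_sum fun s _ => ?_
  rw [← sum_add_distrib, sum_mul]
  refine sum_le_sum fun a _ => ?_
  rw [← mul_add, show H - h = H - (h + 1) + 1 by omega]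
  exact mul_le_mul_of_nonneg_left (le_optValue_succ Q r _ s a) (hq.mass_nonneg s a)

lemma lpObj_le_optValue (hQ : IsInduced L Pbar ξ q Q) (hq : LPFeasible L Pbar ξ q) :
    lpObj L r q ≤ optValue Q r H L.s0 := by
  obtain rfl | hH := Nat.eq_zero_or_pos H
  · simp [lpObj, optValue]
  have hs0 : L.states 0 = {L.s0} := by
    ext s
    rw [Layering.mem_states, L.layer_eq_zero_iff, mem_singleton]
  rw [lpObj_eq_sum_mass]
  refine (sum_le_sum fun h hh => hQ.sum_mass_mul_reward_le hq (mem_range.1 hh)).trans_eq ?_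
  rw [sum_range_sub' fun h => ∑ s ∈ L.states h, (∑ a, mass L q s a) * optValue Q r (H - h) s]
  simp only [Nat.sub_self, optValue, mul_zero, sum_const_zero, sub_zero, hs0, sum_singleton,
    hq.sum_mass_s0 hH, Nat.sub_zero, one_mul]

end IsInduced

lemma IsFOA.exists_optimistic_dynamics [Nonempty A] {π : S → A} (hπ : IsFOA L Pbar ξ r π)
    (hP : L.IsDynamics P)
    (hconf : ∀ s a, L.layer s < H → ∑ s', |Pbar s a s' - P s a s'| ≤ ξ s a) :
    ∃ Q, L.IsDynamics Q ∧
      (∀ s a, L.layer s < H → ∑ s' ∈ L.states (L.layer s + 1), |Q s a s' - Pbar s a s'| ≤ ξ s a) ∧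
      ∀ π', value P r π' H L.s0 ≤ value Q r π H L.s0 := by
  obtain ⟨q, Q, hq, hopt, hQ, hbest⟩ := hπ
  refine ⟨Q, hQ.isDynamics, fun s a hs => hQ.sum_abs_sub_le hq hs a, fun π' => ?_⟩
  obtain ⟨πgreedy, hgreedy⟩ := hQ.isDynamics.exists_value_eq_optValue r
  calc value P r π' H L.s0 = lpObj L r (extOcc L P π') := (lpObj_extOcc hP r π').symm
    _ ≤ lpObj L r q := hopt _ (lpFeasible_extOcc hP hconf π')
    _ ≤ optValue Q r H L.s0 := hQ.lpObj_le_optValue hq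
    _ = value Q r πgreedy H L.s0 := (hgreedy H L.s0 (by rw [L.layer_s0, zero_add])).symm
    _ ≤ value Q r π H L.s0 := hbest πgreedy

lemma IsFOA.value_sub_value_le [Nonempty A] {f b g : S → A → ℝ} {π : S → A}
    (hπ : IsFOA L Pbar ξ (fun s a => f s a + b s a) π) (hP : L.IsDynamics P)
    (hconf : ∀ s a, L.layer s < H → ∑ s', |Pbar s a s' - P s a s'| ≤ ξ s a)
    (hf : ∀ s a, f s a ∈ Set.Icc (0 : ℝ) 1) (hb : ∀ s a, 0 ≤ b s a)
    (herr : ∀ s a, |f s a - r s a| ≤ b s a + g s a) (π' : S → A) :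
    value P r π' H L.s0 - value P r π H L.s0
      ≤ expectedSum L P π' (fun s => g s (π' s)) + expectedSum L P π (fun s => g s (π s))
        + 2 * ∑ s with L.layer s < H, b s (π s)
        + 2 * H * expectedSum L P π fun s => min 1 (ξ s (π s)) := by
  obtain ⟨Q, hQ, hQconf, hbest⟩ := hπ.exists_optimistic_dynamics hP hconf
  have hcomparator : value P r π' H L.s0
      ≤ value P (fun s a => f s a + b s a) π' H L.s0
        + expectedSum L P π' fun s => g s (π' s) := by
    simp only [value_eq_expectedSum]
    rw [← expectedSum_add]
    exact expectedSum_mono hP π' fun s _ => by linarith [neg_le_of_abs_le (herr s (π' s))]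
  have hplayed : value P f π H L.s0
      ≤ value P r π H L.s0 + expectedSum L P π (fun s => b s (π s))
        + expectedSum L P π fun s => g s (π s) := by
    rw [value_eq_expectedSum, value_eq_expectedSum, ← expectedSum_add, ← expectedSum_add]
    exact expectedSum_mono hP π fun s _ => by linarith [le_of_abs_le (herr s (π s))]
  have hmodel : value Q (fun s a => f s a + b s a) π H L.s0
      = value Q f π H L.s0 + expectedSum L Q π fun s => b s (π s) := by
    simp only [value_eq_expectedSum, expectedSum_add]
  have hdynamics : value Q f π H L.s0 - value P f π H L.s0
      ≤ H * expectedSum L P π fun s => 2 * min 1 (ξ s (π s)) :=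
    RMUCID.value_sub_value_le hP hQ (fun s a _ => hf s a) π fun s hs =>
      hP.sum_abs_sub_le_two_mul_min hQ hs (hconf s _ hs) (hQconf s _ hs)
  rw [expectedSum_const_mul] at hdynamics
  have hbonusP := expectedSum_le_sum hP π fun s => hb s (π s)
  have hbonusQ := expectedSum_le_sum hQ π fun s => hb s (π s)
  linarith [hbest π']

end Optimism

section Paths

variable {S A : Type*} {H : ℕ} {P : S → A → S → ℝ}

open scoped Classical in
/-- The probability that an episode played with `π` starts with the `n + 1` states `x`. -/
def pathProb (P : S → A → S → ℝ) (s0 : S) (π : S → A) (n : ℕ) (x : Fin (n + 1) → S) : ℝ :=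
  (if x 0 = s0 then 1 else 0) *
    ∏ h : Fin n, P (x h.castSucc) (π (x h.castSucc)) (x h.succ)

lemma pathProb_snoc (P : S → A → S → ℝ) (s0 : S) (π : S → A) {n : ℕ} (y : Fin (n + 1) → S)
    (s : S) :
    pathProb P s0 π (n + 1) (Fin.snoc (α := fun _ => S) y s)
      = pathProb P s0 π n y * P (y (Fin.last n)) (π (y (Fin.last n))) s := by
  simp only [pathProb, Fin.prod_univ_castSucc, Fin.snoc_castSucc, Fin.succ_castSucc, Fin.succ_last,
    Fin.snoc_last, mul_assoc]
  congr 1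

variable [Fintype S] {L : Layering S H}

lemma sum_snoc {n : ℕ} (f : (Fin (n + 2) → S) → ℝ) :
    ∑ x, f x = ∑ y : Fin (n + 1) → S, ∑ s : S, f (Fin.snoc (α := fun _ => S) y s) := by
  rw [← (Fin.snocEquiv fun _ => S).sum_comp, Fintype.sum_prod_type, sum_comm]
  rfl

lemma sum_pathProb_mul_last (P : S → A → S → ℝ) (s0 : S) (π : S → A) (n : ℕ) (u : S → ℝ) :
    ∑ x, pathProb P s0 π n x * u (x (Fin.last n)) = ∑ s, occ P s0 π n s * u s := by
  induction n generalizing u with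
  | zero =>
    classical
    rw [sum_occ_zero_mul, ← (Equiv.funUnique (Fin 1) S).symm.sum_comp]
    simp [pathProb]
  | succ n ih =>
    rw [sum_snoc, sum_occ_succ_mul, ← ih]
    simp only [pathProb_snoc, Fin.snoc_last, mul_sum, mul_assoc]

namespace Layering.IsDynamics

lemma layer_of_pathProb_ne_zero (hP : L.IsDynamics P) {π : S → A} {n : ℕ} (hn : n ≤ H)
    {x : Fin (n + 1) → S} (hx : pathProb P L.s0 π n x ≠ 0) (i : Fin (n + 1)) :
    L.layer (x i) = i := by
  obtain ⟨hstart, hsteps⟩ := mul_ne_zero_iff.1 hx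
  rw [prod_ne_zero_iff] at hsteps
  induction i using Fin.induction with
  | zero => exact (L.layer_eq_zero_iff _).2 (by_contra fun h => hstart (if_neg h))
  | succ i ih =>
    rw [Fin.val_castSucc] at ih
    by_contra hne
    refine hsteps i (mem_univ _) (hP.eq_zero _ _ _ (by omega) ?_)
    rwa [ih, ← Fin.val_succ]

lemma pathProb_nonneg (hP : L.IsDynamics P) (π : S → A) {n : ℕ} (hn : n ≤ H)
    (x : Fin (n + 1) → S) : 0 ≤ pathProb P L.s0 π n x := by
  by_cases hx : pathProb P L.s0 π n x = 0
  · exact hx.ge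
  · refine mul_nonneg (by positivity) (prod_nonneg fun h _ => hP.nonneg _ _ _ ?_)
    rw [hP.layer_of_pathProb_ne_zero hn hx, Fin.val_castSucc]
    omega

lemma sum_pathProb (hP : L.IsDynamics P) (π : S → A) {n : ℕ} (hn : n ≤ H) :
    ∑ x, pathProb P L.s0 π n x = 1 := by
  simpa only [mul_one, hP.sum_occ π hn] using sum_pathProb_mul_last P L.s0 π n fun _ => 1

lemma sum_pathProb_succ_mul_init (hP : L.IsDynamics P) (π : S → A) {n : ℕ} (hn : n < H)
    (ψ : (Fin (n + 1) → S) → ℝ) :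
    ∑ x, pathProb P L.s0 π (n + 1) x * ψ (Fin.init (α := fun _ => S) x)
      = ∑ y, pathProb P L.s0 π n y * ψ y := by
  rw [sum_snoc]
  refine sum_congr rfl fun y _ => ?_
  simp only [pathProb_snoc, Fin.init_snoc]
  by_cases hy : pathProb P L.s0 π n y = 0
  · simp [hy]
  · have hlast := hP.layer_of_pathProb_ne_zero hn.le hy (Fin.last n)
    rw [← sum_mul, ← mul_sum, hP.sum_eq_one _ _ (by rwa [hlast, Fin.val_last]), mul_one]

lemma sum_pathProb_mul_pair (hP : L.IsDynamics P) (π : S → A) {n : ℕ} (hn : n ≤ H) (h : Fin n)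
    (ψ : S → S → ℝ) :
    ∑ x, pathProb P L.s0 π n x * ψ (x h.castSucc) (x h.succ)
      = ∑ s, occ P L.s0 π h s * ∑ s', P s (π s) s' * ψ s s' := by
  induction n with
  | zero => exact h.elim0
  | succ n ih =>
    induction h using Fin.lastCases with
    | last =>
      rw [sum_snoc, Fin.val_last, ← sum_pathProb_mul_last]
      simp only [pathProb_snoc, Fin.snoc_castSucc, Fin.succ_last, Fin.snoc_last, mul_sum, mul_assoc]
    | cast j =>
      rw [Fin.val_castSucc, ← ih (by omega) j]
      exact hP.sum_pathProb_succ_mul_init π (by omega) fun y => ψ (y j.castSucc) (y j.succ)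

lemma sum_pathProb_mul_sum (hP : L.IsDynamics P) (π : S → A) (u : S → ℝ) :
    ∑ x, pathProb P L.s0 π H x * ∑ h : Fin H, u (x h.castSucc) = expectedSum L P π u := by
  simp only [mul_sum, expectedSum]
  rw [sum_comm, sum_range]
  refine sum_congr rfl fun h _ => ?_
  rw [hP.sum_pathProb_mul_pair π le_rfl h fun s _ => u s]
  refine sum_congr rfl fun s _ => ?_
  by_cases hs : L.layer s = h
  · rw [← sum_mul, hP.sum_eq_one _ _ (by omega), one_mul]
  · rw [hP.occ_eq_zero π h.2.le hs, zero_mul, zero_mul]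

end Layering.IsDynamics

end Paths

section Supermartingale

open ProbabilityTheory
open scoped ENNReal

variable {Ω : Type*} {mΩ : MeasurableSpace Ω} {μ : Measure Ω}

lemma lintegral_mul_le_of_setLIntegral_le {m : MeasurableSpace Ω} (hm : m ≤ mΩ)
    {X W : Ω → ℝ≥0∞} (hX : Measurable[mΩ] X) (hW : Measurable[m] W)
    (h : ∀ E, MeasurableSet[m] E → ∫⁻ ω in E, X ω ∂μ ≤ μ E) :
    ∫⁻ ω, W ω * X ω ∂μ ≤ ∫⁻ ω, W ω ∂μ := by
  have htrim : (μ.withDensity X).trim hm ≤ μ.trim hm := by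
    refine (@Measure.le_iff _ m _ _).2 fun E hE => ?_
    rw [trim_measurableSet_eq hm hE, trim_measurableSet_eq hm hE, withDensity_apply _ (hm _ hE)]
    exact h E hE
  have hint := @lintegral_mono' _ m _ _ htrim _ _ (le_refl W)
  rw [lintegral_trim hm hW, lintegral_trim hm hW,
    lintegral_withDensity_eq_lintegral_mul μ hX (hW.mono hm le_rfl)] at hint
  simpa only [Pi.mul_apply, mul_comm] using hint

section Adapted

variable [IsProbabilityMeasure μ] {𝓕 : Filtration ℕ mΩ} {T : ℕ}

lemma measurable_prod_Ico {X : ℕ → Ω → ℝ≥0∞} (hX : ∀ i ∈ Icc 1 T, Measurable[𝓕 (i + 1)] (X i))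
    {t : ℕ} (ht : t ≤ T + 1) : Measurable[𝓕 t] fun ω => ∏ i ∈ Ico 1 t, X i ω := by
  refine measurable_fun_prod (Ico 1 t) fun i hi => ?_
  rw [mem_Ico] at hi
  exact (hX i (mem_Icc.2 (by omega))).mono (𝓕.mono (by omega)) le_rfl

lemma lintegral_prod_le_one {X : ℕ → Ω → ℝ≥0∞}
    (hX : ∀ i ∈ Icc 1 T, Measurable[𝓕 (i + 1)] (X i))
    (h : ∀ i ∈ Icc 1 T, ∀ E, MeasurableSet[𝓕 i] E → ∫⁻ ω in E, X i ω ∂μ ≤ μ E)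
    {t : ℕ} (ht : t ≤ T + 1) : ∫⁻ ω, ∏ i ∈ Ico 1 t, X i ω ∂μ ≤ 1 := by
  induction t with
  | zero => simp
  | succ t ih =>
    obtain rfl | hpos := Nat.eq_zero_or_pos t
    · simp
    have htT : t ∈ Icc 1 T := mem_Icc.2 (by omega)
    simp only [prod_Ico_succ_top hpos]
    exact (lintegral_mul_le_of_setLIntegral_le (𝓕.le t) ((hX t htT).mono (𝓕.le _) le_rfl)
      (measurable_prod_Ico hX (by omega)) (h t htT)).trans (ih (by omega))

lemma measure_log_le_sum_le {Y : ℕ → Ω → ℝ} (hY : ∀ i ∈ Icc 1 T, Measurable[𝓕 (i + 1)] (Y i))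
    (h : ∀ i ∈ Icc 1 T, ∀ E, MeasurableSet[𝓕 i] E →
      ∫⁻ ω in E, ENNReal.ofReal (Real.exp (Y i ω)) ∂μ ≤ μ E)
    {t : ℕ} (ht : t ≤ T + 1) {ε : ℝ} (hε : 0 < ε) :
    μ {ω | Real.log (1 / ε) ≤ ∑ i ∈ Ico 1 t, Y i ω} ≤ ENNReal.ofReal ε := by
  have hX : ∀ i ∈ Icc 1 T, Measurable[𝓕 (i + 1)] fun ω => ENNReal.ofReal (Real.exp (Y i ω)) :=
    fun i hi => (Real.measurable_exp.comp (hY i hi)).ennreal_ofReal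
  have hset : {ω | Real.log (1 / ε) ≤ ∑ i ∈ Ico 1 t, Y i ω}
      = {ω | ENNReal.ofReal (1 / ε) ≤ ∏ i ∈ Ico 1 t, ENNReal.ofReal (Real.exp (Y i ω))} := by
    ext ω
    simp only [Set.mem_ofPred_eq]
    rw [← ENNReal.ofReal_prod_of_nonneg fun i _ => (Real.exp_pos _).le, ← Real.exp_sum,
      ENNReal.ofReal_le_ofReal_iff (Real.exp_pos _).le, Real.log_le_iff_le_exp (by positivity)]
  rw [hset]
  have hmeas := (measurable_prod_Ico hX ht).mono (𝓕.le t) le_rfl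
  refine (meas_ge_le_lintegral_div hmeas.aemeasurable
    (ENNReal.ofReal_pos.2 (by positivity)).ne' ENNReal.ofReal_ne_top).trans ?_
  calc (∫⁻ ω, ∏ i ∈ Ico 1 t, ENNReal.ofReal (Real.exp (Y i ω)) ∂μ) / ENNReal.ofReal (1 / ε)
      ≤ 1 / ENNReal.ofReal (1 / ε) := by gcongr; exact lintegral_prod_le_one hX h ht
    _ = ENNReal.ofReal ε := by
        rw [one_div, one_div, ENNReal.ofReal_inv_of_pos hε, inv_inv]

end Adapted

lemma setLIntegral_eq_tsum_fiber {κ : Type*} [Countable κ] {k : Ω → κ}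
    (hk : ∀ j, MeasurableSet {ω | k ω = j}) {E : Set Ω} (hE : MeasurableSet E) (f : Ω → ℝ≥0∞) :
    ∫⁻ ω in E, f ω ∂μ = ∑' j, ∫⁻ ω in E ∩ {ω | k ω = j}, f ω ∂μ := by
  have hdisj : Pairwise (Function.onFun Disjoint fun j => E ∩ {ω | k ω = j}) := fun i j hij =>
    Set.disjoint_left.2 fun ω hi hj => hij (hi.2.symm.trans hj.2)
  rw [← lintegral_iUnion (fun j => hE.inter (hk j)) hdisj]
  congr 2
  ext ω
  simp

section Hoeffding

variable [IsProbabilityMeasure μ] {X : Ω → ℝ} {a b : ℝ}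

lemma mgf_sub_integral_le_of_mem_Icc (hm : AEMeasurable X μ) (hb : ∀ᵐ ω ∂μ, X ω ∈ Set.Icc a b)
    (t : ℝ) :
    mgf (fun ω => X ω - ∫ ω', X ω' ∂μ) μ t ≤ Real.exp (t ^ 2 * (b - a) ^ 2 / 8) := by
  refine ((hasSubgaussianMGF_of_mem_Icc hm hb).mgf_le t).trans_eq (congrArg Real.exp ?_)
  simp only [NNReal.coe_pow, NNReal.coe_div, coe_nnnorm, Real.norm_eq_abs, NNReal.coe_ofNat,
    div_pow, sq_abs]
  ring

lemma lintegral_exp_le_of_mem_Icc (hm : AEMeasurable X μ) (hb : ∀ᵐ ω ∂μ, X ω ∈ Set.Icc a b)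
    (t : ℝ) :
    ∫⁻ ω, ENNReal.ofReal (Real.exp (t * (X ω - ∫ ω, X ω ∂μ))) ∂μ
      ≤ ENNReal.ofReal (Real.exp (t ^ 2 * (b - a) ^ 2 / 8)) := by
  rw [← ofReal_integral_eq_lintegral_ofReal
    ((hasSubgaussianMGF_of_mem_Icc hm hb).integrable_exp_mul t)
    (Filter.Eventually.of_forall fun _ => (Real.exp_pos _).le)]
  exact ENNReal.ofReal_le_ofReal (mgf_sub_integral_le_of_mem_Icc hm hb t)

end Hoeffding

lemma sum_mul_exp_le_of_mem_Icc {ι : Type*} [Fintype ι] {w x : ι → ℝ} (hw : ∀ i, 0 ≤ w i)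
    (hw1 : ∑ i, w i = 1) {a b : ℝ} (hx : ∀ i, x i ∈ Set.Icc a b) (t : ℝ) :
    ∑ i, w i * Real.exp (t * (x i - ∑ j, w j * x j)) ≤ Real.exp (t ^ 2 * (b - a) ^ 2 / 8) := by
  let _ : MeasurableSpace ι := ⊤
  let p : PMF ι := PMF.ofFintype (fun i => ENNReal.ofReal (w i)) (by
    rw [← ENNReal.ofReal_sum_of_nonneg fun i _ => hw i, hw1, ENNReal.ofReal_one])
  have hp : ∀ i, (p i).toReal = w i := fun i => by
    simp [p, PMF.ofFintype_apply, ENNReal.toReal_ofReal (hw i)]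
  have hmgf := mgf_sub_integral_le_of_mem_Icc (μ := p.toMeasure)
    (measurable_from_top (f := x)).aemeasurable (Filter.Eventually.of_forall hx) t
  simpa only [mgf, PMF.integral_eq_sum, hp, smul_eq_mul] using hmgf

end Supermartingale

section Round

open ProbabilityTheory
open scoped ENNReal

/-- The states `s_0, …, s_H` of an episode. -/
def Episode.path {C S A : Type*} (H : ℕ) (e : Episode C S A) (h : Fin (H + 1)) : S := e.st h

lemma lintegral_pi_prod {n : ℕ} {Y : Type*} [MeasurableSpace Y] (ν : Fin n → Measure Y)
    [∀ h, IsProbabilityMeasure (ν h)] {G : Fin n → Y → ℝ≥0∞} (hG : ∀ h, Measurable (G h)) :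
    ∫⁻ y, ∏ h, G h (y h) ∂(Measure.pi ν) = ∏ h, ∫⁻ z, G h z ∂(ν h) := by
  have hind := iIndepFun_pi (μ := ν) (X := G) fun h => (hG h).aemeasurable
  rw [lintegral_prod_eq_prod_lintegral_of_indepFun univ _ hind
    fun h => (hG h).comp (measurable_pi_apply h)]
  exact prod_congr rfl fun h _ => (measurePreserving_eval ν h).lintegral_comp (hG h)

namespace IsInteraction

variable {C S A Ω : Type*} [Fintype C] [Fintype S] {H T : ℕ}
  {mΩ : MeasurableSpace Ω} {μ : Measure Ω} {M : CMDP C S A H}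
  {𝓕 : Filtration ℕ mΩ} {σ : ℕ → Ω → Episode C S A} {pol : ℕ → Ω → C → S → A}

lemma measurableSet_path (hI : IsInteraction M T μ 𝓕 σ pol) {t : ℕ} (ht : t ∈ Icc 1 T)
    (x : Fin (H + 1) → S) : MeasurableSet[𝓕 (t + 1)] {ω | (σ t ω).path H = x} := by
  have hset : {ω | (σ t ω).path H = x} = ⋂ h : Fin (H + 1), {ω | (σ t ω).st h = x h} := by
    ext ω
    simp [funext_iff, Episode.path]
  rw [hset]
  exact MeasurableSet.iInter fun h => hI.st_meas t ht h (by omega) (x h)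

lemma measureReal_cell (hI : IsInteraction M T μ 𝓕 σ pol) {t : ℕ} (ht : t ∈ Icc 1 T)
    {p : C → S → A} {E : Set Ω} (hE : MeasurableSet[𝓕 t] E) (hp : ∀ ω ∈ E, pol t ω = p) (c : C)
    {x : Fin (H + 1) → S} (hx : x 0 = M.lay.s0) {B : Fin H → Set ℝ}
    (hB : ∀ h, MeasurableSet (B h)) :
    μ.real {ω ∈ E | (σ t ω).ctx = c ∧ (σ t ω).path H = x ∧ ∀ h : Fin H, (σ t ω).rew h ∈ B h}
      = μ.real E * M.D c * ∏ h : Fin H, ((M.R c (x h.castSucc) (p c (x h.castSucc))).real (B h) *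
          M.P (x h.castSucc) (p c (x h.castSucc)) (x h.succ)) := by
  let x' : ℕ → S := fun h => if hh : h < H + 1 then x ⟨h, hh⟩ else M.lay.s0
  let B' : ℕ → Set ℝ := fun h => if hh : h < H then B ⟨h, hh⟩ else Set.univ
  have hx' : ∀ h : Fin (H + 1), x' h = x h := fun h => dif_pos h.2
  have hB' : ∀ h : Fin H, B' h = B h := fun h => dif_pos h.2
  have hlaw := hI.law t ht p E hE hp c x' B' ((hx' 0).trans hx) fun h => by
    simp only [B']; split_ifs; exacts [hB _, MeasurableSet.univ]
  have hpath : ∀ ω, (∀ h ≤ H, (σ t ω).st h = x' h) ↔ (σ t ω).path H = x := fun ω => by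
    refine ⟨fun h => funext fun i => (h i (by omega)).trans (hx' i), ?_⟩
    rintro rfl h hh
    exact (hx' ⟨h, by omega⟩).symm
  have hrew : ∀ ω, (∀ h < H, (σ t ω).rew h ∈ B' h) ↔ ∀ h : Fin H, (σ t ω).rew h ∈ B h :=
    fun ω => ⟨fun h i => hB' i ▸ h i i.2, fun h i hi => (hB' ⟨i, hi⟩).symm ▸ h ⟨i, hi⟩⟩
  simp only [hpath, hrew, prod_range] at hlaw
  rw [hlaw]
  refine congrArg (_ * ·) (prod_congr rfl fun h _ => ?_)
  rw [hB', ← hx' h.castSucc, ← hx' h.succ]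
  rfl

variable [IsFiniteMeasure μ]

lemma measure_cell (hI : IsInteraction M T μ 𝓕 σ pol) {t : ℕ} (ht : t ∈ Icc 1 T) {p : C → S → A}
    {E : Set Ω} (hE : MeasurableSet[𝓕 t] E) (hp : ∀ ω ∈ E, pol t ω = p) (c : C)
    (x : Fin (H + 1) → S) {B : Fin H → Set ℝ} (hB : ∀ h, MeasurableSet (B h)) :
    μ {ω ∈ E | (σ t ω).ctx = c ∧ (σ t ω).path H = x ∧ ∀ h : Fin H, (σ t ω).rew h ∈ B h}
      = μ E * ENNReal.ofReal (M.D c * pathProb M.P M.lay.s0 (p c) H x) *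
        ∏ h : Fin H, M.R c (x h.castSucc) (p c (x h.castSucc)) (B h) := by
  have := M.R_prob
  by_cases hx : x 0 = M.lay.s0
  · have hprob : pathProb M.P M.lay.s0 (p c) H x
        = ∏ h : Fin H, M.P (x h.castSucc) (p c (x h.castSucc)) (x h.succ) := by
      simp [pathProb, hx]
    have hnonneg := M.isDynamics.pathProb_nonneg (p c) le_rfl x
    rw [← ofReal_measureReal, hI.measureReal_cell ht hE hp c hx hB, prod_mul_distrib, ← hprob,
      mul_comm (∏ _, _), ← mul_assoc, ENNReal.ofReal_mul, mul_assoc (μ.real E),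
      ENNReal.ofReal_mul measureReal_nonneg, ENNReal.ofReal_prod_of_nonneg]
    · rw [ofReal_measureReal, prod_congr rfl fun h _ => ofReal_measureReal]
    · exact fun _ _ => measureReal_nonneg
    · exact mul_nonneg (mul_nonneg measureReal_nonneg (M.D_nonneg c)) hnonneg
  · have hprob : pathProb M.P M.lay.s0 (p c) H x = 0 := by simp [pathProb, hx]
    rw [hprob, mul_zero, ENNReal.ofReal_zero, mul_zero, zero_mul]
    refine measure_mono_null ?_ (ae_iff.1 (hI.start t ht))
    rintro ω ⟨-, -, rfl, -⟩ hstart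
    exact hx hstart

lemma map_restrict_cell (hI : IsInteraction M T μ 𝓕 σ pol) {t : ℕ} (ht : t ∈ Icc 1 T)
    {p : C → S → A} {E : Set Ω} (hE : MeasurableSet[𝓕 t] E) (hp : ∀ ω ∈ E, pol t ω = p) (c : C)
    (x : Fin (H + 1) → S) :
    (μ.restrict (E ∩ {ω | (σ t ω).ctx = c ∧ (σ t ω).path H = x})).map
        (fun ω (h : Fin H) => (σ t ω).rew h)
      = (μ E * ENNReal.ofReal (M.D c * pathProb M.P M.lay.s0 (p c) H x)) •
        Measure.pi fun h : Fin H => M.R c (x h.castSucc) (p c (x h.castSucc)) := by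
  have := M.R_prob
  have hrew : Measurable fun ω (h : Fin H) => (σ t ω).rew h := measurable_pi_lambda _ fun h =>
    (hI.rew_meas t ht h h.2).mono (𝓕.le _) le_rfl
  have hbox : ∀ B : Fin H → Set ℝ, (∀ h, MeasurableSet (B h)) →
      (μ.restrict (E ∩ {ω | (σ t ω).ctx = c ∧ (σ t ω).path H = x})).map
          (fun ω (h : Fin H) => (σ t ω).rew h) (Set.pi Set.univ B)
        = ((μ E * ENNReal.ofReal (M.D c * pathProb M.P M.lay.s0 (p c) H x)) •
          Measure.pi fun h : Fin H => M.R c (x h.castSucc) (p c (x h.castSucc)))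
            (Set.pi Set.univ B) := by
    intro B hB
    have hpi : MeasurableSet (Set.pi Set.univ B) := MeasurableSet.univ_pi hB
    rw [Measure.map_apply hrew hpi, Measure.restrict_apply (hrew hpi), Measure.smul_apply,
      Measure.pi_pi, smul_eq_mul, ← hI.measure_cell ht hE hp c x hB]
    congr 1
    ext ω
    simp only [Set.mem_inter_iff, Set.mem_preimage, Set.mem_pi, Set.mem_univ, true_imp_iff,
      Set.mem_ofPred_eq]
    tauto
  refine ext_of_generate_finite _ generateFrom_pi.symm isPiSystem_pi ?_ ?_
  · rintro _ ⟨B, hB, rfl⟩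
    exact hbox B fun h => hB h (Set.mem_univ h)
  · simpa only [Set.pi_univ] using hbox (fun _ => Set.univ) fun _ => MeasurableSet.univ

lemma lintegral_cell (hI : IsInteraction M T μ 𝓕 σ pol) {t : ℕ} (ht : t ∈ Icc 1 T)
    {p : C → S → A} {E : Set Ω} (hE : MeasurableSet[𝓕 t] E) (hp : ∀ ω ∈ E, pol t ω = p) (c : C)
    (x : Fin (H + 1) → S) {G : Fin H → ℝ → ℝ≥0∞} (hG : ∀ h, Measurable (G h)) :
    ∫⁻ ω in E ∩ {ω | (σ t ω).ctx = c ∧ (σ t ω).path H = x}, ∏ h, G h ((σ t ω).rew h) ∂μ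
      = μ E * ENNReal.ofReal (M.D c * pathProb M.P M.lay.s0 (p c) H x) *
        ∏ h : Fin H, ∫⁻ z, G h z ∂(M.R c (x h.castSucc) (p c (x h.castSucc))) := by
  have := M.R_prob
  have hrew : Measurable fun ω (h : Fin H) => (σ t ω).rew h := measurable_pi_lambda _ fun h =>
    (hI.rew_meas t ht h h.2).mono (𝓕.le _) le_rfl
  rw [← lintegral_pi_prod _ hG, ← smul_eq_mul, ← lintegral_smul_measure,
    ← hI.map_restrict_cell ht hE hp c x, lintegral_map (by fun_prop) hrew]

lemma ae_layer [Finite A] (hI : IsInteraction M T μ 𝓕 σ pol) {t : ℕ} (ht : t ∈ Icc 1 T) :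
    ∀ᵐ ω ∂μ, ∀ h ≤ H, M.lay.layer ((σ t ω).st h) = h := by
  have hprob : ∀ᵐ ω ∂μ, ∀ (p : C → S → A) (c : C) (x : Fin (H + 1) → S),
      pol t ω = p → (σ t ω).ctx = c → (σ t ω).path H = x →
        pathProb M.P M.lay.s0 (p c) H x ≠ 0 := by
    simp only [ae_all_iff]
    intro p c x
    by_cases hx : pathProb M.P M.lay.s0 (p c) H x = 0
    swap
    · exact Filter.Eventually.of_forall fun _ _ _ _ => hx
    have hnull := hI.measure_cell ht (hI.pol_meas t ht p) (fun ω hω => hω) c x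
      (B := fun _ => Set.univ) fun _ => MeasurableSet.univ
    rw [hx, mul_zero, ENNReal.ofReal_zero, mul_zero, zero_mul] at hnull
    filter_upwards [measure_eq_zero_iff_ae_notMem.1 hnull] with ω hω hpol hctx hpath
    exact (hω ⟨hpol, hctx, hpath, fun _ => Set.mem_univ _⟩).elim
  filter_upwards [hprob] with ω hω h hh
  exact M.isDynamics.layer_of_pathProb_ne_zero le_rfl (hω _ _ _ rfl rfl rfl) ⟨h, by omega⟩

end IsInteraction

end Round

section Concentration

open scoped ENNReal

section Fibres

variable {Ω ι κ : Type*} {m : MeasurableSpace Ω}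

lemma measurableSet_prodMk_eq {f : Ω → ι} {g : Ω → κ} {q : ι × κ}
    (hf : MeasurableSet {ω | f ω = q.1}) (hg : MeasurableSet {ω | g ω = q.2}) :
    MeasurableSet {ω | (f ω, g ω) = q} := by
  simp only [Prod.ext_iff]
  exact hf.inter hg

lemma measurable_comp_countable {β : Type*} [MeasurableSpace β] [Countable κ] {k : Ω → κ}
    (hk : ∀ q, MeasurableSet {ω | k ω = q}) {X : Ω → β} (hX : Measurable X) {Z : κ → β → ℝ}
    (hZ : ∀ q, Measurable (Z q)) :
    Measurable fun ω => Z (k ω) (X ω) := by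
  let _ : MeasurableSpace κ := ⊤
  have hZ' : Measurable (Function.uncurry Z) := measurable_from_prod_countable_right hZ
  exact hZ'.comp ((measurable_to_countable' hk).prodMk hX)

end Fibres

namespace IsInteraction

variable {C S A Ω : Type*} [Fintype C] [Fintype S] {H T : ℕ}
  {mΩ : MeasurableSpace Ω} {μ : Measure Ω} {M : CMDP C S A H}
  {𝓕 : Filtration ℕ mΩ} {σ : ℕ → Ω → Episode C S A} {pol : ℕ → Ω → C → S → A}

lemma measurable_visits (hI : IsInteraction M T μ 𝓕 σ pol) {t : ℕ} (ht : t ≤ T + 1)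
    (s : S) (a : A) : Measurable[𝓕 t] fun ω => visits H (fun j => σ j ω) t s a := by
  classical
  simp only [visits, card_filter]
  refine Finset.measurable_sum _ fun i hi => ?_
  rw [mem_Ico] at hi
  have hiT : i ∈ Icc 1 T := mem_Icc.2 (by omega)
  refine Measurable.ite ?_ measurable_const measurable_const
  have hset : {ω | ∃ h < H, (σ i ω).st h = s ∧ (σ i ω).act h = a}
      = ⋃ h : Fin H, {ω | (σ i ω).st h = s} ∩ {ω | (σ i ω).act h = a} := by
    ext ω
    simp only [Set.mem_ofPred_eq, Set.mem_iUnion, Set.mem_inter_iff, Fin.exists_iff, exists_prop]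
  rw [hset]
  exact MeasurableSet.iUnion fun h => 𝓕.mono (by omega : i + 1 ≤ t) _
    ((hI.st_meas i hiT h h.2.le s).inter (hI.act_meas i hiT h h.2 a))

lemma measurableSet_outcome (hI : IsInteraction M T μ 𝓕 σ pol) {t : ℕ} (ht : t ∈ Icc 1 T)
    (q : C × (Fin (H + 1) → S)) :
    MeasurableSet[𝓕 (t + 1)] {ω | ((σ t ω).ctx, (σ t ω).path H) = q} :=
  measurableSet_prodMk_eq (hI.ctx_meas t ht q.1) (hI.measurableSet_path ht q.2)

lemma lintegral_exp_cell_le [IsFiniteMeasure μ] (hI : IsInteraction M T μ 𝓕 σ pol)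
    {t : ℕ} (ht : t ∈ Icc 1 T)
    {p : C → S → A} {E : Set Ω} (hE : MeasurableSet[𝓕 t] E) (hp : ∀ ω ∈ E, pol t ω = p) (c : C)
    (x : Fin (H + 1) → S) (v : ℝ) {g : S → A → ℝ → ℝ} (hg : ∀ s a, Measurable (g s a))
    {B : S → A → ℝ} (hB : ∀ s a, M.lay.layer s < H →
      ∫⁻ z, ENNReal.ofReal (Real.exp (g s a z)) ∂(M.R c s a) ≤ ENNReal.ofReal (Real.exp (B s a))) :
    ∫⁻ ω in E ∩ {ω | (σ t ω).ctx = c ∧ (σ t ω).path H = x}, ENNReal.ofReal (Real.exp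
        (v + ∑ h : Fin H, g (x h.castSucc) (p c (x h.castSucc)) ((σ t ω).rew h))) ∂μ
      ≤ μ E * ENNReal.ofReal (M.D c * (pathProb M.P M.lay.s0 (p c) H x *
          Real.exp (v + ∑ h : Fin H, B (x h.castSucc) (p c (x h.castSucc))))) := by
  have hexp_add : ∀ u : Fin H → ℝ, ENNReal.ofReal (Real.exp (v + ∑ h, u h))
      = ENNReal.ofReal (Real.exp v) * ∏ h, ENNReal.ofReal (Real.exp (u h)) := fun u => by
    rw [Real.exp_add, Real.exp_sum, ENNReal.ofReal_mul (Real.exp_pos _).le,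
      ENNReal.ofReal_prod_of_nonneg fun _ _ => (Real.exp_pos _).le]
  simp only [hexp_add]
  have hG : ∀ h : Fin H, Measurable fun z =>
      ENNReal.ofReal (Real.exp (g (x h.castSucc) (p c (x h.castSucc)) z)) := fun h =>
    (Real.measurable_exp.comp (hg _ _)).ennreal_ofReal
  rw [lintegral_const_mul' _ _ ENNReal.ofReal_ne_top, hI.lintegral_cell ht hE hp c x hG]
  by_cases hx : pathProb M.P M.lay.s0 (p c) H x = 0
  · simp [hx]
  have hprod : ∏ h : Fin H, ∫⁻ z, ENNReal.ofReal (Real.exp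
        (g (x h.castSucc) (p c (x h.castSucc)) z)) ∂(M.R c (x h.castSucc) (p c (x h.castSucc)))
      ≤ ∏ h : Fin H, ENNReal.ofReal (Real.exp (B (x h.castSucc) (p c (x h.castSucc)))) := by
    refine prod_le_prod' fun h _ => hB _ _ ?_
    rw [M.isDynamics.layer_of_pathProb_ne_zero le_rfl hx]
    exact h.2
  calc _ ≤ ENNReal.ofReal (Real.exp v) *
        (μ E * ENNReal.ofReal (M.D c * pathProb M.P M.lay.s0 (p c) H x) *
          ∏ h : Fin H, ENNReal.ofReal (Real.exp (B (x h.castSucc) (p c (x h.castSucc))))) := by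
        gcongr
    _ = _ := by
        rw [← mul_assoc (M.D c), ENNReal.ofReal_mul (mul_nonneg (M.D_nonneg c)
          (M.isDynamics.pathProb_nonneg _ le_rfl x)), hexp_add]
        ring

lemma setLIntegral_exp_round_le [IsFiniteMeasure μ] (hI : IsInteraction M T μ 𝓕 σ pol)
    {t : ℕ} (ht : t ∈ Icc 1 T)
    {p : C → S → A} {E : Set Ω} (hE : MeasurableSet[𝓕 t] E) (hp : ∀ ω ∈ E, pol t ω = p)
    (y : C → (Fin (H + 1) → S) → ℝ) {g : C → S → A → ℝ → ℝ} (hg : ∀ c s a, Measurable (g c s a))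
    {B : C → S → A → ℝ} (hB : ∀ c s a, M.lay.layer s < H →
      ∫⁻ z, ENNReal.ofReal (Real.exp (g c s a z)) ∂(M.R c s a)
        ≤ ENNReal.ofReal (Real.exp (B c s a))) :
    ∫⁻ ω in E, ENNReal.ofReal (Real.exp (y (σ t ω).ctx ((σ t ω).path H)
        + ∑ h ∈ range H, g (σ t ω).ctx ((σ t ω).st h) ((σ t ω).act h) ((σ t ω).rew h))) ∂μ
      ≤ μ E * ENNReal.ofReal (∑ c, M.D c * ∑ x, pathProb M.P M.lay.s0 (p c) H x *
          Real.exp (y c x + ∑ h : Fin H, B c (x h.castSucc) (p c (x h.castSucc)))) := by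
  have hact : ∀ᵐ ω ∂μ, ∀ h : Fin H, (σ t ω).act h = pol t ω (σ t ω).ctx ((σ t ω).st h) :=
    ae_all_iff.2 fun h => hI.act_eq t ht h h.2
  have hout := fun c x => 𝓕.le _ _ (hI.measurableSet_outcome ht (c, x))
  have hnonneg : ∀ c x, 0 ≤ M.D c * (pathProb M.P M.lay.s0 (p c) H x *
      Real.exp (y c x + ∑ h : Fin H, B c (x h.castSucc) (p c (x h.castSucc)))) := fun c x =>
    mul_nonneg (M.D_nonneg c)
      (mul_nonneg (M.isDynamics.pathProb_nonneg _ le_rfl x) (Real.exp_pos _).le)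
  simp only [mul_sum]
  rw [setLIntegral_eq_tsum_fiber (fun (q : _ × _) => hout q.1 q.2) (𝓕.le t _ hE),
    tsum_fintype, Fintype.sum_prod_type,
    ENNReal.ofReal_sum_of_nonneg fun c _ => sum_nonneg fun x _ => hnonneg c x, mul_sum]
  refine sum_le_sum fun c _ => ?_
  rw [ENNReal.ofReal_sum_of_nonneg fun x _ => hnonneg c x, mul_sum]
  refine sum_le_sum fun x _ => ?_
  simp only [Prod.mk.injEq] at hout ⊢
  rw [setLIntegral_congr_fun_ae ((𝓕.le t _ hE).inter (hout c x)) ?_]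
  · exact hI.lintegral_exp_cell_le ht hE hp c x (y c x) (hg c) (hB c)
  filter_upwards [hact] with ω hω ⟨hωE, hctx, hpath⟩
  subst hctx hpath
  simp only [sum_range, hω, hp ω hωE]
  rfl

variable [Finite A]

lemma measurableSet_past (hI : IsInteraction M T μ 𝓕 σ pol) {t : ℕ} (ht : t ∈ Icc 1 T)
    (q : (C → S → A) × (S → A → ℕ)) :
    MeasurableSet[𝓕 t] {ω | (pol t ω, visits H (fun j => σ j ω) t) = q} := by
  have hset : {ω | visits H (fun j => σ j ω) t = q.2}
      = ⋂ s, ⋂ a, {ω | visits H (fun j => σ j ω) t s a = q.2 s a} := by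
    ext ω
    simp [funext_iff]
  refine measurableSet_prodMk_eq (hI.pol_meas t ht q.1) (hset ▸ ?_)
  refine MeasurableSet.iInter fun s => MeasurableSet.iInter fun a => ?_
  exact hI.measurable_visits (by rw [mem_Icc] at ht; omega) s a (measurableSet_singleton _)

lemma measurable_round (hI : IsInteraction M T μ 𝓕 σ pol)
    (y : (C → S → A) → (S → A → ℕ) → C → (Fin (H + 1) → S) → ℝ)
    {g : C → S → A → ℝ → ℝ} (hg : ∀ c s a, Measurable (g c s a)) {t : ℕ} (ht : t ∈ Icc 1 T) :
    Measurable[𝓕 (t + 1)] fun ω =>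
      y (pol t ω) (visits H (fun j => σ j ω) t) (σ t ω).ctx ((σ t ω).path H)
        + ∑ h ∈ range H, g (σ t ω).ctx ((σ t ω).st h) ((σ t ω).act h) ((σ t ω).rew h) := by
  refine Measurable.add ?_ (Finset.measurable_sum _ fun h hh => ?_)
  · exact measurable_comp_countable (m := 𝓕 (t + 1)) (X := fun _ => ())
      (Z := fun q _ => y q.1.1 q.1.2 q.2.1 q.2.2)
      (fun q => measurableSet_prodMk_eq (𝓕.mono t.le_succ _ (hI.measurableSet_past ht q.1))
        (hI.measurableSet_outcome ht q.2)) measurable_const fun _ => measurable_const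
  · rw [mem_range] at hh
    exact measurable_comp_countable (m := 𝓕 (t + 1))
      (Z := fun (q : C × S × A) => g q.1 q.2.1 q.2.2)
      (fun q => measurableSet_prodMk_eq (hI.ctx_meas t ht q.1)
        (measurableSet_prodMk_eq (hI.st_meas t ht h hh.le q.2.1) (hI.act_meas t ht h hh q.2.2)))
      (hI.rew_meas t ht h hh) fun q => hg q.1 q.2.1 q.2.2

lemma measure_log_le_sum_round_le [IsProbabilityMeasure μ] (hI : IsInteraction M T μ 𝓕 σ pol)
    (y : (C → S → A) → (S → A → ℕ) → C → (Fin (H + 1) → S) → ℝ)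
    {g : C → S → A → ℝ → ℝ} (hg : ∀ c s a, Measurable (g c s a)) {B : C → S → A → ℝ}
    (hB : ∀ c s a, M.lay.layer s < H →
      ∫⁻ z, ENNReal.ofReal (Real.exp (g c s a z)) ∂(M.R c s a)
        ≤ ENNReal.ofReal (Real.exp (B c s a)))
    (hy : ∀ p N, ∑ c, M.D c * ∑ x, pathProb M.P M.lay.s0 (p c) H x *
      Real.exp (y p N c x + ∑ h : Fin H, B c (x h.castSucc) (p c (x h.castSucc))) ≤ 1)
    {t : ℕ} (ht : t ≤ T + 1) {ε : ℝ} (hε : 0 < ε) :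
    μ {ω | Real.log (1 / ε) ≤ ∑ i ∈ Ico 1 t,
      (y (pol i ω) (visits H (fun j => σ j ω) i) (σ i ω).ctx ((σ i ω).path H)
        + ∑ h ∈ range H, g (σ i ω).ctx ((σ i ω).st h) ((σ i ω).act h) ((σ i ω).rew h))}
      ≤ ENNReal.ofReal ε := by
  refine measure_log_le_sum_le (fun i hi => hI.measurable_round y hg hi) (fun i hi E hE => ?_) ht hε
  have hpast := hI.measurableSet_past hi
  have hμE : μ E = ∑' q, μ (E ∩ {ω | (pol i ω, visits H (fun j => σ j ω) i) = q}) := by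
    simpa only [setLIntegral_one] using setLIntegral_eq_tsum_fiber (μ := μ)
      (fun q => 𝓕.le i _ (hpast q)) (𝓕.le i _ hE) fun _ => 1
  rw [setLIntegral_eq_tsum_fiber (fun q => 𝓕.le i _ (hpast q)) (𝓕.le i _ hE), hμE]
  refine ENNReal.tsum_le_tsum fun ⟨p, N⟩ => ?_
  have hE' := hE.inter (hpast (p, N))
  have hpol : ∀ ω ∈ E ∩ {ω | (pol i ω, visits H (fun j => σ j ω) i) = (p, N)}, pol i ω = p :=
    fun ω hω => congrArg Prod.fst hω.2
  have hvisits : ∀ ω ∈ E ∩ {ω | (pol i ω, visits H (fun j => σ j ω) i) = (p, N)},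
      visits H (fun j => σ j ω) i = N := fun ω hω => congrArg Prod.snd hω.2
  rw [setLIntegral_congr_fun (𝓕.le i _ hE') fun ω hω => by rw [hpol ω hω, hvisits ω hω]]
  refine (hI.setLIntegral_exp_round_le hi hE' hpol (y p N) hg hB).trans ?_
  exact mul_le_of_le_one_right' (ENNReal.ofReal_le_one.2 (hy p N))

end IsInteraction

end Concentration

section Events

open scoped ENNReal

lemma exp_neg_le_one_sub_half {z : ℝ} (hz : z ∈ Set.Icc (0 : ℝ) 1) :
    Real.exp (-z) ≤ 1 - z / 2 := by
  obtain ⟨hz0, hz1⟩ := hz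
  rw [Real.exp_neg, inv_le_iff_one_le_mul₀ (Real.exp_pos _)]
  calc 1 ≤ (1 - z / 2) * (z + 1) := by nlinarith
    _ ≤ (1 - z / 2) * Real.exp z := by
      gcongr
      · linarith
      · exact Real.add_one_le_exp z

lemma exp_le_one_add_two_mul {z : ℝ} (hz : z ∈ Set.Icc (0 : ℝ) 1) :
    Real.exp z ≤ 1 + 2 * z := by
  have hconv := convexOn_exp.2 (Set.mem_univ 0) (Set.mem_univ 1) (sub_nonneg.2 hz.2) hz.1
    (sub_add_cancel 1 z)
  simp only [smul_eq_mul, mul_zero, zero_add, mul_one, Real.exp_zero] at hconv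
  nlinarith [Real.exp_one_lt_d9, hz.1]

lemma exp_mul_one_sub_le_one (e : ℝ) : Real.exp e * (1 - e) ≤ 1 := by
  calc Real.exp e * (1 - e) ≤ Real.exp e * Real.exp (-e) := by
        gcongr
        exact Real.one_sub_le_exp_neg e
    _ = 1 := by rw [← Real.exp_add, add_neg_cancel, Real.exp_zero]

lemma Layering.IsDynamics.sum_pathProb_mul_exp_le {S A : Type*} [Fintype S] {H : ℕ}
    {L : Layering S H} {P : S → A → S → ℝ} (hP : L.IsDynamics P) (π : S → A) {u : S → ℝ}
    (hu : ∀ s, L.layer s < H → u s ∈ Set.Icc (0 : ℝ) 1) {κ : ℝ} (hκ0 : 0 < κ) (hκ : H ≤ κ) :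
    ∑ x, pathProb P L.s0 π H x * Real.exp (-(∑ h : Fin H, u (x h.castSucc)) / κ)
      ≤ 1 - expectedSum L P π u / (2 * κ) := by
  have hterm : ∀ x, pathProb P L.s0 π H x * Real.exp (-(∑ h : Fin H, u (x h.castSucc)) / κ)
      ≤ pathProb P L.s0 π H x
        - (pathProb P L.s0 π H x * ∑ h : Fin H, u (x h.castSucc)) / (2 * κ) := by
    intro x
    by_cases hx : pathProb P L.s0 π H x = 0
    · simp [hx]
    have hux : ∀ h : Fin H, u (x h.castSucc) ∈ Set.Icc (0 : ℝ) 1 := fun h => hu _ (by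
      rw [hP.layer_of_pathProb_ne_zero le_rfl hx]
      exact h.2)
    have hsum : (∑ h : Fin H, u (x h.castSucc)) / κ ∈ Set.Icc (0 : ℝ) 1 := by
      refine ⟨div_nonneg (sum_nonneg fun h _ => (hux h).1) hκ0.le, (div_le_one hκ0).2 ?_⟩
      calc ∑ h : Fin H, u (x h.castSucc) ≤ ∑ _h : Fin H, 1 := sum_le_sum fun h _ => (hux h).2
        _ ≤ κ := by simpa using hκ
    rw [neg_div]
    refine (mul_le_mul_of_nonneg_left (exp_neg_le_one_sub_half hsum)
      (hP.pathProb_nonneg π le_rfl x)).trans_eq ?_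
    field_simp
  refine (sum_le_sum fun x _ => hterm x).trans_eq ?_
  rw [sum_sub_distrib, ← sum_div, hP.sum_pathProb π le_rfl, hP.sum_pathProb_mul_sum π u]

namespace CMDP

variable {C S A : Type*} [Fintype C] [Fintype S] {H : ℕ} (M : CMDP C S A H)

lemma r_mem_Icc (c : C) (s : S) (a : A) : M.r c s a ∈ Set.Icc (0 : ℝ) 1 := by
  have := M.R_prob c s a
  refine ⟨integral_nonneg_of_ae ((M.R_mem c s a).mono fun x hx => hx.1), ?_⟩
  have hle := integral_mono_ae (Integrable.of_mem_Icc 0 1 aemeasurable_id (M.R_mem c s a))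
    (integrable_const (1 : ℝ)) ((M.R_mem c s a).mono fun x hx => hx.2)
  simpa [r] using hle

lemma sum_D_mul_one_sub (v : C → ℝ) (k : ℝ) :
    ∑ c, M.D c * (1 - v c / k) = 1 - (∑ c, M.D c * v c) / k := by
  simp only [mul_sub, mul_one, sum_sub_distrib, M.D_sum, sum_div, mul_div_assoc]

lemma sum_D_mul_sum_pathProb_mul_exp_le_one (p : C → S → A) {u : C → S → ℝ}
    (hu : ∀ c s, M.lay.layer s < H → u c s ∈ Set.Icc (0 : ℝ) 1)
    {κ : ℝ} (hκ0 : 0 < κ) (hκ : H ≤ κ) :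
    ∑ c, M.D c * ∑ x, pathProb M.P M.lay.s0 (p c) H x *
      Real.exp ((∑ c, M.D c * expectedSum M.lay M.P (p c) (u c)) / (2 * κ)
        + -(∑ h : Fin H, u c (x h.castSucc)) / κ) ≤ 1 := by
  set e := (∑ c, M.D c * expectedSum M.lay M.P (p c) (u c)) / (2 * κ) with he
  calc _ = Real.exp e * ∑ c, M.D c * ∑ x, pathProb M.P M.lay.s0 (p c) H x *
          Real.exp (-(∑ h : Fin H, u c (x h.castSucc)) / κ) := by
        simp only [Real.exp_add, mul_sum, mul_left_comm _ (Real.exp e)]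
    _ ≤ Real.exp e * ∑ c, M.D c * (1 - expectedSum M.lay M.P (p c) (u c) / (2 * κ)) := by
        gcongr with c
        · exact M.D_nonneg c
        · exact M.isDynamics.sum_pathProb_mul_exp_le (p c) (hu c) hκ0 hκ
    _ = Real.exp e * (1 - e) := by rw [M.sum_D_mul_one_sub, he]
    _ ≤ 1 := exp_mul_one_sub_le_one e

/-- The expected squared error of the reward estimate `f` in an episode with context `c` played
with the policy `p`. -/
def sqErr (f : C → S → A → ℝ) (p : C → S → A) (c : C) : ℝ :=
  expectedSum M.lay M.P (p c) fun s => (f c s (p c s) - M.r c s (p c s)) ^ 2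

lemma lintegral_exp_sq_sub_sq_le (c : C) (s : S) (a : A) (y : ℝ) {κ : ℝ} (hκ : 1 ≤ κ) :
    ∫⁻ z, ENNReal.ofReal (Real.exp (-((y - z) ^ 2 - (M.r c s a - z) ^ 2) / κ)) ∂(M.R c s a)
      ≤ ENNReal.ofReal (Real.exp (-(y - M.r c s a) ^ 2 / (2 * κ))) := by
  have := M.R_prob c s a
  have hκ0 : κ ≠ 0 := by linarith
  set d := y - M.r c s a with hd
  have hexp : ∀ z, -((y - z) ^ 2 - (M.r c s a - z) ^ 2) / κ
      = -d ^ 2 / κ + (2 * d / κ) * (z - ∫ x, x ∂(M.R c s a)) := fun z => by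
    change _ = -d ^ 2 / κ + (2 * d / κ) * (z - M.r c s a)
    rw [hd]
    ring
  have hvar : -d ^ 2 / κ + (2 * d / κ) ^ 2 * (1 - 0) ^ 2 / 8 ≤ -d ^ 2 / (2 * κ) := by
    have hdiff : -d ^ 2 / (2 * κ) - (-d ^ 2 / κ + (2 * d / κ) ^ 2 * (1 - 0) ^ 2 / 8)
        = d ^ 2 * (κ - 1) / (2 * κ ^ 2) := by
      field_simp
      ring
    have hpos : 0 ≤ d ^ 2 * (κ - 1) / (2 * κ ^ 2) :=
      div_nonneg (mul_nonneg (sq_nonneg d) (by linarith)) (by positivity)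
    linarith
  simp only [hexp, Real.exp_add, ENNReal.ofReal_mul (Real.exp_pos _).le]
  rw [lintegral_const_mul' _ _ ENNReal.ofReal_ne_top]
  refine (mul_le_mul_of_nonneg_left (lintegral_exp_le_of_mem_Icc (X := fun x => x)
    aemeasurable_id (M.R_mem c s a) (2 * d / κ)) zero_le).trans ?_
  rw [← ENNReal.ofReal_mul (Real.exp_pos _).le, ← Real.exp_add]
  exact ENNReal.ofReal_le_ofReal (Real.exp_le_exp.2 hvar)

end CMDP

open scoped Classical in
/-- The statistic that compares `v` at the successors of the visits to `(s, a)` before round `t`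
with its mean under `p`, tilted by `k`: its exponential has mean at most `1` when `p` is the law of
the successor and `|v| ≤ 1`. -/
def transitionTest {C S A : Type*} [Fintype S] {H : ℕ} (L : Layering S H) (p : S → ℝ)
    (σ : ℕ → Episode C S A) (pol : ℕ → C → S → A) (s : S) (a : A) (v : S → ℝ) (k : ℝ) (t : ℕ) : ℝ :=
  ∑ i ∈ Ico 1 t, if (σ i).st (L.layer s) = s ∧ pol i (σ i).ctx s = a then
    k * (v ((σ i).st (L.layer s + 1)) - ∑ s', p s' * v s') - k ^ 2 / 2 else 0

namespace IsInteraction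

variable {C S A Ω : Type*} [Fintype C] [Fintype S] [Finite A] {H T : ℕ}
  {mΩ : MeasurableSpace Ω} {μ : Measure Ω} [IsProbabilityMeasure μ] {M : CMDP C S A H}
  {𝓕 : Filtration ℕ mΩ} {σ : ℕ → Ω → Episode C S A} {pol : ℕ → Ω → C → S → A}

lemma measure_regression_le (hI : IsInteraction M T μ 𝓕 σ pol) (hH : 0 < H)
    {f f₀ : C → S → A → ℝ} (hf : ∀ c s a, f c s a ∈ Set.Icc (0 : ℝ) 1)
    (hf₀ : ∀ c s a, M.lay.layer s < H → f₀ c s a = M.r c s a)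
    {t : ℕ} (ht : t ≤ T + 1) {ε : ℝ} (hε : 0 < ε) :
    μ {ω | Real.log (1 / ε) ≤ (∑ i ∈ Ico 1 t, ∑ c, M.D c * M.sqErr f (pol i ω) c) / (4 * H)
        - (sqLoss H (fun j => σ j ω) t f - sqLoss H (fun j => σ j ω) t f₀) / H}
      ≤ ENNReal.ofReal ε := by
  have hH1 : (1 : ℝ) ≤ H := by exact_mod_cast hH
  have hsq : ∀ c s a, (f c s a - M.r c s a) ^ 2 ∈ Set.Icc (0 : ℝ) 1 := fun c s a => by
    refine ⟨sq_nonneg _, (sq_le_one_iff_abs_le_one _).2 ?_⟩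
    exact (abs_sub_le_of_le_of_le (hf c s a).1 (hf c s a).2 (M.r_mem_Icc c s a).1
      (M.r_mem_Icc c s a).2).trans_eq (sub_zero 1)
  convert hI.measure_log_le_sum_round_le
    (fun p _ _ _ => (∑ c, M.D c * M.sqErr f p c) / (4 * H))
    (g := fun c s a z => -((f c s a - z) ^ 2 - (f₀ c s a - z) ^ 2) / H)
    (fun c s a => by fun_prop) (B := fun c s a => -(f c s a - M.r c s a) ^ 2 / (2 * H))
    (fun c s a hs => by
      simpa only [hf₀ c s a hs] using M.lintegral_exp_sq_sub_sq_le c s a (f c s a) hH1)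
    (fun p _ => ?_) ht hε using 5 with ω
  · rw [sum_add_distrib, sub_eq_add_neg, ← sum_div]
    simp only [sqLoss, ← sum_sub_distrib, sum_neg_distrib, sum_div, neg_div]
  · refine le_of_eq_of_le ?_ (M.sum_D_mul_sum_pathProb_mul_exp_le_one p
      (u := fun c s => (f c s (p c s) - M.r c s (p c s)) ^ 2) (fun c s _ => hsq c s (p c s))
      (κ := 2 * H) (by linarith) (by linarith))
    simp only [CMDP.sqErr, sum_div, ← sum_neg_distrib, ← mul_assoc]
    norm_num

lemma measure_log_le_sum_path_le (hI : IsInteraction M T μ 𝓕 σ pol)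
    (y : (C → S → A) → (S → A → ℕ) → C → (Fin (H + 1) → S) → ℝ)
    (hy : ∀ p N, ∑ c, M.D c * ∑ x, pathProb M.P M.lay.s0 (p c) H x * Real.exp (y p N c x) ≤ 1)
    {t : ℕ} (ht : t ≤ T + 1) {ε : ℝ} (hε : 0 < ε) :
    μ {ω | Real.log (1 / ε) ≤ ∑ i ∈ Ico 1 t,
      y (pol i ω) (visits H (fun j => σ j ω) i) (σ i ω).ctx ((σ i ω).path H)}
      ≤ ENNReal.ofReal ε := by
  have := M.R_prob
  simpa using hI.measure_log_le_sum_round_le y (g := fun _ _ _ _ => 0)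
    (fun _ _ _ => measurable_const) (B := fun _ _ _ => 0) (fun _ _ _ _ => by simp)
    (by simpa using hy) ht hε

lemma measure_visited_le (hI : IsInteraction M T μ 𝓕 σ pol) (hH : 0 < H)
    {u : (S → A → ℕ) → S → A → ℝ} (hu : ∀ N s a, u N s a ∈ Set.Icc (0 : ℝ) 1)
    {t : ℕ} (ht : t ≤ T + 1) {ε : ℝ} (hε : 0 < ε) :
    μ {ω | Real.log (1 / ε) ≤
        (∑ i ∈ Ico 1 t, ∑ c, M.D c * expectedSum M.lay M.P (pol i ω c) fun s =>
          u (visits H (fun j => σ j ω) i) s (pol i ω c s)) / (2 * H)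
        - (∑ i ∈ Ico 1 t, ∑ h ∈ range H, u (visits H (fun j => σ j ω) i) ((σ i ω).st h)
            (pol i ω (σ i ω).ctx ((σ i ω).st h))) / H}
      ≤ ENNReal.ofReal ε := by
  have hH0 : (0 : ℝ) < H := by exact_mod_cast hH
  convert hI.measure_log_le_sum_path_le (fun p N c x =>
    (∑ c, M.D c * expectedSum M.lay M.P (p c) fun s => u N s (p c s)) / (2 * H)
      + -(∑ h : Fin H, u N (x h.castSucc) (p c (x h.castSucc))) / H)
    (fun p N => M.sum_D_mul_sum_pathProb_mul_exp_le_one p (u := fun c s => u N s (p c s))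
      (fun c s _ => hu N s (p c s)) hH0 le_rfl) ht hε using 5 with ω
  simp only [sum_add_distrib, sum_neg_distrib, sum_div, neg_div, sum_range, sub_eq_add_neg]
  rfl

lemma measure_contexts_le (hI : IsInteraction M T μ 𝓕 σ pol) (hH : 0 < H)
    {v : (C → S → A) → C → ℝ} (hv : ∀ p c, v p c ∈ Set.Icc (0 : ℝ) H)
    {t : ℕ} (ht : t ≤ T + 1) {ε : ℝ} (hε : 0 < ε) :
    μ {ω | Real.log (1 / ε) ≤ (∑ i ∈ Ico 1 t, v (pol i ω) (σ i ω).ctx) / H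
        - 2 * (∑ i ∈ Ico 1 t, ∑ c, M.D c * v (pol i ω) c) / H}
      ≤ ENNReal.ofReal ε := by
  have hH0 : (0 : ℝ) < H := by exact_mod_cast hH
  convert hI.measure_log_le_sum_path_le (fun p _ c _ =>
    v p c / H + -(2 * (∑ c, M.D c * v p c) / H)) (fun p _ => ?_) ht hε using 5 with ω
  · rw [sum_add_distrib, ← sum_div, sum_neg_distrib, ← sum_div, ← mul_sum, sub_eq_add_neg]
  set e := 2 * (∑ c, M.D c * v p c) / H with he
  have hexp : ∀ c, Real.exp (v p c / H) ≤ 1 - -2 * v p c / H := fun c =>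
    (exp_le_one_add_two_mul ⟨div_nonneg (hv p c).1 hH0.le,
      (div_le_one hH0).2 (hv p c).2⟩).trans_eq (by ring)
  calc ∑ c, M.D c * ∑ x, pathProb M.P M.lay.s0 (p c) H x * Real.exp (v p c / H + -e)
      = (∑ c, M.D c * Real.exp (v p c / H)) * Real.exp (-e) := by
        simp only [← sum_mul, M.isDynamics.sum_pathProb _ le_rfl, one_mul, Real.exp_add,
          ← mul_assoc]
    _ ≤ (∑ c, M.D c * (1 - -2 * v p c / H)) * Real.exp (-e) := by
        gcongr with c
        · exact M.D_nonneg c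
        · exact hexp c
    _ = Real.exp (-e) * (1 - -e) := by
        rw [M.sum_D_mul_one_sub, he, mul_comm]
        simp only [mul_left_comm _ (-2 : ℝ), ← mul_sum]
        ring
    _ ≤ 1 := exp_mul_one_sub_le_one (-e)

lemma measure_transitions_le (hI : IsInteraction M T μ 𝓕 σ pol)
    {s : S} (hs : M.lay.layer s < H) (a : A) {v : S → ℝ} (hv : ∀ s', v s' ∈ Set.Icc (-1 : ℝ) 1)
    (k : ℝ) {t : ℕ} (ht : t ≤ T + 1) {ε : ℝ} (hε : 0 < ε) :
    μ {ω | Real.log (1 / ε) ≤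
        transitionTest M.lay (M.P s a) (fun i => σ i ω) (fun i => pol i ω) s a v k t}
      ≤ ENNReal.ofReal ε := by
  classical
  let h₀ : Fin H := ⟨M.lay.layer s, hs⟩
  refine hI.measure_log_le_sum_path_le (fun p _ c x => if x h₀.castSucc = s ∧ p c s = a then
    k * (v (x h₀.succ) - ∑ s', M.P s a s' * v s') - k ^ 2 / 2 else 0) (fun p _ => ?_) ht hε
  rw [← M.D_sum]
  refine sum_le_sum fun c _ => mul_le_of_le_one_right (M.D_nonneg c) ?_
  rw [M.isDynamics.sum_pathProb_mul_pair (p c) le_rfl h₀ (fun z z' => Real.exp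
    (if z = s ∧ p c s = a then k * (v z' - ∑ s', M.P s a s' * v s') - k ^ 2 / 2 else 0)),
    ← M.isDynamics.sum_occ (p c) h₀.2.le]
  refine sum_le_sum fun z _ => ?_
  by_cases hz : M.lay.layer z = h₀
  swap
  · rw [M.isDynamics.occ_eq_zero (p c) h₀.2.le hz, zero_mul]
  refine mul_le_of_le_one_right (M.isDynamics.occ_nonneg (p c) h₀.2.le z) ?_
  by_cases hza : z = s ∧ p c s = a
  · simp only [hza, and_self, if_true, sub_eq_add_neg _ (k ^ 2 / 2), Real.exp_add, ← mul_assoc,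
      ← sum_mul]
    refine (mul_le_mul_of_nonneg_right (sum_mul_exp_le_of_mem_Icc
      (fun s' => M.isDynamics.nonneg s a s' hs) (M.isDynamics.sum_eq_one s a hs) hv k)
      (Real.exp_pos _).le).trans_eq ?_
    rw [← Real.exp_add, Real.exp_eq_one_iff]
    ring
  · simp only [hza, if_false, Real.exp_zero, mul_one]
    exact (M.isDynamics.sum_eq_one _ _ (hz.trans_lt h₀.2)).le

end IsInteraction

end Events

section Consistent

section Counts

variable {C S A : Type*} {H : ℕ} {σ : ℕ → Episode C S A} {t : ℕ} {s : S} {a : A}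

lemma visits_le (H : ℕ) (σ : ℕ → Episode C S A) (t : ℕ) (s : S) (a : A) :
    visits H σ t s a ≤ t - 1 := by
  classical exact (card_filter_le _ _).trans_eq (Nat.card_Ico 1 t)

lemma visitsNext_le_visits (H : ℕ) (σ : ℕ → Episode C S A) (t : ℕ) (s : S) (a : A) (s' : S) :
    visitsNext H σ t s a s' ≤ visits H σ t s a := by
  classical
  exact card_le_card (monotone_filter_right _ fun _ _ ⟨h, hh, hst, hact, _⟩ => ⟨h, hh, hst, hact⟩)

variable [Fintype S] {p : S → ℝ}

lemma sum_abs_empP_sub_of_visits_eq_zero (hp : ∀ s', 0 ≤ p s') (hp1 : ∑ s', p s' = 1)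
    (h0 : visits H σ t s a = 0) : ∑ s', |empP H σ t s a s' - p s'| = 1 := by
  have hnext : ∀ s', visitsNext H σ t s a s' = 0 := fun s' =>
    Nat.le_zero.1 ((visitsNext_le_visits H σ t s a s').trans h0.le)
  simpa only [empP, hnext, Nat.cast_zero, zero_div, zero_sub, abs_neg, abs_of_nonneg (hp _)]
    using hp1

lemma sum_abs_empP_sub_of_visits_pos (p : S → ℝ) (hpos : 0 < visits H σ t s a) :
    ∑ s', |empP H σ t s a s' - p s'|
      = (∑ s', |(visitsNext H σ t s a s' : ℝ) - visits H σ t s a * p s'|) / visits H σ t s a := by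
  have hpos' : (0 : ℝ) < visits H σ t s a := by exact_mod_cast hpos
  rw [sum_div]
  refine sum_congr rfl fun s' _ => ?_
  rw [empP, max_eq_right (by exact_mod_cast hpos), ← abs_of_pos hpos', ← abs_div, abs_of_pos hpos',
    sub_div, mul_div_cancel_left₀ _ hpos'.ne']

end Counts

variable {C S A : Type*} {H T : ℕ}

/-- The properties that every sample path has almost surely: step `h` is in layer `h`, and the
actions are those of the policies. -/
structure IsConsistent (L : Layering S H) (T : ℕ) (σ : ℕ → Episode C S A) (pol : ℕ → C → S → A) :
    Prop where
  layer_st : ∀ i ∈ Icc 1 T, ∀ h ≤ H, L.layer ((σ i).st h) = h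
  act_eq : ∀ i ∈ Icc 1 T, ∀ h < H, (σ i).act h = pol i (σ i).ctx ((σ i).st h)

namespace IsConsistent

variable {L : Layering S H} {σ : ℕ → Episode C S A} {pol : ℕ → C → S → A}

lemma visited_iff (hc : IsConsistent L T σ pol) {i : ℕ} (hi : i ∈ Icc 1 T) {s : S}
    (hs : L.layer s < H) (a : A) (Q : ℕ → Prop) :
    (∃ h < H, (σ i).st h = s ∧ (σ i).act h = a ∧ Q h)
      ↔ ((σ i).st (L.layer s) = s ∧ pol i (σ i).ctx s = a) ∧ Q (L.layer s) := by
  constructor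
  · rintro ⟨h, hh, rfl, rfl, hQ⟩
    rw [hc.layer_st i hi h hh.le]
    exact ⟨⟨rfl, (hc.act_eq i hi h hh).symm⟩, hQ⟩
  · rintro ⟨⟨hst, hact⟩, hQ⟩
    exact ⟨L.layer s, hs, hst, by rw [hc.act_eq i hi _ hs, hst, hact], hQ⟩

open scoped Classical in
lemma visits_eq (hc : IsConsistent L T σ pol) {t : ℕ} (ht : t ≤ T + 1) {s : S}
    (hs : L.layer s < H) (a : A) :
    visits H σ t s a = #{i ∈ Ico 1 t | (σ i).st (L.layer s) = s ∧ pol i (σ i).ctx s = a} := by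
  refine congrArg card (filter_congr fun i hi => ?_)
  rw [mem_Ico] at hi
  simpa only [and_true] using
    hc.visited_iff (i := i) (mem_Icc.2 (by omega)) hs a fun _ => True

open scoped Classical in
lemma sum_mul_visitsNext [Fintype S] (hc : IsConsistent L T σ pol) {t : ℕ} (ht : t ≤ T + 1) {s : S}
    (hs : L.layer s < H) (a : A) (v : S → ℝ) :
    ∑ s', v s' * (visitsNext H σ t s a s' : ℝ)
      = ∑ i ∈ Ico 1 t with (σ i).st (L.layer s) = s ∧ pol i (σ i).ctx s = a,
        v ((σ i).st (L.layer s + 1)) := by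
  have hnext : ∀ s', visitsNext H σ t s a s' = #{i ∈ Ico 1 t |
      ((σ i).st (L.layer s) = s ∧ pol i (σ i).ctx s = a) ∧ (σ i).st (L.layer s + 1) = s'} := by
    refine fun s' => congrArg card (filter_congr fun i hi => ?_)
    rw [mem_Ico] at hi
    exact hc.visited_iff (mem_Icc.2 (by omega)) hs a fun h => (σ i).st (h + 1) = s'
  rw [← sum_fiberwise _ fun i => (σ i).st (L.layer s + 1)]
  refine sum_congr rfl fun s' _ => ?_
  rw [hnext, filter_filter, sum_congr rfl fun i hi => by rw [(mem_filter.1 hi).2.2], sum_const,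
    nsmul_eq_mul, mul_comm]

lemma transitionTest_eq [Fintype S] (hc : IsConsistent L T σ pol) {t : ℕ} (ht : t ≤ T + 1) {s : S}
    (hs : L.layer s < H) (a : A) (p v : S → ℝ) (k : ℝ) :
    transitionTest L p σ pol s a v k t
      = k * ∑ s', v s' * ((visitsNext H σ t s a s' : ℝ) - visits H σ t s a * p s')
        - visits H σ t s a * (k ^ 2 / 2) := by
  have hdev : ∑ s', v s' * ((visitsNext H σ t s a s' : ℝ) - visits H σ t s a * p s')
      = ∑ s', v s' * (visitsNext H σ t s a s' : ℝ) - visits H σ t s a * ∑ s', p s' * v s' := by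
    rw [mul_sum, ← sum_sub_distrib]
    exact sum_congr rfl fun s' _ => by ring
  rw [hdev, hc.sum_mul_visitsNext ht hs, hc.visits_eq ht hs, transitionTest, ← sum_filter,
    sum_sub_distrib, ← mul_sum, sum_sub_distrib, sum_const, sum_const, nsmul_eq_mul, nsmul_eq_mul]

end IsConsistent

lemma exists_units_mul_eq_abs (z : ℝ) : ∃ b : ℤˣ, ((b : ℤ) : ℝ) * z = |z| := by
  obtain hz | hz := le_total 0 z
  · exact ⟨1, by simp [abs_of_nonneg hz]⟩
  · exact ⟨-1, by simp [abs_of_nonpos hz]⟩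

lemma IsConsistent.sum_abs_empP_sub_le [Fintype S] {L : Layering S H} {σ : ℕ → Episode C S A}
    {pol : ℕ → C → S → A} (hc : IsConsistent L T σ pol) {P : S → A → S → ℝ} (hP : L.IsDynamics P)
    {t : ℕ} (ht : t ∈ Icc 1 T) {s : S} (hs : L.layer s < H) (a : A) {l : ℝ} (hl : 0 < l)
    (htest : ∀ n ∈ Icc 1 T, ∀ b : S → ℤˣ, transitionTest L (P s a) σ pol s a
      (fun s' => ((b s' : ℤ) : ℝ)) (Real.sqrt (2 * l / n)) t < l)
    {Λ : ℝ} (hΛ : 2 * l ≤ Λ) (hΛ1 : 1 ≤ Λ) :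
    ∑ s', |empP H σ t s a s' - P s a s'| ≤ Real.sqrt (Λ / max 1 (visits H σ t s a : ℝ)) := by
  rw [mem_Icc] at ht
  obtain h0 | hpos := Nat.eq_zero_or_pos (visits H σ t s a)
  · rw [sum_abs_empP_sub_of_visits_eq_zero (fun s' => hP.nonneg s a s' hs) (hP.sum_eq_one s a hs)
      h0, h0, Nat.cast_zero, max_eq_left zero_le_one, div_one]
    exact Real.one_le_sqrt.2 hΛ1
  have hvT : visits H σ t s a ≤ T := (visits_le H σ t s a).trans (by omega)
  choose b hb using fun s' =>
    exists_units_mul_eq_abs ((visitsNext H σ t s a s' : ℝ) - visits H σ t s a * P s a s')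
  have hdev := htest (visits H σ t s a) (mem_Icc.2 ⟨hpos, hvT⟩) b
  rw [hc.transitionTest_eq (by omega) hs] at hdev
  simp only [hb] at hdev
  rw [sum_abs_empP_sub_of_visits_pos _ hpos, max_eq_right (by exact_mod_cast hpos)]
  set n : ℝ := ((visits H σ t s a : ℕ) : ℝ)
  have hn : 0 < n := Nat.cast_pos.2 hpos
  have hk : 0 < Real.sqrt (2 * l / n) := Real.sqrt_pos.2 (by positivity)
  have hk_sq : n * Real.sqrt (2 * l / n) ^ 2 = 2 * l := by
    rw [Real.sq_sqrt (by positivity)]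
    field_simp
  calc _ ≤ Real.sqrt (2 * l / n) :=
        (div_le_iff₀ hn).2 (le_of_mul_le_mul_left (by linarith) hk)
    _ ≤ _ := Real.sqrt_le_sqrt (by gcongr)

end Consistent

section GoodEvent

open scoped ENNReal

lemma measure_biUnion_le_ofReal_card_mul {Ω ι : Type*} {_ : MeasurableSpace Ω} {μ : Measure Ω}
    (I : Finset ι) {E : ι → Set Ω} {ε : ℝ} (hE : ∀ i ∈ I, μ (E i) ≤ ENNReal.ofReal ε) :
    μ (⋃ i ∈ I, E i) ≤ ENNReal.ofReal (#I * ε) := by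
  refine (measure_biUnion_finset_le I E).trans ((sum_le_card_nsmul I _ _ hE).trans_eq ?_)
  rw [nsmul_eq_mul, ENNReal.ofReal_mul (Nat.cast_nonneg _), ENNReal.ofReal_natCast]

lemma sum_one_div_cube_le (T : ℕ) : ∑ t ∈ Icc 1 T, 1 / (t : ℝ) ^ 3 ≤ 2 := by
  suffices h : ∑ t ∈ Icc 1 T, 1 / (t : ℝ) ^ 3 ≤ 2 - 2 / ((T : ℝ) + 1) from
    h.trans (sub_le_self _ (by positivity))
  induction T with
  | zero => simp
  | succ n ih =>
    rw [sum_Icc_succ_top (by omega)]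
    push_cast
    have hn : (0 : ℝ) ≤ n := Nat.cast_nonneg n
    have htelescope :
        1 / ((n : ℝ) + 1) ^ 3 ≤ 2 / ((n : ℝ) + 1) - 2 / ((n : ℝ) + 1 + 1) := by
      rw [div_sub_div _ _ (by positivity) (by positivity), div_le_div_iff₀ (by positivity)
        (by positivity)]
      nlinarith [pow_nonneg hn 2, pow_nonneg hn 3]
    linarith

lemma xi_eq_sqrt {C S A : Type*} [Fintype S] [Fintype A] (H T : ℕ) (δ : ℝ)
    (σ : ℕ → Episode C S A) (t : ℕ) (s : S) (a : A) :
    xi H T δ σ t s a = Real.sqrt ((4 * (Fintype.card S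
      + 2 * Real.log (4 * Fintype.card S * Fintype.card A * (T : ℝ) ^ 2 / δ)))
      / max 1 (visits H σ t s a : ℝ)) := by
  have h4 : Real.sqrt 4 = 2 := by
    rw [show (4 : ℝ) = 2 ^ 2 by norm_num, Real.sqrt_sq (by norm_num)]
  rw [xi, mul_div_assoc 4 (_ + _), Real.sqrt_mul (by norm_num), h4]

lemma one_lt_confidence_ratio {s a T : ℕ} (hs : 0 < s) (ha : 0 < a) (hT : 0 < T) {δ : ℝ}
    (hδ : 0 < δ) (hδ1 : δ < 1) : 1 < 4 * s * a * (T : ℝ) ^ 2 / δ := by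
  have h1 : (1 : ℝ) ≤ s * a * (T : ℝ) ^ 2 := by
    exact_mod_cast Nat.one_le_iff_ne_zero.2 (by positivity)
  rw [lt_div_iff₀ hδ]
  linarith

namespace IsInteraction

variable {C S A Ω : Type*} [Fintype C] [Fintype S] {H T : ℕ}
  {mΩ : MeasurableSpace Ω} {μ : Measure Ω} [IsProbabilityMeasure μ] {M : CMDP C S A H}
  {𝓕 : Filtration ℕ mΩ} {σ : ℕ → Ω → Episode C S A} {pol : ℕ → Ω → C → S → A}

lemma ae_isConsistent [Finite A] (hI : IsInteraction M T μ 𝓕 σ pol) :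
    ∀ᵐ ω ∂μ, IsConsistent M.lay T (fun t => σ t ω) (fun t => pol t ω) := by
  have hst : ∀ᵐ ω ∂μ, ∀ i ∈ Icc 1 T, ∀ h ≤ H, M.lay.layer ((σ i ω).st h) = h :=
    (ae_ball_iff (Set.to_countable _)).2 fun i hi => hI.ae_layer hi
  have hact : ∀ᵐ ω ∂μ, ∀ i ∈ Icc 1 T, ∀ h < H,
      (σ i ω).act h = pol i ω (σ i ω).ctx ((σ i ω).st h) :=
    (ae_ball_iff (Set.to_countable _)).2 fun i hi =>
      (ae_ball_iff (Set.to_countable {h | h < H})).2 fun h hh => hI.act_eq i hi h hh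
  filter_upwards [hst, hact] with ω hω hω' using ⟨hω, hω'⟩

lemma measure_exists_transitionTest_le [Fintype A] (hI : IsInteraction M T μ 𝓕 σ pol) {ε : ℝ}
    (hε : 0 < ε) :
    μ {ω | ∃ t ∈ Icc 1 T, ∃ n ∈ Icc 1 T, ∃ s a, M.lay.layer s < H ∧ ∃ b : S → ℤˣ,
        Real.log (1 / ε) ≤ transitionTest M.lay (M.P s a) (fun i => σ i ω) (fun i => pol i ω) s a
          (fun s' => ((b s' : ℤ) : ℝ)) (Real.sqrt (2 * Real.log (1 / ε) / n)) t}
      ≤ ENNReal.ofReal (T ^ 2 * Fintype.card S * Fintype.card A * 2 ^ Fintype.card S * ε) := by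
  classical
  have hunits : ∀ z : ℤˣ, ((z : ℤ) : ℝ) ∈ Set.Icc (-1 : ℝ) 1 := fun z => by
    obtain rfl | rfl := Int.units_eq_one_or z <;> norm_num
  let I : Finset (ℕ × ℕ × (S × A) × (S → ℤˣ)) := {j ∈ Icc 1 T ×ˢ Icc 1 T ×ˢ univ ×ˢ univ |
    M.lay.layer j.2.2.1.1 < H}
  have hI_card : #I ≤ T * (T * (Fintype.card S * Fintype.card A * 2 ^ Fintype.card S)) := by
    refine (card_filter_le _ _).trans_eq ?_
    simp only [card_product, Nat.card_Icc, Nat.add_sub_cancel, card_univ, Fintype.card_prod,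
      Fintype.card_fun, Fintype.card_units_int]
  refine (measure_mono ?_).trans ((measure_biUnion_le_ofReal_card_mul I (ε := ε)
    (E := fun j => {ω | Real.log (1 / ε) ≤ transitionTest M.lay (M.P j.2.2.1.1 j.2.2.1.2)
      (fun i => σ i ω) (fun i => pol i ω) j.2.2.1.1 j.2.2.1.2 (fun s' => ((j.2.2.2 s' : ℤ) : ℝ))
      (Real.sqrt (2 * Real.log (1 / ε) / j.2.1)) j.1}) fun j hj => ?_).trans ?_)
  · rintro ω ⟨t, ht, n, hn, s, a, hs, b, htest⟩
    refine Set.mem_biUnion (x := (t, n, (s, a), b)) ?_ htest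
    simp only [I, coe_filter, Set.mem_ofPred_eq, mem_product, mem_univ, and_true]
    exact ⟨⟨ht, hn⟩, hs⟩
  · simp only [I, mem_filter, mem_product, mem_Icc] at hj
    exact hI.measure_transitions_le hj.2 _ (fun s' => hunits _) _ (by omega) hε
  · refine ENNReal.ofReal_le_ofReal (mul_le_mul_of_nonneg_right ?_ hε.le)
    calc (#I : ℝ) ≤ _ := Nat.cast_le.2 hI_card
      _ = _ := by push_cast; ring

lemma measure_not_confidence_le [Fintype A] [Nonempty A] (hI : IsInteraction M T μ 𝓕 σ pol)
    (hT : 0 < T) {δ : ℝ} (hδ : 0 < δ) (hδ1 : δ < 1) :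
    μ {ω | ¬ ∀ t ∈ Icc 1 T, ∀ s a, M.lay.layer s < H →
        ∑ s', |empP H (fun j => σ j ω) t s a s' - M.P s a s'| ≤ xi H T δ (fun j => σ j ω) t s a}
      ≤ ENNReal.ofReal (δ / 4) := by
  have : Nonempty S := ⟨M.lay.s0⟩
  have hS : (1 : ℝ) ≤ Fintype.card S := by exact_mod_cast Fintype.card_pos
  set X : ℝ := 4 * Fintype.card S * Fintype.card A * (T : ℝ) ^ 2 / δ with hX
  have hX1 : 1 < X := one_lt_confidence_ratio Fintype.card_pos Fintype.card_pos hT hδ hδ1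
  set ε : ℝ := 1 / (X * 2 ^ Fintype.card S) with hε
  have hε0 : 0 < ε := by positivity
  have hlogX : 0 < Real.log X := Real.log_pos hX1
  have hlog : Real.log (1 / ε) = Real.log X + Fintype.card S * Real.log 2 := by
    rw [hε, one_div_one_div, Real.log_mul (by positivity) (by positivity), Real.log_pow]
  have hlog2' : Fintype.card S * Real.log 2 ≤ Fintype.card S :=
    mul_le_of_le_one_right (by positivity) (by linarith [Real.log_two_lt_d9])
  have hunion := hI.measure_exists_transitionTest_le hε0
  have hδ4 : T ^ 2 * Fintype.card S * Fintype.card A * 2 ^ Fintype.card S * ε = δ / 4 := by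
    rw [hε, hX]
    field_simp
  rw [hδ4] at hunion
  refine (measure_mono_ae ?_).trans hunion
  filter_upwards [hI.ae_isConsistent] with ω hω hnot
  by_contra hgood
  refine hnot fun t ht s a hs => ?_
  rw [xi_eq_sqrt]
  refine hω.sum_abs_empP_sub_le M.isDynamics ht hs a (l := Real.log (1 / ε))
    (by rw [hlog]; positivity) (fun n hn b => ?_) (by linarith) (by linarith)
  by_contra hcon
  exact hgood ⟨t, ht, n, hn, s, a, hs, b, not_lt.1 hcon⟩

lemma measure_not_regression_le [Finite A] (hI : IsInteraction M T μ 𝓕 σ pol) (hH : 0 < H)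
    {F : Finset (C → S → A → ℝ)} (hF : ∀ f ∈ F, ∀ c s a, f c s a ∈ Set.Icc (0 : ℝ) 1)
    {f₀ : C → S → A → ℝ} (hf₀F : f₀ ∈ F)
    (hf₀ : ∀ c s a, M.lay.layer s < H → f₀ c s a = M.r c s a) {δ : ℝ} (hδ : 0 < δ) :
    μ {ω | ¬ ∀ t ∈ Icc 1 T, ∀ f ∈ F, ∑ i ∈ Ico 1 t, ∑ c, M.D c * M.sqErr f (pol i ω) c
        ≤ 4 * (sqLoss H (fun j => σ j ω) t f - sqLoss H (fun j => σ j ω) t f₀)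
          + 4 * H * Real.log (8 * #F * (t : ℝ) ^ 3 / δ)}
      ≤ ENNReal.ofReal (δ / 4) := by
  have hF0 : (0 : ℝ) < #F := by exact_mod_cast card_pos.2 ⟨f₀, hf₀F⟩
  let bad : ℕ → (C → S → A → ℝ) → Set Ω := fun t f =>
    {ω | Real.log (8 * #F * (t : ℝ) ^ 3 / δ) ≤
      (∑ i ∈ Ico 1 t, ∑ c, M.D c * M.sqErr f (pol i ω) c) / (4 * H)
        - (sqLoss H (fun j => σ j ω) t f - sqLoss H (fun j => σ j ω) t f₀) / H}
  have hbad : ∀ t ∈ Icc 1 T, μ (⋃ f ∈ F, bad t f) ≤ ENNReal.ofReal (δ / 8 * (1 / (t : ℝ) ^ 3)) := by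
    intro t ht
    rw [mem_Icc] at ht
    have ht0 : (0 : ℝ) < t := by exact_mod_cast ht.1
    refine (measure_biUnion_le_ofReal_card_mul F (ε := δ / (8 * #F * (t : ℝ) ^ 3))
      fun f hf => ?_).trans_eq ?_
    · simpa only [bad, one_div_div] using
        hI.measure_regression_le hH (hF f hf) hf₀ (by omega : t ≤ T + 1)
          (by positivity : 0 < δ / (8 * #F * (t : ℝ) ^ 3))
    · congr 1
      field_simp
  calc _ ≤ μ (⋃ t ∈ Icc 1 T, ⋃ f ∈ F, bad t f) := measure_mono fun ω hω => by
        simp only [Set.mem_ofPred_eq, not_forall, not_le] at hω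
        obtain ⟨t, ht, f, hf, hlt⟩ := hω
        refine Set.mem_biUnion ht (Set.mem_biUnion hf (Set.mem_ofPred_eq.mpr ?_))
        rw [← mul_div_mul_left _ (H : ℝ) (four_ne_zero' ℝ), ← sub_div,
          le_div_iff₀ (mul_pos four_pos (Nat.cast_pos.2 hH))]
        linarith
    _ ≤ ∑ t ∈ Icc 1 T, ENNReal.ofReal (δ / 8 * (1 / (t : ℝ) ^ 3)) :=
        (measure_biUnion_finset_le _ _).trans (sum_le_sum hbad)
    _ = ENNReal.ofReal (δ / 8 * ∑ t ∈ Icc 1 T, 1 / (t : ℝ) ^ 3) := by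
        rw [← ENNReal.ofReal_sum_of_nonneg fun t _ => by positivity, ← mul_sum]
    _ ≤ ENNReal.ofReal (δ / 4) := ENNReal.ofReal_le_ofReal (by
        linarith [mul_le_mul_of_nonneg_left (sum_one_div_cube_le T) (by positivity : 0 ≤ δ / 8)])

end IsInteraction

end GoodEvent

section Sums

lemma one_div_sqrt_succ_le (n : ℕ) :
    1 / Real.sqrt ((n : ℝ) + 1) ≤ 2 * Real.sqrt ((n : ℝ) + 1) - 2 * Real.sqrt n := by
  have hn : (0 : ℝ) ≤ n := Nat.cast_nonneg n
  have hsq := Real.sq_sqrt hn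
  have hsq_succ := Real.sq_sqrt (add_nonneg hn zero_le_one)
  rw [div_le_iff₀ (Real.sqrt_pos.2 (by positivity))]
  nlinarith only [hsq, hsq_succ, sq_nonneg (Real.sqrt ((n : ℝ) + 1) - Real.sqrt n)]

lemma sum_one_div_sqrt_le (m T : ℕ) :
    ∑ t ∈ Ico (m + 1) (T + 1), 1 / Real.sqrt t ≤ 2 * Real.sqrt T := by
  calc ∑ t ∈ Ico (m + 1) (T + 1), 1 / Real.sqrt t
      ≤ ∑ t ∈ Ico 1 (T + 1), 1 / Real.sqrt t :=
        sum_le_sum_of_subset_of_nonneg (Ico_subset_Ico_left (by omega)) fun _ _ _ => by positivity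
    _ = ∑ n ∈ range T, 1 / Real.sqrt ((n : ℝ) + 1) := by
        rw [sum_Ico_eq_sum_range]
        simp only [Nat.add_sub_cancel, Nat.cast_add, Nat.cast_one, add_comm (1 : ℝ)]
    _ ≤ ∑ n ∈ range T, (2 * Real.sqrt ((n + 1 : ℕ) : ℝ) - 2 * Real.sqrt n) :=
        sum_le_sum fun n _ => by push_cast; exact one_div_sqrt_succ_le n
    _ = 2 * Real.sqrt T := by
        rw [sum_range_sub fun n : ℕ => 2 * Real.sqrt n, Nat.cast_zero, Real.sqrt_zero, mul_zero,
          sub_zero]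

lemma three_mul_sqrt_add_le (n : ℕ) :
    3 * Real.sqrt n + 1 / Real.sqrt (max 1 (n : ℝ)) ≤ 3 * Real.sqrt ((n : ℝ) + 1) := by
  obtain rfl | hpos := Nat.eq_zero_or_pos n
  · norm_num
  have hn : (1 : ℝ) ≤ n := by exact_mod_cast hpos
  set u := Real.sqrt n with hu
  set v := Real.sqrt ((n : ℝ) + 1) with hv
  have hu0 : 0 < u := Real.sqrt_pos.2 (by linarith)
  have hv0 : 0 < v := Real.sqrt_pos.2 (by linarith)
  have hmul : (v - u) * (v + u) = 1 := by
    have hu2 : u ^ 2 = n := Real.sq_sqrt (by linarith)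
    have hv2 : v ^ 2 = n + 1 := Real.sq_sqrt (by linarith)
    linear_combination hv2 - hu2
  have hvu : v ≤ 2 * u := by
    rw [hv, Real.sqrt_le_left (by positivity), mul_pow, Real.sq_sqrt (by linarith)]
    linarith
  rw [max_eq_right hn, ← hu]
  have hdiff : 1 / u ≤ 3 * (v - u) := by
    rw [div_le_iff₀ hu0, ← hmul]
    nlinarith [pos_of_mul_pos_left (hmul ▸ one_pos : 0 < (v - u) * (v + u)) (by positivity)]
  linarith

lemma one_div_le_two_mul_log {x : ℝ} (hx : 1 ≤ x) :
    1 / x ≤ 2 * (Real.log (x + 1) - Real.log x) := by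
  have hlog := Real.one_sub_inv_le_log_of_pos (by positivity : 0 < (x + 1) / x)
  rw [Real.log_div (by linarith) (by linarith), inv_div, one_sub_div (by linarith),
    add_sub_cancel_left] at hlog
  have hdiv : 1 / x ≤ 2 * (1 / (x + 1)) := by
    rw [mul_one_div, div_le_div_iff₀ (by linarith) (by linarith)]
    linarith
  linarith

lemma sum_log_le_card_mul_log {ι : Type*} [Fintype ι] {n : ι → ℝ} (hn : ∀ i, 0 < n i) {x : ℝ}
    (hx : 0 < x) (hsum : ∑ i, n i = x) :
    ∑ i, Real.log (n i) ≤ Fintype.card ι * Real.log (x / Fintype.card ι) := by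
  have : Nonempty ι := by
    by_contra hι
    rw [not_nonempty_iff] at hι
    simp [← hsum] at hx
  have hmean : 0 < x / Fintype.card ι := by positivity
  have hlog : ∀ i, Real.log (n i)
      ≤ n i / (x / Fintype.card ι) - 1 + Real.log (x / Fintype.card ι) := fun i => by
    have hle := Real.log_le_sub_one_of_pos (div_pos (hn i) hmean)
    rw [Real.log_div (hn i).ne' hmean.ne'] at hle
    linarith
  refine (sum_le_sum fun i _ => hlog i).trans_eq ?_
  rw [sum_add_distrib, sum_sub_distrib, ← sum_div, hsum]
  simp only [sum_const, card_univ, nsmul_eq_mul]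
  field_simp
  ring

section CountBefore

open scoped Classical in
/-- The number of indices `1 ≤ i < t` with `x i = a`, as a real number: the shape in which it enters
the denominator of the bonus in `rhat`. -/
def countBefore {A : Type*} (x : ℕ → A) (t : ℕ) (a : A) : ℝ :=
  ∑ i ∈ Ico 1 t, if a = x i then (1 : ℝ) else 0

variable {A : Type*} {x : ℕ → A}

open scoped Classical in
lemma countBefore_succ (x : ℕ → A) {t : ℕ} (ht : 1 ≤ t) (a : A) :
    countBefore x (t + 1) a = countBefore x t a + if a = x t then (1 : ℝ) else 0 := by
  rw [countBefore, sum_Ico_succ_top ht, countBefore]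

lemma one_le_countBefore {t i : ℕ} (hi : i ∈ Ico 1 t) : 1 ≤ countBefore x t (x i) := by
  classical
  simpa only [if_pos, countBefore] using
    single_le_sum (f := fun j => if x i = x j then (1 : ℝ) else 0)
      (fun j _ => by split_ifs <;> norm_num) hi

variable [Fintype A]

lemma sum_countBefore (x : ℕ → A) {t : ℕ} (ht : 1 ≤ t) :
    ∑ a, countBefore x t a = (t : ℝ) - 1 := by
  classical
  simp only [countBefore]
  rw [sum_comm]
  simp [Nat.cast_sub ht]

lemma sum_log_countBefore_succ_sub {t : ℕ} (ht : 1 ≤ t) :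
    ∑ a, (Real.log (countBefore x (t + 1) a) - Real.log (countBefore x t a))
      = Real.log (countBefore x t (x t) + 1) - Real.log (countBefore x t (x t)) := by
  rw [sum_eq_single_of_mem (x t) (mem_univ _) fun a _ ha => by
      rw [countBefore_succ x ht, if_neg ha, add_zero, sub_self],
    countBefore_succ x ht, if_pos rfl]

variable (hx : ∀ a, ∃ i ∈ Icc 1 (Fintype.card A), x i = a)
include hx

lemma one_le_countBefore_of_exists {t : ℕ} (ht : Fintype.card A < t) (a : A) :
    1 ≤ countBefore x t a := by
  obtain ⟨i, hi, rfl⟩ := hx a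
  rw [mem_Icc] at hi
  exact one_le_countBefore (mem_Ico.2 (by omega))

lemma sum_one_div_countBefore_le_sum_log {T : ℕ} (hT : Fintype.card A ≤ T) :
    ∑ t ∈ Ico (Fintype.card A + 1) (T + 1), 1 / countBefore x t (x t)
      ≤ 2 * ∑ a, Real.log (countBefore x (T + 1) a) := by
  induction T, hT using Nat.le_induction with
  | base =>
    rw [Ico_self, sum_empty]
    exact mul_nonneg zero_le_two (sum_nonneg fun a _ =>
      Real.log_nonneg (one_le_countBefore_of_exists hx (Nat.lt_succ_self _) a))
  | succ T hT ih =>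
    rw [sum_Ico_succ_top (by omega)]
    have hlog := one_div_le_two_mul_log
      (one_le_countBefore_of_exists hx (by omega : Fintype.card A < T + 1) (x (T + 1)))
    rw [← sum_log_countBefore_succ_sub (by omega), sum_sub_distrib] at hlog
    linarith

lemma sum_one_div_countBefore_le [Nonempty A] {T : ℕ} (hT : Fintype.card A ≤ T) :
    ∑ t ∈ Ico (Fintype.card A + 1) (T + 1), 1 / countBefore x t (x t)
      ≤ 2 * (Fintype.card A * Real.log (T / Fintype.card A)) := by
  have hT0 : 0 < T := Fintype.card_pos.trans_le hT
  refine (sum_one_div_countBefore_le_sum_log hx hT).trans (mul_le_mul_of_nonneg_left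
    (sum_log_le_card_mul_log (fun a => one_pos.trans_le
      (one_le_countBefore_of_exists hx (by omega) a)) (by exact_mod_cast hT0) ?_) zero_le_two)
  rw [sum_countBefore x (by omega)]
  push_cast
  ring

end CountBefore

end Sums

section VisitSums

variable {C S A : Type*} {H T : ℕ} {L : Layering S H} {σ : ℕ → Episode C S A}
  {pol : ℕ → C → S → A}

open scoped Classical in
lemma visits_succ {t : ℕ} (ht : 1 ≤ t) (s : S) (a : A) :
    visits H σ (t + 1) s a = visits H σ t s a +
      if ∃ h < H, (σ t).st h = s ∧ (σ t).act h = a then 1 else 0 := by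
  simp only [visits, card_filter]
  rw [sum_Ico_succ_top ht]

open scoped Classical in
lemma sum_visited_div_sqrt_le (s : S) (a : A) (T : ℕ) :
    ∑ t ∈ Icc 1 T, (if ∃ h < H, (σ t).st h = s ∧ (σ t).act h = a then
      1 / Real.sqrt (max 1 (visits H σ t s a : ℝ)) else 0)
      ≤ 3 * Real.sqrt (visits H σ (T + 1) s a) := by
  induction T with
  | zero => simp
  | succ T ih =>
    rw [sum_Icc_succ_top (by omega), visits_succ (t := T + 1) (by omega)]
    split_ifs with hvisited
    · push_cast
      exact (add_le_add_left ih _).trans (three_mul_sqrt_add_le _)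
    · rwa [add_zero, add_zero]

variable [Fintype S] [Fintype A]

lemma sum_sqrt_le_sqrt_card_mul_sum {ι : Type*} [Fintype ι] {n : ι → ℝ} (hn : ∀ i, 0 ≤ n i) :
    ∑ i, Real.sqrt (n i) ≤ Real.sqrt (Fintype.card ι * ∑ i, n i) := by
  refine Real.le_sqrt_of_sq_le (sq_sum_le_card_mul_sum_sq.trans_eq ?_)
  simp only [Real.sq_sqrt (hn _), card_univ]

namespace IsConsistent

open scoped Classical in
lemma sum_steps (hc : IsConsistent L T σ pol) {t : ℕ} (ht : t ∈ Icc 1 T) (φ : S → A → ℝ) :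
    ∑ h ∈ range H, φ ((σ t).st h) ((σ t).act h)
      = ∑ q : S × A, if ∃ h < H, (σ t).st h = q.1 ∧ (σ t).act h = q.2 then φ q.1 q.2 else 0 := by
  have hinj : Set.InjOn (fun h => ((σ t).st h, (σ t).act h)) (range H : Set ℕ) := by
    intro h hh h' hh' heq
    rw [coe_range, Set.mem_Iio] at hh hh'
    have hlayer : L.layer ((σ t).st h) = L.layer ((σ t).st h') :=
      congrArg L.layer (congrArg Prod.fst heq)
    rwa [hc.layer_st t ht h hh.le, hc.layer_st t ht h' hh'.le] at hlayer
  rw [← sum_image (f := fun q : S × A => φ q.1 q.2) hinj, ← sum_filter]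
  refine sum_congr ?_ fun _ _ => rfl
  ext ⟨s, a⟩
  simp

lemma sum_visits (hc : IsConsistent L T σ pol) :
    ∑ q : S × A, (visits H σ (T + 1) q.1 q.2 : ℝ) = H * T := by
  classical
  calc ∑ q : S × A, (visits H σ (T + 1) q.1 q.2 : ℝ)
      = ∑ t ∈ Icc 1 T, ∑ q : S × A,
          if ∃ h < H, (σ t).st h = q.1 ∧ (σ t).act h = q.2 then (1 : ℝ) else 0 := by
        rw [sum_comm]
        refine sum_congr rfl fun q _ => ?_
        rw [visits, card_filter]
        push_cast
        rfl
    _ = ∑ _t ∈ Icc 1 T, (H : ℝ) := sum_congr rfl fun t ht => by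
        rw [← hc.sum_steps ht fun _ _ => 1, sum_const, card_range, nsmul_one]
    _ = H * T := by rw [sum_const, Nat.card_Icc, Nat.add_sub_cancel, nsmul_eq_mul, mul_comm]

lemma sum_div_sqrt_visits_le (hc : IsConsistent L T σ pol) :
    ∑ t ∈ Icc 1 T, ∑ h ∈ range H,
        1 / Real.sqrt (max 1 (visits H σ t ((σ t).st h) ((σ t).act h) : ℝ))
      ≤ 3 * Real.sqrt (Fintype.card S * Fintype.card A * (H * T)) := by
  classical
  calc _ = ∑ q : S × A, ∑ t ∈ Icc 1 T,
        (if ∃ h < H, (σ t).st h = q.1 ∧ (σ t).act h = q.2 then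
          1 / Real.sqrt (max 1 (visits H σ t q.1 q.2 : ℝ)) else 0) := by
        rw [sum_comm (t := Icc 1 T)]
        exact sum_congr rfl fun t ht => hc.sum_steps ht
          fun s a => 1 / Real.sqrt (max 1 (visits H σ t s a : ℝ))
    _ ≤ ∑ q : S × A, 3 * Real.sqrt (visits H σ (T + 1) q.1 q.2) :=
        sum_le_sum fun q _ => sum_visited_div_sqrt_le q.1 q.2 T
    _ ≤ 3 * Real.sqrt (Fintype.card S * Fintype.card A * (H * T)) := by
        rw [← mul_sum, ← hc.sum_visits, ← Nat.cast_mul, ← Fintype.card_prod]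
        exact mul_le_mul_of_nonneg_left
          (sum_sqrt_le_sqrt_card_mul_sum fun _ => Nat.cast_nonneg _) zero_le_three

end IsConsistent

end VisitSums

section RoundRegret

lemma abs_le_div_add {b w : ℝ} (hb : 0 < b) (hw : 0 < w) (d : ℝ) :
    |d| ≤ b / w + w * d ^ 2 / (4 * b) := by
  have hsquare : b / w + w * d ^ 2 / (4 * b) - |d| = (w * |d| - 2 * b) ^ 2 / (4 * b * w) := by
    rw [← sq_abs d]
    field_simp
    ring
  exact sub_nonneg.1 (hsquare ▸ by positivity)

variable {C S A : Type*} [Fintype C] [Fintype S] {H T : ℕ} {M : CMDP C S A H}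
  {σ : ℕ → Episode C S A} {pol : ℕ → C → S → A} {F : Finset (C → S → A → ℝ)} {δ pmin : ℝ}

namespace CMDP

lemma V_mem_Icc (M : CMDP C S A H) (c : C) (π : S → A) : M.V c π ∈ Set.Icc (0 : ℝ) H :=
  M.isDynamics.value_mem_Icc (fun s a _ => M.r_mem_Icc c s a) π
    (by rw [M.lay.layer_s0, zero_add])

lemma card_states [Nonempty A] (M : CMDP C S A H) : H + 1 ≤ Fintype.card S := by
  classical
  have hlayers : range (H + 1) ⊆ univ.image M.lay.layer := by
    intro h hh
    rw [mem_range] at hh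
    by_contra hempty
    simp only [mem_image, mem_univ, true_and, not_exists] at hempty
    have hsum := M.isDynamics.sum_occ (fun _ => Classical.arbitrary A) (by omega : h ≤ H)
    rw [sum_eq_zero fun s _ => M.isDynamics.occ_eq_zero _ (by omega) (hempty s)] at hsum
    exact zero_ne_one hsum
  calc H + 1 = #(range (H + 1)) := (card_range _).symm
    _ ≤ #(univ.image M.lay.layer) := card_le_card hlayers
    _ ≤ Fintype.card S := card_image_le

/-- The loss of the policy `p` against `πs` in one episode, in expectation over the context. -/
def expectedGap (M : CMDP C S A H) (πs p : C → S → A) : ℝ :=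
  ∑ c, M.D c * (M.V c (πs c) - M.V c (p c))

lemma expectedGap_le (M : CMDP C S A H) (πs p : C → S → A) : M.expectedGap πs p ≤ H := by
  calc M.expectedGap πs p ≤ ∑ c, M.D c * (H : ℝ) :=
        sum_le_sum fun c _ => mul_le_mul_of_nonneg_left
          (by linarith [(M.V_mem_Icc c (πs c)).2, (M.V_mem_Icc c (p c)).1]) (M.D_nonneg c)
    _ = H := by rw [← sum_mul, M.D_sum, one_mul]

/-- The expected sum of the confidence radii of round `t`, truncated at `1`, along an episode that
is played with `p`. -/
def expectedRadius [Fintype A] (M : CMDP C S A H) (T : ℕ) (δ : ℝ) (σ : ℕ → Episode C S A) (t : ℕ)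
    (p : C → S → A) : ℝ :=
  ∑ c, M.D c * expectedSum M.lay M.P (p c) fun s => min 1 (xi H T δ σ t s (p c s))

lemma expectedRadius_nonneg [Fintype A] (M : CMDP C S A H) (T : ℕ) (δ : ℝ)
    (σ : ℕ → Episode C S A) (t : ℕ) (p : C → S → A) : 0 ≤ M.expectedRadius T δ σ t p :=
  sum_nonneg fun c _ => mul_nonneg (M.D_nonneg c)
    (expectedSum_nonneg M.isDynamics _ fun _ _ =>
      le_min zero_le_one (mul_nonneg zero_le_two (Real.sqrt_nonneg _)))

/-- The sum over the states of the inverse number of earlier rounds whose policy agrees with that of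
round `t`, in expectation over the context: the bonuses of round `t` up to normalization. -/
def expectedInvCount (M : CMDP C S A H) (pol : ℕ → C → S → A) (t : ℕ) : ℝ :=
  ∑ c, M.D c * ∑ s with M.lay.layer s < H, 1 / countBefore (fun i => pol i c s) t (pol t c s)

lemma expectedInvCount_nonneg (M : CMDP C S A H) (pol : ℕ → C → S → A) (t : ℕ) :
    0 ≤ M.expectedInvCount pol t := by
  classical
  exact sum_nonneg fun c _ => mul_nonneg (M.D_nonneg c) (sum_nonneg fun s _ =>
    one_div_nonneg.2 (sum_nonneg fun i _ => by split_ifs <;> norm_num))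

lemma MinReach.sum_countBefore_mul_le (hreach : M.MinReach pmin) (f : C → S → A → ℝ) (t : ℕ)
    (c : C) (π : S → A) :
    ∑ s with M.lay.layer s < H, pmin * countBefore (fun i => pol i c s) t (π s)
        * (f c s (π s) - M.r c s (π s)) ^ 2
      ≤ ∑ i ∈ Ico 1 t, M.sqErr f (pol i) c := by
  classical
  simp only [sqErr, expectedSum_eq_sum_layer M.isDynamics]
  rw [sum_comm]
  refine sum_le_sum fun s _ => ?_
  rw [countBefore, mul_sum, sum_mul]
  refine sum_le_sum fun i _ => ?_
  split_ifs with hplayed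
  · rw [hplayed, mul_one]
    exact mul_le_mul_of_nonneg_right (hreach (pol i c) s) (sq_nonneg _)
  · rw [mul_zero, zero_mul]
    exact mul_nonneg (M.isDynamics.occ_nonneg (pol i c) (M.lay.layer_le s) s) (sq_nonneg _)

end CMDP

namespace IsRun

variable [Fintype A] {enum : Fin (Fintype.card A) ≃ A}

lemma exists_played (hrun : IsRun M.lay F T δ pmin enum σ pol) (c : C) (s : S) (a : A) :
    ∃ i ∈ Icc 1 (Fintype.card A), pol i c s = a := by
  refine ⟨enum.symm a + 1, ?_, ?_⟩
  · rw [mem_Icc]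
    omega
  · rw [hrun.init, Equiv.apply_symm_apply]

lemma V_sub_V_le [Nonempty A] (hrun : IsRun M.lay F T δ pmin enum σ pol) (hpmin : 0 < pmin)
    (hreach : M.MinReach pmin) {t : ℕ} (ht : Fintype.card A < t)
    (hconf : ∀ s a, M.lay.layer s < H → ∑ s', |empP H σ t s a s' - M.P s a s'| ≤ xi H T δ σ t s a)
    {f : C → S → A → ℝ} (hf : ∀ c s a, f c s a ∈ Set.Icc (0 : ℝ) 1) {b : ℝ} (hb : 0 < b) {c : C}
    (hFOA : IsFOA M.lay (empP H σ t) (xi H T δ σ t) (rhat b pmin f pol t c) (pol t c))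
    (π : S → A) :
    M.V c π - M.V c (pol t c) ≤ (∑ i ∈ Ico 1 t, M.sqErr f (pol i) c) / (2 * b)
      + 2 * (b / pmin * ∑ s with M.lay.layer s < H,
          1 / countBefore (fun i => pol i c s) t (pol t c s))
      + 2 * H * expectedSum M.lay M.P (pol t c) fun s => min 1 (xi H T δ σ t s (pol t c s)) := by
  let w : S → A → ℝ := fun s a => pmin * countBefore (fun i => pol i c s) t a
  have hw : ∀ s a, 0 < w s a := fun s a => mul_pos hpmin
    (one_pos.trans_le (one_le_countBefore_of_exists (hrun.exists_played c s) ht a))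
  have herr : ∀ p : S → A,
      expectedSum M.lay M.P p (fun s => w s (p s) * (f c s (p s) - M.r c s (p s)) ^ 2 / (4 * b))
        ≤ (∑ i ∈ Ico 1 t, M.sqErr f (pol i) c) / (4 * b) := fun p => by
    refine (expectedSum_le_sum M.isDynamics p fun s => ?_).trans ?_
    · have := hw s (p s)
      positivity
    · rw [← sum_div]
      exact div_le_div_of_nonneg_right (hreach.sum_countBefore_mul_le f t c p) (by positivity)
  have hopt := hFOA.value_sub_value_le (f := f c) (b := fun s a => b / w s a) M.isDynamics hconf
    (hf c) (fun s a => (div_pos hb (hw s a)).le)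
    (g := fun s a => w s a * (f c s a - M.r c s a) ^ 2 / (4 * b))
    (fun s a => abs_le_div_add hb (hw s a) _) π
  have hbonus : b / pmin * ∑ s with M.lay.layer s < H,
      1 / countBefore (fun i => pol i c s) t (pol t c s)
        = ∑ s with M.lay.layer s < H, b / w s (pol t c s) := by
    simp only [w, mul_sum, div_mul_div_comm, mul_one]
  rw [hbonus]
  refine hopt.trans (add_le_add_left (add_le_add_left ?_ _) _)
  calc _ ≤ _ := add_le_add (herr π) (herr (pol t c))
    _ = _ := by field_simp; ring

lemma expectedGap_le [Nonempty A] (hrun : IsRun M.lay F T δ pmin enum σ pol) (hpmin : 0 < pmin)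
    (hreach : M.MinReach pmin) {t : ℕ} (ht : Fintype.card A < t)
    (hconf : ∀ s a, M.lay.layer s < H → ∑ s', |empP H σ t s a s' - M.P s a s'| ≤ xi H T δ σ t s a)
    {f : C → S → A → ℝ} (hf : ∀ c s a, f c s a ∈ Set.Icc (0 : ℝ) 1) {b : ℝ} (hb : 0 < b)
    (hFOA : ∀ c, IsFOA M.lay (empP H σ t) (xi H T δ σ t) (rhat b pmin f pol t c) (pol t c))
    (πs : C → S → A) :
    M.expectedGap πs (pol t)
      ≤ (∑ i ∈ Ico 1 t, ∑ c, M.D c * M.sqErr f (pol i) c) / (2 * b)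
        + 2 * (b / pmin * M.expectedInvCount pol t) + 2 * H * M.expectedRadius T δ σ t (pol t) := by
  refine (sum_le_sum fun c _ => mul_le_mul_of_nonneg_left
    (hrun.V_sub_V_le hpmin hreach ht hconf hf hb (hFOA c) (πs c)) (M.D_nonneg c)).trans_eq ?_
  rw [sum_comm, CMDP.expectedInvCount, CMDP.expectedRadius, sum_div]
  simp_rw [← mul_sum]
  rw [mul_sum, mul_sum, mul_sum, ← sum_add_distrib, ← sum_add_distrib]
  exact sum_congr rfl fun c _ => by ring

lemma sum_expectedInvCount_le [Nonempty A] (hrun : IsRun M.lay F T δ pmin enum σ pol)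
    (hAT : Fintype.card A ≤ T) :
    ∑ t ∈ Ico (Fintype.card A + 1) (T + 1), M.expectedInvCount pol t
      ≤ 2 * (Fintype.card S * Fintype.card A * Real.log (T / Fintype.card A)) := by
  have hA : (0 : ℝ) < Fintype.card A := by exact_mod_cast Fintype.card_pos
  have hlog : 0 ≤ Real.log (T / Fintype.card A) :=
    Real.log_nonneg (by rw [le_div_iff₀ hA, one_mul]; exact_mod_cast hAT)
  calc ∑ t ∈ Ico (Fintype.card A + 1) (T + 1), M.expectedInvCount pol t
      = ∑ c, M.D c * ∑ s with M.lay.layer s < H, ∑ t ∈ Ico (Fintype.card A + 1) (T + 1),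
          1 / countBefore (fun i => pol i c s) t (pol t c s) := by
        simp only [CMDP.expectedInvCount]
        rw [sum_comm]
        exact sum_congr rfl fun c _ => by rw [← mul_sum, sum_comm]
    _ ≤ ∑ c, M.D c * ∑ s with M.lay.layer s < H,
          2 * (Fintype.card A * Real.log (T / Fintype.card A)) :=
        sum_le_sum fun c _ => mul_le_mul_of_nonneg_left (sum_le_sum fun s _ =>
          sum_one_div_countBefore_le (hrun.exists_played c s) hAT) (M.D_nonneg c)
    _ = #{s | M.lay.layer s < H} * (2 * (Fintype.card A * Real.log (T / Fintype.card A))) := by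
        rw [← sum_mul, M.D_sum, one_mul, sum_const, nsmul_eq_mul]
    _ ≤ Fintype.card S * (2 * (Fintype.card A * Real.log (T / Fintype.card A))) :=
        mul_le_mul_of_nonneg_right (by exact_mod_cast card_le_univ _) (by positivity)
    _ = 2 * (Fintype.card S * Fintype.card A * Real.log (T / Fintype.card A)) := by ring

end IsRun

end RoundRegret

section Tuning

variable {S A : Type*} [Fintype S] [Fintype A] {n t T : ℕ} {δ : ℝ}

lemma one_lt_regression_ratio (hn : 0 < n) (ht : 0 < t) (hδ : 0 < δ) (hδ1 : δ < 1) :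
    1 < 8 * n * (t : ℝ) ^ 3 / δ := by
  have h1 : (1 : ℝ) ≤ n * (t : ℝ) ^ 3 := by
    exact_mod_cast Nat.one_le_iff_ne_zero.2 (by positivity)
  rw [lt_div_iff₀ hδ]
  linarith

lemma log_regression_ratio_mono (hn : 0 < n) (ht : 0 < t) (htT : t ≤ T) (hδ : 0 < δ) :
    Real.log (8 * n * (t : ℝ) ^ 3 / δ) ≤ Real.log (8 * n * (T : ℝ) ^ 3 / δ) := by
  gcongr

lemma beta_pos [Nonempty S] [Nonempty A] (hn : 0 < n) (ht : 0 < t) (hδ : 0 < δ) (hδ1 : δ < 1) :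
    0 < beta S A n δ t := by
  have hlog := Real.log_pos (one_lt_regression_ratio hn ht hδ hδ1)
  exact Real.sqrt_pos.2 (by positivity)

lemma beta_mono (hn : 0 < n) (ht : 0 < t) (htT : t ≤ T) (hδ : 0 < δ) (hδ1 : δ < 1) :
    beta S A n δ t ≤ beta S A n δ T := by
  have hlog := Real.log_pos (one_lt_regression_ratio hn ht hδ hδ1)
  unfold beta
  gcongr

lemma log_div_beta_le [Nonempty S] [Nonempty A] (hn : 0 < n) (ht : 0 < t) (htT : t ≤ T)
    (hδ : 0 < δ) (hδ1 : δ < 1) :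
    Real.log (8 * n * (t : ℝ) ^ 3 / δ) / beta S A n δ t
      ≤ Real.sqrt (Fintype.card S * Fintype.card A * Real.log (8 * n * (T : ℝ) ^ 3 / δ))
        * (1 / Real.sqrt t) := by
  have hmono := log_regression_ratio_mono hn ht htT hδ
  have hpos := Real.log_pos (one_lt_regression_ratio hn ht hδ hδ1)
  have hβ := beta_pos (S := S) (A := A) hn ht hδ hδ1
  set l := Real.log (8 * n * (t : ℝ) ^ 3 / δ) with hl
  set l' := Real.log (8 * n * (T : ℝ) ^ 3 / δ)
  have hl' : 0 < l' := hpos.trans_le hmono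
  rw [mul_one_div, div_le_div_iff₀ hβ (Real.sqrt_pos.2 (Nat.cast_pos.2 ht)), beta, ← hl,
    ← Real.sqrt_mul (by positivity)]
  refine Real.le_sqrt_of_sq_le ?_
  calc (l * Real.sqrt t) ^ 2 = t * l * l := by rw [mul_pow, Real.sq_sqrt t.cast_nonneg]; ring
    _ ≤ t * l * (17 * l') := by gcongr; linarith
    _ = Fintype.card S * Fintype.card A * l'
          * (17 * t * l / (Fintype.card S * Fintype.card A)) := by field_simp

/-- The sum over `T` rounds of the regression errors for a class of `n` functions, up to the factors
`H` and `1 / pmin`. -/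
def regressionTerm (s a n T : ℕ) (δ : ℝ) : ℝ :=
  Real.sqrt (s * a * T * Real.log (8 * n * (T : ℝ) ^ 3 / δ))

lemma regressionTerm_nonneg (s a n T : ℕ) (δ : ℝ) : 0 ≤ regressionTerm s a n T δ :=
  Real.sqrt_nonneg _

lemma sqrt_mul_log_mul_sqrt (s a n T : ℕ) (δ : ℝ) :
    Real.sqrt (s * a * Real.log (8 * n * (T : ℝ) ^ 3 / δ)) * Real.sqrt T
      = regressionTerm s a n T δ := by
  rw [← Real.sqrt_mul' _ T.cast_nonneg, regressionTerm, mul_right_comm]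

lemma beta_mul_card_le [Nonempty S] [Nonempty A] (n T : ℕ) (δ : ℝ) :
    beta S A n δ T * (Fintype.card S * Fintype.card A)
      ≤ 5 * regressionTerm (Fintype.card S) (Fintype.card A) n T δ := by
  have hsqrt : Real.sqrt 17 ≤ 5 := Real.sqrt_le_iff.2 (by norm_num)
  have hbeta : beta S A n δ T * (Fintype.card S * Fintype.card A)
      = Real.sqrt 17 * regressionTerm (Fintype.card S) (Fintype.card A) n T δ := by
    rw [beta, regressionTerm, ← Real.sqrt_mul (by norm_num),
      ← Real.sqrt_sq (by positivity : (0 : ℝ) ≤ Fintype.card S * Fintype.card A),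
      ← Real.sqrt_mul' _ (sq_nonneg _), Real.sqrt_sq (by positivity)]
    congr 1
    field_simp
  rw [hbeta]
  exact mul_le_mul_of_nonneg_right hsqrt (regressionTerm_nonneg ..)

end Tuning

section DynamicsTerm

variable {x δ : ℝ}

lemma one_le_log_div (hx : 8 ≤ x) (hδ : 0 < δ) (hδ1 : δ < 1) : 1 ≤ Real.log (x / δ) := by
  rw [Real.le_log_iff_exp_le (by positivity), le_div_iff₀ hδ]
  exact (mul_le_of_le_one_right (Real.exp_pos 1).le hδ1.le).trans
    (by linarith [Real.exp_one_lt_d9])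

lemma log_four_mul_div_le (hx : 8 ≤ x) (hδ : 0 < δ) (hδ1 : δ < 1) :
    Real.log (4 * x / δ) ≤ 2 * Real.log (x / δ) := by
  have hfour : Real.log 4 ≤ Real.log (x / δ) := by
    refine Real.log_le_log (by norm_num) ?_
    rw [le_div_iff₀ hδ]
    linarith
  rw [mul_div_assoc, Real.log_mul (by norm_num) (by positivity)]
  linarith

lemma sqrt_add_two_mul_log_le {s : ℝ} (hs : 1 ≤ s) (hx : 8 ≤ x) (hδ : 0 < δ) (hδ1 : δ < 1) :
    Real.sqrt (s + 2 * Real.log (4 * x / δ)) ≤ 3 * Real.sqrt s * Real.log (x / δ) := by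
  have hfour := log_four_mul_div_le hx hδ hδ1
  have hone := one_le_log_div hx hδ hδ1
  set l := Real.log (x / δ)
  rw [Real.sqrt_le_left (by positivity), mul_pow, mul_pow, Real.sq_sqrt (by positivity)]
  nlinarith [mul_nonneg (sub_nonneg.2 hs) (sub_nonneg.2 hone),
    mul_nonneg (zero_le_one.trans hs) (mul_nonneg (zero_le_one.trans hone) (sub_nonneg.2 hone))]

/-- The order of the part of the regret over `T` rounds that is due to the unknown dynamics. -/
def dynamicsTerm (H s a T : ℕ) (δ : ℝ) : ℝ :=
  (H : ℝ) ^ (3 / 2 : ℝ) * s * Real.sqrt (T * a) * Real.log (s * a * (T : ℝ) ^ 2 / δ)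

lemma dynamicsTerm_eq (H s a T : ℕ) (δ : ℝ) :
    dynamicsTerm H s a T δ
      = H * (Real.sqrt H * s * Real.sqrt (T * a) * Real.log (s * a * (T : ℝ) ^ 2 / δ)) := by
  have hrpow : (H : ℝ) ^ (3 / 2 : ℝ) = H * Real.sqrt H := by
    rw [Real.rpow_div_two_eq_sqrt 3 H.cast_nonneg, show (3 : ℝ) = (3 : ℕ) by norm_num,
      Real.rpow_natCast, pow_succ, Real.sq_sqrt H.cast_nonneg]
  rw [dynamicsTerm, hrpow]
  ring

lemma sq_mul_log_le_dynamicsTerm {H s a T : ℕ} (hHs : H ≤ s) (ha : 0 < a) (hT : 0 < T)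
    (h8 : (8 : ℝ) ≤ s * a * (T : ℝ) ^ 2) (hδ : 0 < δ) (hδ1 : δ < 1) :
    (H : ℝ) ^ 2 * Real.log (4 / δ) ≤ dynamicsTerm H s a T δ := by
  have hΛ := one_le_log_div h8 hδ hδ1
  have hfour : Real.log (4 / δ) ≤ Real.log (s * a * (T : ℝ) ^ 2 / δ) := by
    gcongr
    linarith
  set Λ := Real.log (s * a * (T : ℝ) ^ 2 / δ)
  have hTa : 1 ≤ Real.sqrt (T * a) := Real.one_le_sqrt.2 (by exact_mod_cast Nat.mul_pos hT ha)
  have hsqrtH : Real.sqrt H ≤ s := (Real.sqrt_le_left s.cast_nonneg).2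
    (by exact_mod_cast hHs.trans (Nat.le_self_pow two_ne_zero s))
  calc (H : ℝ) ^ 2 * Real.log (4 / δ) ≤ (H : ℝ) ^ 2 * Λ := by gcongr
    _ = H * (Real.sqrt H * Real.sqrt H * 1 * Λ) := by
        rw [Real.mul_self_sqrt H.cast_nonneg]
        ring
    _ ≤ H * (Real.sqrt H * s * Real.sqrt (T * a) * Λ) := by gcongr
    _ = dynamicsTerm H s a T δ := (dynamicsTerm_eq ..).symm

lemma IsConsistent.sum_min_xi_le {C S A : Type*} [Fintype S] [Fintype A] [Nonempty S] {H T : ℕ}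
    {L : Layering S H} {σ : ℕ → Episode C S A} {pol : ℕ → C → S → A}
    (hc : IsConsistent L T σ pol)
    (h8 : (8 : ℝ) ≤ Fintype.card S * Fintype.card A * (T : ℝ) ^ 2) (hδ : 0 < δ) (hδ1 : δ < 1) :
    ∑ t ∈ Icc 1 T, ∑ h ∈ range H,
        min 1 (xi H T δ σ t ((σ t).st h) (pol t (σ t).ctx ((σ t).st h)))
      ≤ 18 * (Real.sqrt H * Fintype.card S * Real.sqrt (T * Fintype.card A)
          * Real.log (Fintype.card S * Fintype.card A * (T : ℝ) ^ 2 / δ)) := by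
  have hs : (1 : ℝ) ≤ Fintype.card S := by exact_mod_cast Fintype.card_pos
  have hB := sqrt_add_two_mul_log_le hs h8 hδ hδ1
  simp only [← mul_assoc] at hB
  have hsqrt : Real.sqrt (Fintype.card S * Fintype.card A * (H * T))
      = Real.sqrt (Fintype.card S) * (Real.sqrt H * Real.sqrt (T * Fintype.card A)) := by
    rw [← Real.sqrt_mul H.cast_nonneg, ← Real.sqrt_mul (Fintype.card S).cast_nonneg]
    congr 1
    ring
  set B : ℝ := Fintype.card S + 2 * Real.log (4 * Fintype.card S * Fintype.card A * (T : ℝ) ^ 2 / δ)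
    with hBdef
  set Λ := Real.log (Fintype.card S * Fintype.card A * (T : ℝ) ^ 2 / δ)
  calc _ ≤ ∑ t ∈ Icc 1 T, ∑ h ∈ range H, 2 * Real.sqrt B
          * (1 / Real.sqrt (max 1 (visits H σ t ((σ t).st h) ((σ t).act h) : ℝ))) := by
        refine sum_le_sum fun t ht => sum_le_sum fun h hh => ?_
        rw [← hc.act_eq t ht h (mem_range.1 hh)]
        refine (min_le_right _ _).trans_eq ?_
        rw [xi, ← hBdef, Real.sqrt_div' _ (zero_le_one.trans (le_max_left _ _)), mul_one_div,
          mul_div_assoc]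
    _ ≤ 2 * (3 * Real.sqrt (Fintype.card S) * Λ)
          * (3 * Real.sqrt (Fintype.card S * Fintype.card A * (H * T))) := by
        simp only [← mul_sum]
        have hΛ : 0 ≤ Λ := zero_le_one.trans (one_le_log_div h8 hδ hδ1)
        exact mul_le_mul (mul_le_mul_of_nonneg_left hB zero_le_two) hc.sum_div_sqrt_visits_le
          (by positivity) (by positivity)
    _ = 18 * (Real.sqrt H * (Real.sqrt (Fintype.card S) * Real.sqrt (Fintype.card S))
          * Real.sqrt (T * Fintype.card A) * Λ) := by
        rw [hsqrt]
        ring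
    _ = _ := by rw [Real.mul_self_sqrt (Fintype.card S).cast_nonneg]

end DynamicsTerm

section CumulativeRegret

variable {C S A : Type*} [Fintype C] [Fintype S] [Fintype A] {H T : ℕ} {M : CMDP C S A H}
  {σ : ℕ → Episode C S A} {pol : ℕ → C → S → A} {F : Finset (C → S → A → ℝ)} {f₀ : C → S → A → ℝ}
  {δ pmin : ℝ} {πs : C → S → A} {enum : Fin (Fintype.card A) ≃ A}

/-- The histories on which the concentration inequalities of the analysis hold: the regression
oracle has small expected squared error relative to the function `f₀`, the dynamics lie in the
confidence sets, and the observed contexts and states are typical for the policies played. Each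
field fails with probability at most `δ / 4`. -/
structure IsConcentrated (M : CMDP C S A H) (F : Finset (C → S → A → ℝ)) (f₀ : C → S → A → ℝ)
    (T : ℕ) (δ : ℝ) (πs : C → S → A) (σ : ℕ → Episode C S A) (pol : ℕ → C → S → A) : Prop where
  regression : ∀ t ∈ Icc 1 T, ∀ f ∈ F, ∑ i ∈ Ico 1 t, ∑ c, M.D c * M.sqErr f (pol i) c
    ≤ 4 * (sqLoss H σ t f - sqLoss H σ t f₀) + 4 * H * Real.log (8 * #F * (t : ℝ) ^ 3 / δ)
  confidence : ∀ t ∈ Icc 1 T, ∀ s a, M.lay.layer s < H →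
    ∑ s', |empP H σ t s a s' - M.P s a s'| ≤ xi H T δ σ t s a
  contexts : regret M T πs σ pol
    ≤ 2 * ∑ t ∈ Icc 1 T, M.expectedGap πs (pol t) + H * Real.log (4 / δ)
  visited : ∑ t ∈ Icc 1 T, M.expectedRadius T δ σ t (pol t)
    ≤ 2 * ∑ t ∈ Icc 1 T, ∑ h ∈ range H,
        min 1 (xi H T δ σ t ((σ t).st h) (pol t (σ t).ctx ((σ t).st h)))
      + 2 * H * Real.log (4 / δ)

/-- The order of the regret for horizon `H`, `s` states and `a` actions, where `e` is the
`regressionTerm` of the function class or an upper bound of it. -/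
def regretBound (H s a T : ℕ) (δ pmin e : ℝ) : ℝ :=
  dynamicsTerm H s a T δ + (H + (1 + Real.log (T / a)) / pmin) * e + a * H

lemma log_rounds_div_actions_nonneg {a T : ℕ} (ha : 0 < a) (haT : a ≤ T) :
    0 ≤ Real.log ((T : ℝ) / a) :=
  Real.log_nonneg ((one_le_div (Nat.cast_pos.2 ha)).2 (Nat.cast_le.2 haT))

lemma regretBound_nonneg (H : ℕ) {s a T : ℕ} {e : ℝ} (hs : 0 < s) (ha : 0 < a) (haT : a ≤ T)
    (hδ : 0 < δ) (hδ1 : δ < 1) (hpmin : 0 < pmin) (he : 0 ≤ e) :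
    0 ≤ regretBound H s a T δ pmin e := by
  have hlog := log_rounds_div_actions_nonneg ha haT
  have hΛ : 0 ≤ Real.log (s * a * (T : ℝ) ^ 2 / δ) := by
    have hsaT : (1 : ℝ) ≤ s * a * (T : ℝ) ^ 2 := by
      exact_mod_cast Nat.mul_pos (Nat.mul_pos hs ha) (Nat.pow_pos (ha.trans_le haT))
    exact Real.log_nonneg ((one_le_div hδ).2 (hδ1.le.trans hsaT))
  unfold regretBound dynamicsTerm
  positivity

lemma regretBound_le_regretBound (H s : ℕ) {a T : ℕ} {e e' : ℝ} (δ : ℝ) (ha : 0 < a) (haT : a ≤ T)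
    (hpmin : 0 < pmin) (he : e ≤ e') :
    regretBound H s a T δ pmin e ≤ regretBound H s a T δ pmin e' := by
  have hlog := log_rounds_div_actions_nonneg ha haT
  unfold regretBound
  gcongr

lemma CMDP.eight_le_card_mul_card_mul_sq [Nonempty A] (M : CMDP C S A H) (hH : 0 < H)
    (hT : Fintype.card S * Fintype.card A ≤ T) :
    (8 : ℝ) ≤ Fintype.card S * Fintype.card A * (T : ℝ) ^ 2 := by
  have hSA : 2 ≤ Fintype.card S * Fintype.card A :=
    le_mul_of_le_of_one_le (by have := M.card_states; omega) Fintype.card_pos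
  exact_mod_cast Nat.mul_le_mul hSA (Nat.pow_le_pow_left (hSA.trans hT) 2)

lemma IsRun.two_mul_sum_bonus_le [Nonempty A] (hrun : IsRun M.lay F T δ pmin enum σ pol)
    (hAT : Fintype.card A ≤ T) (hpmin : 0 < pmin) :
    2 * (beta S A #F δ T / pmin
        * ∑ t ∈ Ico (Fintype.card A + 1) (T + 1), M.expectedInvCount pol t)
      ≤ 20 * (Real.log (T / Fintype.card A) / pmin)
        * regressionTerm (Fintype.card S) (Fintype.card A) #F T δ := by
  have : Nonempty S := ⟨M.lay.s0⟩
  have hβ : 0 ≤ beta S A #F δ T := Real.sqrt_nonneg _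
  have hG := log_rounds_div_actions_nonneg Fintype.card_pos hAT
  set G := Real.log ((T : ℝ) / Fintype.card A)
  set Q := regressionTerm (Fintype.card S) (Fintype.card A) #F T δ
  calc _ ≤ 2 * (beta S A #F δ T / pmin * (2 * (Fintype.card S * Fintype.card A * G))) := by
        gcongr
        exact hrun.sum_expectedInvCount_le hAT
    _ = 4 * (G / pmin) * (beta S A #F δ T * (Fintype.card S * Fintype.card A)) := by ring
    _ ≤ 4 * (G / pmin) * (5 * Q) :=
        mul_le_mul_of_nonneg_left (beta_mul_card_le #F T δ) (by positivity)
    _ = 20 * (G / pmin) * Q := by ring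

namespace IsConcentrated

lemma expectedGap_le [Nonempty A] (hgood : IsConcentrated M F f₀ T δ πs σ pol)
    (hrun : IsRun M.lay F T δ pmin enum σ pol) (hδ : 0 < δ) (hδ1 : δ < 1) (hpmin : 0 < pmin)
    (hreach : M.MinReach pmin) (hF : ∀ f ∈ F, ∀ c s a, f c s a ∈ Set.Icc (0 : ℝ) 1) (hf₀F : f₀ ∈ F)
    {t : ℕ} (ht : t ∈ Ico (Fintype.card A + 1) (T + 1)) :
    M.expectedGap πs (pol t)
      ≤ 2 * H * (Real.sqrt (Fintype.card S * Fintype.card A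
            * Real.log (8 * #F * (T : ℝ) ^ 3 / δ)) * (1 / Real.sqrt t))
        + 2 * (beta S A #F δ T / pmin * M.expectedInvCount pol t)
        + 2 * H * M.expectedRadius T δ σ t (pol t) := by
  have : Nonempty S := ⟨M.lay.s0⟩
  obtain ⟨hAt, htT⟩ := mem_Ico.1 ht
  have ht0 : 0 < t := Nat.zero_lt_of_lt hAt
  have htmem : t ∈ Icc 1 T := mem_Icc.2 ⟨ht0, Nat.lt_succ_iff.1 htT⟩
  have hF0 : 0 < #F := card_pos.2 ⟨f₀, hf₀F⟩
  obtain ⟨f, ⟨hfF, hfmin⟩, hFOA⟩ := hrun.step t hAt (mem_Icc.1 htmem).2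
  have hβ := beta_pos (S := S) (A := A) hF0 ht0 hδ hδ1
  have hβT := beta_mono (S := S) (A := A) hF0 ht0 (mem_Icc.1 htmem).2 hδ hδ1
  have hsqErr : ∑ i ∈ Ico 1 t, ∑ c, M.D c * M.sqErr f (pol i) c
      ≤ 4 * H * Real.log (8 * #F * (t : ℝ) ^ 3 / δ) := by
    linarith [hgood.regression t htmem f hfF, hfmin f₀ hf₀F]
  have hregression : (∑ i ∈ Ico 1 t, ∑ c, M.D c * M.sqErr f (pol i) c) / (2 * beta S A #F δ t)
      ≤ 2 * H * (Real.sqrt (Fintype.card S * Fintype.card A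
            * Real.log (8 * #F * (T : ℝ) ^ 3 / δ)) * (1 / Real.sqrt t)) :=
    calc _ ≤ 4 * H * Real.log (8 * #F * (t : ℝ) ^ 3 / δ) / (2 * beta S A #F δ t) := by gcongr
      _ = 2 * H * (Real.log (8 * #F * (t : ℝ) ^ 3 / δ) / beta S A #F δ t) := by field_simp; ring
      _ ≤ _ := mul_le_mul_of_nonneg_left (log_div_beta_le hF0 ht0 (mem_Icc.1 htmem).2 hδ hδ1)
          (by positivity)
  refine (hrun.expectedGap_le hpmin hreach hAt (hgood.confidence t htmem) (hF f hfF) hβ hFOA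
    πs).trans ?_
  have := M.expectedInvCount_nonneg pol t
  gcongr

lemma two_mul_sum_expectedRadius_le [Nonempty A] (hgood : IsConcentrated M F f₀ T δ πs σ pol)
    (hc : IsConsistent M.lay T σ pol) (hH : 0 < H) (hT : Fintype.card S * Fintype.card A ≤ T)
    (hδ : 0 < δ) (hδ1 : δ < 1) :
    2 * H * ∑ t ∈ Icc 1 T, M.expectedRadius T δ σ t (pol t)
      ≤ 76 * dynamicsTerm H (Fintype.card S) (Fintype.card A) T δ := by
  have : Nonempty S := ⟨M.lay.s0⟩
  have h8 := M.eight_le_card_mul_card_mul_sq hH hT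
  have hHS : H ≤ Fintype.card S := by have := M.card_states; omega
  have hT0 : 0 < T := (Nat.mul_pos Fintype.card_pos Fintype.card_pos).trans_le hT
  calc 2 * H * ∑ t ∈ Icc 1 T, M.expectedRadius T δ σ t (pol t)
      ≤ 2 * H * (2 * (18 * (Real.sqrt H * Fintype.card S * Real.sqrt (T * Fintype.card A)
            * Real.log (Fintype.card S * Fintype.card A * (T : ℝ) ^ 2 / δ)))
          + 2 * H * Real.log (4 / δ)) := by
        have hobserved := hc.sum_min_xi_le h8 hδ hδ1
        have hvisited := hgood.visited
        gcongr
        linarith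
    _ = 72 * dynamicsTerm H (Fintype.card S) (Fintype.card A) T δ
          + 4 * ((H : ℝ) ^ 2 * Real.log (4 / δ)) := by rw [dynamicsTerm_eq]; ring
    _ ≤ _ := by linarith [sq_mul_log_le_dynamicsTerm hHS Fintype.card_pos hT0 h8 hδ hδ1]

lemma sum_expectedGap_le [Nonempty A] (hgood : IsConcentrated M F f₀ T δ πs σ pol)
    (hrun : IsRun M.lay F T δ pmin enum σ pol) (hc : IsConsistent M.lay T σ pol) (hH : 0 < H)
    (hT : Fintype.card S * Fintype.card A ≤ T) (hδ : 0 < δ) (hδ1 : δ < 1) (hpmin : 0 < pmin)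
    (hreach : M.MinReach pmin) (hF : ∀ f ∈ F, ∀ c s a, f c s a ∈ Set.Icc (0 : ℝ) 1)
    (hf₀F : f₀ ∈ F) :
    ∑ t ∈ Icc 1 T, M.expectedGap πs (pol t)
      ≤ Fintype.card A * H
        + (4 * H + 20 * (Real.log (T / Fintype.card A) / pmin))
          * regressionTerm (Fintype.card S) (Fintype.card A) #F T δ
        + 76 * dynamicsTerm H (Fintype.card S) (Fintype.card A) T δ := by
  have : Nonempty S := ⟨M.lay.s0⟩
  have hAT : Fintype.card A ≤ T := (Nat.le_mul_of_pos_left _ Fintype.card_pos).trans hT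
  set Q := regressionTerm (Fintype.card S) (Fintype.card A) #F T δ with hQ
  set G := Real.log ((T : ℝ) / Fintype.card A)
  set I := Ico (Fintype.card A + 1) (T + 1)
  have hinit : ∑ t ∈ Ico 1 (Fintype.card A + 1), M.expectedGap πs (pol t) ≤ Fintype.card A * H :=
    (sum_le_card_nsmul _ _ _ fun t _ => M.expectedGap_le πs (pol t)).trans_eq (by simp)
  have hregression : 2 * H * (Real.sqrt (Fintype.card S * Fintype.card A
      * Real.log (8 * #F * (T : ℝ) ^ 3 / δ)) * ∑ t ∈ I, 1 / Real.sqrt t) ≤ 4 * H * Q := by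
    rw [hQ, ← sqrt_mul_log_mul_sqrt]
    refine (mul_le_mul_of_nonneg_left (mul_le_mul_of_nonneg_left
      (sum_one_div_sqrt_le (Fintype.card A) T) (Real.sqrt_nonneg _)) (by positivity)).trans_eq ?_
    ring
  have hdynamics : 2 * H * ∑ t ∈ I, M.expectedRadius T δ σ t (pol t)
      ≤ 76 * dynamicsTerm H (Fintype.card S) (Fintype.card A) T δ :=
    (mul_le_mul_of_nonneg_left (sum_le_sum_of_subset_of_nonneg
      (Ico_subset_Ico_left (Nat.le_add_left 1 _)) fun t _ _ => M.expectedRadius_nonneg T δ σ t _)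
      (by positivity)).trans (hgood.two_mul_sum_expectedRadius_le hc hH hT hδ hδ1)
  have hlater := sum_le_sum fun t (ht : t ∈ I) =>
    hgood.expectedGap_le hrun hδ hδ1 hpmin hreach hF hf₀F ht
  simp only [sum_add_distrib, ← mul_sum] at hlater
  have hbonus := hrun.two_mul_sum_bonus_le (M := M) hAT hpmin
  have hsplit : ∑ t ∈ Icc 1 T, M.expectedGap πs (pol t)
      = ∑ t ∈ Ico 1 (Fintype.card A + 1), M.expectedGap πs (pol t)
        + ∑ t ∈ I, M.expectedGap πs (pol t) :=
    (sum_Ico_consecutive _ (by omega) (by omega)).symm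
  linarith

lemma regret_le [Nonempty A] (hgood : IsConcentrated M F f₀ T δ πs σ pol)
    (hrun : IsRun M.lay F T δ pmin enum σ pol) (hc : IsConsistent M.lay T σ pol) (hH : 0 < H)
    (hT : Fintype.card S * Fintype.card A ≤ T) (hδ : 0 < δ) (hδ1 : δ < 1) (hpmin : 0 < pmin)
    (hreach : M.MinReach pmin) (hF : ∀ f ∈ F, ∀ c s a, f c s a ∈ Set.Icc (0 : ℝ) 1)
    (hf₀F : f₀ ∈ F) :
    regret M T πs σ pol ≤ 153 * regretBound H (Fintype.card S) (Fintype.card A) T δ pmin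
      (regressionTerm (Fintype.card S) (Fintype.card A) #F T δ) := by
  have : Nonempty S := ⟨M.lay.s0⟩
  have hT0 : 0 < T := (Nat.mul_pos Fintype.card_pos Fintype.card_pos).trans_le hT
  have hHS : H ≤ Fintype.card S := by have := M.card_states; omega
  have hgap := hgood.sum_expectedGap_le hrun hc hH hT hδ hδ1 hpmin hreach hF hf₀F
  have hlog : H * Real.log (4 / δ)
      ≤ dynamicsTerm H (Fintype.card S) (Fintype.card A) T δ := by
    refine le_trans ?_ (sq_mul_log_le_dynamicsTerm hHS Fintype.card_pos hT0
      (M.eight_le_card_mul_card_mul_sq hH hT) hδ hδ1)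
    have hl : 0 ≤ Real.log (4 / δ) := Real.log_nonneg (by rw [le_div_iff₀ hδ]; linarith)
    exact mul_le_mul_of_nonneg_right (by exact_mod_cast Nat.le_self_pow two_ne_zero H) hl
  have hG := log_rounds_div_actions_nonneg (a := Fintype.card A) Fintype.card_pos
    ((Nat.le_mul_of_pos_left _ Fintype.card_pos).trans hT)
  have hQ := regressionTerm_nonneg (Fintype.card S) (Fintype.card A) #F T δ
  set Q := regressionTerm (Fintype.card S) (Fintype.card A) #F T δ
  set G := Real.log ((T : ℝ) / Fintype.card A)
  calc regret M T πs σ pol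
      ≤ 2 * (Fintype.card A * H + (4 * H + 20 * (G / pmin)) * Q
          + 76 * dynamicsTerm H (Fintype.card S) (Fintype.card A) T δ)
        + dynamicsTerm H (Fintype.card S) (Fintype.card A) T δ := by linarith [hgood.contexts]
    _ = 153 * dynamicsTerm H (Fintype.card S) (Fintype.card A) T δ
        + (8 * H + 40 * (G / pmin)) * Q + 2 * (Fintype.card A * H) := by ring
    _ ≤ 153 * dynamicsTerm H (Fintype.card S) (Fintype.card A) T δ
        + (153 * H + 153 * ((1 + G) / pmin)) * Q + 153 * (Fintype.card A * H) := by
        gcongr <;> linarith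
    _ = 153 * regretBound H (Fintype.card S) (Fintype.card A) T δ pmin Q := by
        rw [regretBound]
        ring

end IsConcentrated

end CumulativeRegret

section HighProbability

variable {C S A Ω : Type*} [Fintype C] [Fintype S] {H T : ℕ}
  {mΩ : MeasurableSpace Ω} {μ : Measure Ω} {M : CMDP C S A H}
  {𝓕 : Filtration ℕ mΩ} {σ : ℕ → Ω → Episode C S A} {pol : ℕ → Ω → C → S → A}
  {F : Finset (C → S → A → ℝ)} {f₀ : C → S → A → ℝ} {δ pmin : ℝ} {πs : C → S → A}

lemma ofReal_one_sub_le_of_compl_le [IsProbabilityMeasure μ] {E : Set Ω} (hδ : 0 ≤ δ)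
    (h : μ Eᶜ ≤ ENNReal.ofReal δ) : ENNReal.ofReal (1 - δ) ≤ μ E := by
  rw [ENNReal.ofReal_sub _ hδ, ENNReal.ofReal_one]
  refine tsub_le_iff_right.2 ?_
  calc 1 = μ (E ∪ Eᶜ) := by rw [Set.union_compl_self, measure_univ]
    _ ≤ μ E + μ Eᶜ := measure_union_le _ _
    _ ≤ μ E + ENNReal.ofReal δ := by gcongr

namespace IsInteraction

lemma measure_not_contexts_le [Finite A] [IsProbabilityMeasure μ] (hI : IsInteraction M T μ 𝓕 σ pol)
    (hH : 0 < H) (hopt : M.IsOptimal πs) (hδ : 0 < δ) :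
    μ {ω | ¬ regret M T πs (fun t => σ t ω) (fun t => pol t ω)
        ≤ 2 * ∑ t ∈ Icc 1 T, M.expectedGap πs (pol t ω) + H * Real.log (4 / δ)}
      ≤ ENNReal.ofReal (δ / 4) := by
  have hv : ∀ (p : C → S → A) (c : C), M.V c (πs c) - M.V c (p c) ∈ Set.Icc (0 : ℝ) H := fun p c =>
    ⟨sub_nonneg.2 (hopt c (p c)), by linarith [(M.V_mem_Icc c (πs c)).2, (M.V_mem_Icc c (p c)).1]⟩
  have hbound := hI.measure_contexts_le hH (v := fun p c => M.V c (πs c) - M.V c (p c)) hv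
    (le_refl (T + 1)) (by positivity : 0 < δ / 4)
  refine (measure_mono fun ω hω => ?_).trans hbound
  simp only [Set.mem_ofPred_eq, not_le] at hω ⊢
  rw [one_div_div, ← sub_div, le_div_iff₀ (Nat.cast_pos.2 hH)]
  unfold regret at hω
  unfold CMDP.expectedGap at hω
  change _ ≤ ∑ t ∈ Icc 1 T, _ - 2 * ∑ t ∈ Icc 1 T, _
  linarith

lemma measure_not_visited_le [Fintype A] [IsProbabilityMeasure μ]
    (hI : IsInteraction M T μ 𝓕 σ pol) (hH : 0 < H) (hδ : 0 < δ) :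
    μ {ω | ¬ ∑ t ∈ Icc 1 T, M.expectedRadius T δ (fun j => σ j ω) t (pol t ω)
        ≤ 2 * ∑ t ∈ Icc 1 T, ∑ h ∈ range H,
            min 1 (xi H T δ (fun j => σ j ω) t ((σ t ω).st h) (pol t ω (σ t ω).ctx ((σ t ω).st h)))
          + 2 * H * Real.log (4 / δ)}
      ≤ ENNReal.ofReal (δ / 4) := by
  have hbound := hI.measure_visited_le hH (u := fun N s a => min 1 (2 * Real.sqrt
      ((Fintype.card S + 2 * Real.log (4 * Fintype.card S * Fintype.card A * (T : ℝ) ^ 2 / δ))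
        / max 1 (N s a : ℝ))))
    (fun N s a => ⟨le_min zero_le_one (by positivity), min_le_left _ _⟩) (le_refl (T + 1))
    (by positivity : 0 < δ / 4)
  refine (measure_mono fun ω hω => ?_).trans hbound
  simp only [Set.mem_ofPred_eq, not_le] at hω ⊢
  rw [one_div_div, ← mul_div_mul_left _ (H : ℝ) (two_ne_zero' ℝ), ← sub_div,
    le_div_iff₀ (mul_pos two_pos (Nat.cast_pos.2 hH))]
  unfold CMDP.expectedRadius xi at hω
  change _ ≤ ∑ t ∈ Icc 1 T, _ - 2 * ∑ t ∈ Icc 1 T, _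
  linarith

lemma measure_not_isConcentrated_le [Fintype A] [Nonempty A] [IsProbabilityMeasure μ]
    (hI : IsInteraction M T μ 𝓕 σ pol) (hH : 0 < H) (hT : 0 < T) (hδ : 0 < δ) (hδ1 : δ < 1)
    (hF : ∀ f ∈ F, ∀ c s a, f c s a ∈ Set.Icc (0 : ℝ) 1) (hf₀F : f₀ ∈ F)
    (hf₀ : ∀ c s a, M.lay.layer s < H → f₀ c s a = M.r c s a) (hopt : M.IsOptimal πs) :
    μ {ω | ¬ IsConcentrated M F f₀ T δ πs (fun t => σ t ω) (fun t => pol t ω)}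
      ≤ ENNReal.ofReal δ := by
  have hquarter : 0 ≤ δ / 4 := by positivity
  calc _ ≤ μ (_ ∪ _ ∪ _ ∪ _) := measure_mono fun ω hω => ?_
    _ ≤ μ _ + μ _ + μ _ + μ _ := (measure_union_le _ _).trans (add_le_add_left
        ((measure_union_le _ _).trans (add_le_add_left (measure_union_le _ _) _)) _)
    _ ≤ ENNReal.ofReal (δ / 4) + ENNReal.ofReal (δ / 4) + ENNReal.ofReal (δ / 4)
          + ENNReal.ofReal (δ / 4) :=
        add_le_add (add_le_add (add_le_add (hI.measure_not_regression_le hH hF hf₀F hf₀ hδ)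
          (hI.measure_not_confidence_le hT hδ hδ1)) (hI.measure_not_contexts_le hH hopt hδ))
          (hI.measure_not_visited_le hH hδ)
    _ = ENNReal.ofReal δ := by
        rw [← ENNReal.ofReal_add hquarter hquarter, ← ENNReal.ofReal_add (by positivity) hquarter,
          ← ENNReal.ofReal_add (by positivity) hquarter]
        congr 1
        ring
  simp only [Set.mem_union, Set.mem_ofPred_eq, ← not_and_or]
  exact fun ⟨⟨⟨hreg, hconf⟩, hctx⟩, hvis⟩ => hω ⟨hreg, hconf, hctx, hvis⟩

lemma ofReal_one_sub_le_measure_regret [Fintype A] [Nonempty A] [IsProbabilityMeasure μ]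
    {enum : Fin (Fintype.card A) ≃ A} (hI : IsInteraction M T μ 𝓕 σ pol)
    (hrun : ∀ᵐ ω ∂μ, IsRun M.lay F T δ pmin enum (fun t => σ t ω) (fun t => pol t ω))
    (hT : Fintype.card S * Fintype.card A ≤ T) (hδ : 0 < δ) (hδ1 : δ < 1) (hpmin : 0 < pmin)
    (hreach : M.MinReach pmin) (hF : ∀ f ∈ F, ∀ c s a, f c s a ∈ Set.Icc (0 : ℝ) 1) (hf₀F : f₀ ∈ F)
    (hf₀ : ∀ c s a, M.lay.layer s < H → f₀ c s a = M.r c s a) (hopt : M.IsOptimal πs) :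
    ENNReal.ofReal (1 - δ) ≤ μ {ω | regret M T πs (fun t => σ t ω) (fun t => pol t ω)
      ≤ 153 * regretBound H (Fintype.card S) (Fintype.card A) T δ pmin
          (regressionTerm (Fintype.card S) (Fintype.card A) #F T δ)} := by
  have : Nonempty S := ⟨M.lay.s0⟩
  refine ofReal_one_sub_le_of_compl_le hδ.le ?_
  rcases H.eq_zero_or_pos with rfl | hH
  · have hbound := regretBound_nonneg 0 (Fintype.card_pos (α := S)) (Fintype.card_pos (α := A))
      ((Nat.le_mul_of_pos_left _ Fintype.card_pos).trans hT) hδ hδ1 hpmin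
      (regressionTerm_nonneg (Fintype.card S) (Fintype.card A) #F T δ)
    have hregret (ω : Ω) : regret M T πs (fun t => σ t ω) (fun t => pol t ω) = 0 :=
      sum_eq_zero fun t _ => sub_self (0 : ℝ)
    simp [hregret, hbound]
  · refine (measure_mono_ae ?_).trans (hI.measure_not_isConcentrated_le hH
      ((Nat.mul_pos Fintype.card_pos Fintype.card_pos).trans_le hT) hδ hδ1 hF hf₀F hf₀ hopt)
    filter_upwards [hrun, hI.ae_isConsistent] with ω hω hc hregret hgood
    exact hregret (hgood.regret_le hω hc hH hT hδ hδ1 hpmin hreach hF hf₀F)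

end IsInteraction

end HighProbability

section ProductClass

variable {C S A : Type*} [Fintype S] {F : Finset (C → S → A → ℝ)} {G : Finset (C → A → ℝ)}

lemma card_le_card_pow_of_forall_exists
    (hG : ∀ f ∈ F, ∃ g : S → C → A → ℝ, (∀ s, g s ∈ G) ∧ f = fun c s a => g s c a) :
    #F ≤ #G ^ Fintype.card S := by
  classical
  have hsub : F ⊆ (Fintype.piFinset fun _ : S => G).image fun g c s a => g s c a := by
    intro f hf
    obtain ⟨g, hg, rfl⟩ := hG f hf
    exact mem_image_of_mem _ (Fintype.mem_piFinset.2 hg)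
  exact ((card_le_card hsub).trans card_image_le).trans_eq (by simp)

lemma log_regression_ratio_le_mul {n m k T : ℕ} {δ : ℝ} (hn : 0 < n) (hk : k ≠ 0)
    (hnm : n ≤ m ^ k) (hT : 0 < T) (hδ : 0 < δ) (hδ1 : δ < 1) :
    Real.log (8 * n * (T : ℝ) ^ 3 / δ) ≤ k * Real.log (8 * m * (T : ℝ) ^ 3 / δ) := by
  have hratio := one_lt_regression_ratio Nat.one_pos hT hδ hδ1
  rw [Nat.cast_one, mul_one] at hratio
  rw [← Real.log_pow]
  refine Real.log_le_log (by positivity) ?_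
  calc 8 * (n : ℝ) * (T : ℝ) ^ 3 / δ = 8 * (T : ℝ) ^ 3 / δ * n := by ring
    _ ≤ (8 * (T : ℝ) ^ 3 / δ) ^ k * (m : ℝ) ^ k :=
        mul_le_mul (le_self_pow₀ hratio.le hk) (by exact_mod_cast hnm) n.cast_nonneg
          (by positivity)
    _ = (8 * (m : ℝ) * (T : ℝ) ^ 3 / δ) ^ k := by ring

lemma regressionTerm_le_mul_sqrt {n m k a T : ℕ} {δ : ℝ} (hn : 0 < n) (hk : k ≠ 0)
    (hnm : n ≤ m ^ k) (hT : 0 < T) (hδ : 0 < δ) (hδ1 : δ < 1) :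
    regressionTerm k a n T δ ≤ k * Real.sqrt (a * T * Real.log (8 * m * (T : ℝ) ^ 3 / δ)) := by
  have hlog := log_regression_ratio_le_mul hn hk hnm hT hδ hδ1
  refine Real.sqrt_le_iff.2 ⟨by positivity, ?_⟩
  have hlog0 := (Real.log_pos (one_lt_regression_ratio hn hT hδ hδ1)).le.trans hlog
  calc k * a * T * Real.log (8 * n * (T : ℝ) ^ 3 / δ)
      ≤ k * a * T * (k * Real.log (8 * m * (T : ℝ) ^ 3 / δ)) := by gcongr
    _ = (k : ℝ) ^ 2 * (a * T * Real.log (8 * m * (T : ℝ) ^ 3 / δ)) := by ring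
    _ = _ := by
        rw [mul_pow, Real.sq_sqrt]
        exact mul_nonneg (by positivity)
          (nonneg_of_mul_nonneg_right hlog0 (Nat.cast_pos.2 (Nat.pos_of_ne_zero hk)))

end ProductClass

end RMUCID

end

open RMUCID in
theorem mainTheorem2 :
    ∃ K : ℝ, 0 < K ∧
      ∀ (C S A Ω : Type*) [Fintype C] [Fintype S] [Fintype A] [Nonempty A]
        [mΩ : MeasurableSpace Ω] (μ : Measure Ω) [IsProbabilityMeasure μ]
        (H T : ℕ) (δ pmin : ℝ) (M : CMDP C S A H) (F : Finset (C → S → A → ℝ))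
        (πs : C → S → A) (enum : Fin (Fintype.card A) ≃ A)
        (𝓕 : Filtration ℕ mΩ) (σ : ℕ → Ω → Episode C S A) (pol : ℕ → Ω → C → S → A),
        Fintype.card S * Fintype.card A ≤ T →
        0 < δ → δ < 1 →
        0 < pmin → pmin ≤ 1 → M.MinReach pmin →
        (∀ f ∈ F, ∀ c s a, f c s a ∈ Set.Icc (0 : ℝ) 1) →
        (∃ f ∈ F, ∀ c s a, M.lay.layer s < H → f c s a = M.r c s a) →
        M.IsOptimal πs →
        IsInteraction M T μ 𝓕 σ pol →
        (∀ᵐ ω ∂μ, IsRun M.lay F T δ pmin enum (fun t => σ t ω) (fun t => pol t ω)) →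
        ENNReal.ofReal (1 - δ) ≤ μ {ω |
          regret M T πs (fun t => σ t ω) (fun t => pol t ω) ≤
            K * ((H : ℝ) ^ (3 / 2 : ℝ) * Fintype.card S * Real.sqrt (T * Fintype.card A)
                  * Real.log (Fintype.card S * Fintype.card A * (T : ℝ) ^ 2 / δ)
                + (H + (1 + Real.log (T / Fintype.card A)) / pmin)
                  * Real.sqrt (Fintype.card S * Fintype.card A * T
                      * Real.log (8 * (#F : ℝ) * (T : ℝ) ^ 3 / δ))
                + Fintype.card A * H)} ∧
        ∀ G : Finset (C → A → ℝ),
          (∀ f, f ∈ F ↔ ∃ g : S → C → A → ℝ, (∀ s, g s ∈ G) ∧ f = fun c s a => g s c a) →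
          ENNReal.ofReal (1 - δ) ≤ μ {ω |
            regret M T πs (fun t => σ t ω) (fun t => pol t ω) ≤
              K * ((H : ℝ) ^ (3 / 2 : ℝ) * Fintype.card S * Real.sqrt (T * Fintype.card A)
                    * Real.log (Fintype.card S * Fintype.card A * (T : ℝ) ^ 2 / δ)
                  + (H + (1 + Real.log (T / Fintype.card A)) / pmin)
                    * (Fintype.card S * Real.sqrt (Fintype.card A * T
                        * Real.log (8 * (#G : ℝ) * (T : ℝ) ^ 3 / δ)))
                  + Fintype.card A * H)} := by
  refine ⟨153, by norm_num, ?_⟩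
  intro C S A Ω _ _ _ _ mΩ μ _ H T δ pmin M F πs enum 𝓕 σ pol hT hδ hδ1 hpmin _ hreach hF
    ⟨f₀, hf₀F, hf₀⟩ hopt hI hrun
  have : Nonempty S := ⟨M.lay.s0⟩
  have hAT : Fintype.card A ≤ T := (Nat.le_mul_of_pos_left _ Fintype.card_pos).trans hT
  have hregret := hI.ofReal_one_sub_le_measure_regret hrun hT hδ hδ1 hpmin hreach hF hf₀F hf₀ hopt
  refine ⟨hregret, fun G hG => hregret.trans (measure_mono fun ω hω => ?_)⟩
  have hcard : #F ≤ #G ^ Fintype.card S := card_le_card_pow_of_forall_exists fun f => (hG f).1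
  have hproduct := regressionTerm_le_mul_sqrt (a := Fintype.card A) (card_pos.2 ⟨f₀, hf₀F⟩)
    Fintype.card_ne_zero hcard (Fintype.card_pos.trans_le hAT) hδ hδ1
  exact hω.trans (mul_le_mul_of_nonneg_left
    (regretBound_le_regretBound H _ δ Fintype.card_pos hAT hpmin hproduct) (by norm_num))
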